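/- Consider the following problem. An instance is a finite bipartite graph $G=(U,V,E)$ (with given sides $U,V$) and a set $F\subseteq E$. A bipartite graph is a chain graph if it has no induced $2K_2$, i.e. there are no $u_1,u_2\in U$, $v_1,v_2\in V$ such that $u_1v_1,u_2v_2$ are edges and $u_1v_2,u_2v_1$ are not. The task is to decide whether there are chain graphs $G_1=(U,V,E_1)$ and $G_2=(U,V,E_2)$ with $E=E_1\cup E_2$ and $E_1\cap F=\emptyset$, and to output such a pair $(G_1,G_2)$ if one exists. Let $m=|E|$, $\hat m=|U||V|-m$ (the number of edges of the bipartite complement of $G$) and $f=|F|$. Then there is a single algorithm which solves this problem for every instance, the graph $G$ and the set $F$ being given as edge lists, and which on instances with $m\ge 1$ and $\hat m\ge 1$ runs in time $$O\bigl(m\hat m+\min\{m^2,\ \hat m(\hat m+f)\}\bigr).$$ In the degenerate cases $m=0$ or $\hat m=0$ (where the expression above is $0$) it runs in time $O(|U|+|V|+m+1)$. Running time is the number of steps of a random access machine with words of $O(\log(|U|+|V|+m+2))$ bits. -/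

import Mathlib

namespace TwoChain

/-! ### Bipartite graphs, chain graphs and covers

A bipartite graph `(U, V, E)` with the two sides `U`, `V` is given by its edge set
`E : Finset (U × V)`; the edge set of its bipartite complement is `Eᶜ`. -/

/-- The edges `u₁v₁` and `u₂v₂` form an induced `2K₂` of the bipartite graph `(U, V, E)`.
(The vertices are then automatically distinct.) -/
def IsInduced2K2 {U V : Type*} (E : Finset (U × V)) (u₁ u₂ : U) (v₁ v₂ : V) : Prop :=
  (u₁, v₁) ∈ E ∧ (u₂, v₂) ∈ E ∧ (u₁, v₂) ∉ E ∧ (u₂, v₁) ∉ E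

/-- `(U, V, E)` is a chain graph: it has no induced `2K₂`. -/
def IsChainGraph {U V : Type*} (E : Finset (U × V)) : Prop :=
  ∀ (u₁ u₂ : U) (v₁ v₂ : V), ¬ IsInduced2K2 E u₁ u₂ v₁ v₂

/-- `(U, V, E₁)` and `(U, V, E₂)` are chain subgraphs of `(U, V, E)` that cover it, and the
first one has no edge in `F`. -/
structure IsRestrictedCover {U V : Type*} [DecidableEq U] [DecidableEq V]
    (E F E₁ E₂ : Finset (U × V)) : Prop where
  chain_left : IsChainGraph E₁
  chain_right : IsChainGraph E₂
  cover : E = E₁ ∪ E₂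
  avoids : Disjoint E₁ F

/-- The function inside the big-O, with `m` edges, `mh` edges in the bipartite complement and
`f` restricted edges. -/
def timeBound (m mh f : ℕ) : ℕ := m * mh + min (m ^ 2) (mh * (mh + f))

/-! ### A random access machine

The machine has registers and arrays, all of whose cells hold natural numbers. A program is a
finite structured program; it names its registers and arrays explicitly, so that it uses a fixed
finite number of them, and only array cells are addressed indirectly. (Interleaving the arrays
of a program in one memory changes the running time by a constant factor only.) -/

/-- A configuration of the memory. -/
structure State where
  /-- contents of the registers -/
  reg : ℕ → ℕ
  /-- `arr a i` is the content of cell `i` of array `a` -/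
  arr : ℕ → ℕ → ℕ

/-- The elementary instructions. -/
inductive Instr : Type
  /-- `r := k` -/
  | lit (r k : ℕ)
  /-- `r := x` -/
  | move (r x : ℕ)
  /-- `r := x + y` -/
  | add (r x y : ℕ)
  /-- `r := x - y`, truncated at `0` -/
  | sub (r x y : ℕ)
  /-- `r := x * y` -/
  | mul (r x y : ℕ)
  /-- `r := a[x]` -/
  | load (r a x : ℕ)
  /-- `a[x] := y` -/
  | store (a x y : ℕ)

/-- The number that an instruction writes. -/
def Instr.value (s : State) : Instr → ℕ
  | .lit _ k => k
  | .move _ x => s.reg x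
  | .add _ x y => s.reg x + s.reg y
  | .sub _ x y => s.reg x - s.reg y
  | .mul _ x y => s.reg x * s.reg y
  | .load _ a x => s.arr a (s.reg x)
  | .store _ _ y => s.reg y

/-- Write `v` to register `r`. -/
def State.setReg (s : State) (r v : ℕ) : State :=
  { s with reg := Function.update s.reg r v }

/-- Write `v` to cell `i` of array `a`. -/
def State.setArr (s : State) (a i v : ℕ) : State :=
  { s with arr := Function.update s.arr a (Function.update (s.arr a) i v) }

/-- The effect of an instruction. -/
def Instr.run (s : State) (i : Instr) : State :=
  match i with
  | .lit r _ => s.setReg r (i.value s)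
  | .move r _ => s.setReg r (i.value s)
  | .add r _ _ => s.setReg r (i.value s)
  | .sub r _ _ => s.setReg r (i.value s)
  | .mul r _ _ => s.setReg r (i.value s)
  | .load r _ _ => s.setReg r (i.value s)
  | .store a x _ => s.setArr a (s.reg x) (i.value s)

/-- The tests: comparisons of two registers. -/
inductive Test : Type
  | eq (x y : ℕ)
  | ne (x y : ℕ)
  | lt (x y : ℕ)
  | le (x y : ℕ)

/-- The outcome of a test. -/
def Test.Holds (s : State) : Test → Prop
  | .eq x y => s.reg x = s.reg y
  | .ne x y => s.reg x ≠ s.reg y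
  | .lt x y => s.reg x < s.reg y
  | .le x y => s.reg x ≤ s.reg y

/-- Programs. -/
inductive Program : Type
  | skip
  | instr (i : Instr)
  | seq (P Q : Program)
  | ite (b : Test) (P Q : Program)
  | while (b : Test) (P : Program)

/-- `Exec W P s t s'`: on a machine whose words hold the numbers `0, …, W - 1`, the program `P`
started in `s` halts after exactly `t` steps in `s'`. Each elementary instruction and each test
takes one step. An instruction whose result does not fit into a word has no successor state, so
a run that overflows does not count as halting. -/
inductive Exec (W : ℕ) : Program → State → ℕ → State → Prop
  | skip (s : State) : Exec W .skip s 1 s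
  | instr (i : Instr) (s : State) (h : i.value s < W) : Exec W (.instr i) s 1 (i.run s)
  | seq {P Q : Program} {s s' s'' : State} {t t' : ℕ} :
      Exec W P s t s' → Exec W Q s' t' s'' → Exec W (.seq P Q) s (t + t') s''
  | ite_true {b : Test} {P Q : Program} {s s' : State} {t : ℕ} :
      b.Holds s → Exec W P s t s' → Exec W (.ite b P Q) s (1 + t) s'
  | ite_false {b : Test} {P Q : Program} {s s' : State} {t : ℕ} :
      ¬ b.Holds s → Exec W Q s t s' → Exec W (.ite b P Q) s (1 + t) s'
  | while_true {b : Test} {P : Program} {s s' s'' : State} {t t' : ℕ} :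
      b.Holds s → Exec W P s t s' → Exec W (.while b P) s' t' s'' →
        Exec W (.while b P) s (1 + t + t') s''
  | while_false {b : Test} {P : Program} {s : State} :
      ¬ b.Holds s → Exec W (.while b P) s 1 s

/-! ### Input and output -/

/-- The list `l` enumerates the edge set `E` without repetition, in any order. -/
def Enumerates {p q : ℕ} (l : List (Fin p × Fin q)) (E : Finset (Fin p × Fin q)) : Prop :=
  l.Nodup ∧ ∀ e, e ∈ l ↔ e ∈ E

/-- The initial state for the graph with sides `{0, …, p - 1}` and `{0, …, q - 1}`, edge list
`lE` and list `lF` of restricted edges: registers `0, 1, 2, 3` hold `p`, `q` and the lengths of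
the two lists, arrays `0, 1` hold the end vertices of the edges of `lE` and arrays `2, 3` those
of the edges of `lF`. All other cells are `0`. -/
def inputState (p q : ℕ) (lE lF : List (Fin p × Fin q)) : State where
  reg r :=
    match r with
    | 0 => p
    | 1 => q
    | 2 => lE.length
    | 3 => lF.length
    | _ => 0
  arr a i :=
    match a with
    | 0 => (lE.map fun e => (e.1 : ℕ)).getD i 0
    | 1 => (lE.map fun e => (e.2 : ℕ)).getD i 0
    | 2 => (lF.map fun e => (e.1 : ℕ)).getD i 0
    | 3 => (lF.map fun e => (e.2 : ℕ)).getD i 0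
    | _ => 0

/-- In state `s`, register `r` and arrays `a`, `b` hold the length and the end vertices of a
repetition-free list of the edges in `E`. -/
def StoresEdges {p q : ℕ} (s : State) (r a b : ℕ) (E : Finset (Fin p × Fin q)) : Prop :=
  ∃ l : List (Fin p × Fin q), Enumerates l E ∧ s.reg r = l.length ∧
    ∀ (i : ℕ) (h : i < l.length), s.arr a i = (l[i].1 : ℕ) ∧ s.arr b i = (l[i].2 : ℕ)

/-- The final state `s` answers the instance `(E, F)`: either register `0` holds `1` and the two
graphs of a restricted cover are stored (the first in register `1` and arrays `0, 1`, the second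
in register `2` and arrays `2, 3`), or register `0` holds `0` and there is no restricted cover. -/
def IsAnswer {p q : ℕ} (E F : Finset (Fin p × Fin q)) (s : State) : Prop :=
  (s.reg 0 = 1 ∧ ∃ E₁ E₂ : Finset (Fin p × Fin q), IsRestrictedCover E F E₁ E₂ ∧
      StoresEdges s 1 0 1 E₁ ∧ StoresEdges s 2 2 3 E₂) ∨
    (s.reg 0 = 0 ∧ ¬ ∃ E₁ E₂ : Finset (Fin p × Fin q), IsRestrictedCover E F E₁ E₂)

end TwoChain

/-! Say that two edges are in conflict if they form an induced 2K₂. In a cover, conflicting edges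
lie in different graphs, because their cross pairs are nonedges. Hence S = E \ E₂ contains exactly
one edge of each conflict and avoids F. As E₁ is a chain graph without edges of F, S cannot contain
edges uv and ab for which ub is in F and av is a nonedge. These conditions (`IsColoring`) are
clauses with at most two literals, so a cover yields a solution of a 2-SAT instance
(`IsRestrictedCover.isColoring`).

The point is the converse: every solution can be turned into a cover. Edges without conflicts are
dropped from S (`IsColoring.tighten`). The remaining obstruction is a six-cycle whose three
antipodal pairs are nonedges and whose edges alternate between S and its complement. For a fixed
nonedge ab, all edges lying in such cycles opposite to ab are recoloured simultaneously (`flip`).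
This preserves the clauses (`IsTight.flip`), removes the cycles at ab (`not_alt_flip`) and creates
none at a nonedge that had none (`not_alt_flip_of_not_alt`), so a single pass over the nonedges
removes all of them. Then E \ S is a chain graph (`chain_right`). So is S together with those
conflict-free edges uv for which ub and av lie in S over some nonedge ab (`chain_closure`), and the
third kind of clause keeps these added edges out of F (`closure_avoid`).

For the running time, an induced 2K₂ consists of two edges and two nonedges, so all conflicts are
found from the pairs of whichever list is shorter, at cost min(m, m̂)² ≤ m m̂. The clauses from F
cost O(f m̂) with f ≤ m. The repair costs constant time for each edge and nonedge, because the test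
for an alternating six-cycle does not depend on the chosen conflict partner (`AltWith.shift`,
`alt_iff_of_conf`). The 2-SAT instance is solved by two depth-first searches of the implication
graph (`greedy_consistent`). All this is O(m m̂), the first summand of the bound; the minimum is not
needed.

On the machine, programs are written with counted loops in such a way that a step raises the stored
numbers by at most one, except for two address registers. Thus the running time also bounds the size
of the numbers, which excludes overflow (`exec_sem`) and bounds the number of stored arcs. -/

namespace TwoChain

/-! ### Conflict colourings -/

section Coloring

variable {U V : Type*} {E F S : U → V → Prop}

/-- The edges `uv` and `xy` form an induced `2K₂`. -/
def Conf (E : U → V → Prop) (u : U) (v : V) (x : U) (y : V) : Prop :=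
  E u v ∧ E x y ∧ ¬ E u y ∧ ¬ E x v

theorem Conf.symm {u x : U} {v y : V} (h : Conf E u v x y) : Conf E x y u v :=
  ⟨h.2.1, h.1, h.2.2.2, h.2.2.1⟩

/-- A set `S` of edges containing exactly one edge of each induced `2K₂`, avoiding `F`, and
not containing two edges whose cross pairs are an edge of `F` and a nonedge. -/
structure IsColoring (E F S : U → V → Prop) : Prop where
  restricted : ∀ {u v}, F u v → E u v
  sub : ∀ {u v}, S u v → E u v
  conf : ∀ {u v x y}, Conf E u v x y → (S u v ↔ ¬ S x y)
  avoid : ∀ {u v}, F u v → ¬ S u v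
  cross : ∀ {u b a v}, F u b → ¬ E a v → S u v → ¬ S a b

/-- A colouring whose set `S` contains only edges that lie in some induced `2K₂`. -/
structure IsTight (E F S : U → V → Prop) : Prop extends IsColoring E F S where
  noniso : ∀ {u v}, S u v → ∃ x y, Conf E u v x y

/-- Both edges of a conflict lie in a conflict, so the restriction leaves `conf` unchanged, while
`avoid` and `cross` only become easier for a smaller S. -/
theorem IsColoring.tighten (h : IsColoring E F S) :
    IsTight E F fun u v => S u v ∧ ∃ x y, Conf E u v x y where
  restricted := h.restricted
  sub hs := h.sub hs.1
  conf {u v x y} hc := by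
    have h1 : ∃ x y, Conf E u v x y := ⟨_, _, hc⟩
    have h2 : ∃ u v, Conf E x y u v := ⟨_, _, hc.symm⟩
    simpa only [h1, h2, and_true] using h.conf hc
  avoid hf hs := h.avoid hf hs.1
  cross hf hz h1 h2 := h.cross hf hz h1.1 h2.1
  noniso hs := hs.2

/-! ### Alternating six-cycles and their removal at one nonedge. -/

/-- The alternating six-cycle with the three nonedges `uy`, `xv`, `ab` whose edges have
alternating colours. -/
def AltWith (E S : U → V → Prop) (u : U) (v : V) (a : U) (b : V) (x : U) (y : V) : Prop :=
  Conf E u v x y ∧ ¬ E a b ∧ E u b ∧ E a v ∧ E x b ∧ E a y ∧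
    (S u b ↔ ¬ S u v) ∧ (S a v ↔ ¬ S u v)

/-- The edge `uv` lies in an alternating six-cycle whose opposite nonedge is `ab`. -/
def Alt (E S : U → V → Prop) (u : U) (v : V) (a : U) (b : V) : Prop :=
  ∃ x y, AltWith E S u v a b x y

/-- Change the colour of all edges in alternating six-cycles opposite to the nonedge `ab`. -/
def flip (E S : U → V → Prop) (a : U) (b : V) (u : U) (v : V) : Prop :=
  (S u v ∧ ¬ Alt E S u v a b) ∨ (¬ S u v ∧ Alt E S u v a b)

/-- The conflict partner of uv is irrelevant. If x'b were a nonedge, then x'y' would conflict with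
ub as well as with uv, so ub and uv would have the same colour, against the alternation; likewise
for ay'. Hence storing a single partner per edge suffices for the repair. -/
theorem AltWith.shift (h : IsColoring E F S) {u x x' a : U} {v y y' b : V}
    (hA : AltWith E S u v a b x y) (hc : Conf E u v x' y') : AltWith E S u v a b x' y' := by
  obtain ⟨h1, h2, h3, h4, h5, h6, h7, h8⟩ := hA
  have k := h.conf hc
  refine ⟨hc, h2, h3, h4, ?_, ?_, h7, h8⟩
  · by_contra hn
    have := h.conf (u := x') (v := y') (x := u) (y := b) ⟨hc.2.1, h3, hn, hc.2.2.1⟩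
    tauto
  · by_contra hn
    have := h.conf (u := x') (v := y') (x := a) (y := v) ⟨hc.2.1, h4, hc.2.2.2, hn⟩
    tauto

theorem AltWith.partner (h : IsColoring E F S) {u x a : U} {v y b : V}
    (hA : AltWith E S u v a b x y) : AltWith E S x y a b u v := by
  obtain ⟨h1, h2, h3, h4, h5, h6, h7, h8⟩ := hA
  have k := h.conf h1
  have k1 := h.conf (u := x) (v := b) (x := a) (y := v) ⟨h5, h4, h1.2.2.2, h2⟩
  have k2 := h.conf (u := a) (v := y) (x := u) (y := b) ⟨h6, h3, h2, h1.2.2.1⟩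
  exact ⟨h1.symm, h2, h5, h6, h3, h4, by tauto, by tauto⟩

/-- The same six-cycle seen from the edge `ub`. -/
theorem AltWith.rotate_right (h : IsColoring E F S) {u x a : U} {v y b : V}
    (hA : AltWith E S u v a b x y) : AltWith E S u b x v a y := by
  obtain ⟨h1, h2, h3, h4, h5, h6, h7, h8⟩ := hA
  have k1 := h.conf (u := x) (v := b) (x := a) (y := v) ⟨h5, h4, h1.2.2.2, h2⟩
  exact ⟨⟨h3, h6, h1.2.2.1, h2⟩, h1.2.2.2, h1.1, h5, h4, h1.2.1, by tauto, by tauto⟩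

/-- The same six-cycle seen from the edge `av`. -/
theorem AltWith.rotate_left (h : IsColoring E F S) {u x a : U} {v y b : V}
    (hA : AltWith E S u v a b x y) : AltWith E S a v u y x b := by
  obtain ⟨h1, h2, h3, h4, h5, h6, h7, h8⟩ := hA
  have k2 := h.conf (u := a) (v := y) (x := u) (y := b) ⟨h6, h3, h2, h1.2.2.1⟩
  exact ⟨⟨h4, h5, h2, h1.2.2.2⟩, h1.2.2.1, h6, h1.1, h1.2.1, h3, by tauto, by tauto⟩

theorem Alt.partner (h : IsColoring E F S) {u x a : U} {v y b : V}
    (hA : Alt E S u v a b) (hc : Conf E u v x y) : Alt E S x y a b := by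
  obtain ⟨x', y', hA⟩ := hA
  exact ⟨_, _, (hA.shift h hc).partner h⟩

/-- With a known partner xy the existential disappears and a constant number of table lookups
decides the matter. The colour condition is phrased so that one compares ub with av and then, if
they agree, may simply copy their colour to uv. -/
theorem alt_iff_of_conf (h : IsColoring E F S) {u x a : U} {v y b : V} (hc : Conf E u v x y) :
    Alt E S u v a b ↔
      ¬ E a b ∧ E u b ∧ E a v ∧ E x b ∧ E a y ∧ (S u b ↔ S a v) ∧ (S u b ↔ ¬ S u v) := by
  constructor
  · rintro ⟨x', y', hA⟩
    obtain ⟨h1, h2, h3, h4, h5, h6, h7, h8⟩ := hA.shift h hc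
    tauto
  · rintro ⟨h2, h3, h4, h5, h6, h7, h8⟩
    exact ⟨x, y, hc, h2, h3, h4, h5, h6, by tauto, by tauto⟩

/-- When cd is about to enter S, an edge uv of S that would violate `cross` together with cd must
leave S in the same flip. The clauses for ud in F force ub and av to be edges outside S; tightness
supplies a conflict partner of uv, which completes the six-cycle. -/
theorem Alt.of_cross_left (h : IsTight E F S) {c u a : U} {d v b : V}
    (hA : Alt E S c d a b) (hd : ¬ S c d) (hf : F u d) (hz : ¬ E c v) (he : S u v) :
    Alt E S u v a b := by
  obtain ⟨x₀, y₀, h1, h2, h3, h4, h5, h6, h7, h8⟩ := hA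
  have hS1 : S c b := by tauto
  have hS2 : S a d := by tauto
  have hx := h.conf (u := x₀) (v := b) (x := a) (y := d) ⟨h5, h4, h1.2.2.2, h2⟩
  have hub : E u b := by
    by_contra hn
    have := h.conf (u := u) (v := d) (x := x₀) (y := b) ⟨h.restricted hf, h5, hn, h1.2.2.2⟩
    have := h.avoid hf
    tauto
  have hubT : ¬ S u b := fun hs => h.cross hf h2 hs hS2
  have hav : E a v := by
    by_contra hn
    exact h.cross hf hn he hS2
  have havT := h.conf (u := c) (v := b) (x := a) (y := v) ⟨h3, hav, hz, h2⟩
  obtain ⟨x, y, hc⟩ := h.noniso he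
  have hxy := h.conf hc
  refine ⟨x, y, hc, h2, hub, hav, ?_, ?_, by tauto, by tauto⟩
  · by_contra hn
    have := h.conf (u := u) (v := b) (x := x) (y := y) ⟨hub, hc.2.1, hc.2.2.1, hn⟩
    tauto
  · by_contra hn
    have := h.conf (u := a) (v := v) (x := x) (y := y) ⟨hav, hc.2.1, hn, hc.2.2.2⟩
    tauto

/-- The mirror image of `Alt.of_cross_left`, with the restricted edge cv in the row of c. -/
theorem Alt.of_cross_right (h : IsTight E F S) {c u a : U} {d v b : V}
    (hA : Alt E S c d a b) (hd : ¬ S c d) (hf : F c v) (hz : ¬ E u d) (he : S u v) :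
    Alt E S u v a b := by
  obtain ⟨x₀, y₀, h1, h2, h3, h4, h5, h6, h7, h8⟩ := hA
  have hS1 : S c b := by tauto
  have hS2 : S a d := by tauto
  have hx := h.conf (u := a) (v := y₀) (x := c) (y := b) ⟨h6, h3, h2, h1.2.2.1⟩
  have hav : E a v := by
    by_contra hn
    have := h.conf (u := c) (v := v) (x := a) (y := y₀) ⟨h.restricted hf, h6, h1.2.2.1, hn⟩
    have := h.avoid hf
    tauto
  have havT : ¬ S a v := fun hs => h.cross hf h2 hS1 hs
  have hub : E u b := by
    by_contra hn
    exact h.cross hf hn hS1 he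
  have hubT := h.conf (u := a) (v := d) (x := u) (y := b) ⟨h4, hub, h2, hz⟩
  obtain ⟨x, y, hc⟩ := h.noniso he
  have hxy := h.conf hc
  refine ⟨x, y, hc, h2, hub, hav, ?_, ?_, by tauto, by tauto⟩
  · by_contra hn
    have := h.conf (u := u) (v := b) (x := x) (y := y) ⟨hub, hc.2.1, hc.2.2.1, hn⟩
    tauto
  · by_contra hn
    have := h.conf (u := a) (v := v) (x := x) (y := y) ⟨hav, hc.2.1, hn, hc.2.2.2⟩
    tauto

/-- Since uv is outside S, alternation would put ub and av into S, which `cross` forbids for uv in F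
and the nonedge ab. So restricted edges never change colour. -/
theorem not_alt_of_restricted (h : IsColoring E F S) {u a : U} {v b : V} (hf : F u v) :
    ¬ Alt E S u v a b := by
  rintro ⟨x, y, h1, h2, h3, h4, h5, h6, h7, h8⟩
  have := h.avoid hf
  exact h.cross hf h2 (by tauto) (by tauto)

/-- Conflict partners flip together and restricted edges do not flip, which settles `conf` and
`avoid`. For `cross`, the offending pair may arise with one or with two newly added edges: the first
case is excluded by `Alt.of_cross_left` and `Alt.of_cross_right`, the second by `k3`. -/
theorem IsTight.flip (h : IsTight E F S) (a : U) (b : V) : IsTight E F (flip E S a b) where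
  restricted := h.restricted
  sub {u v} hs := by
    rcases hs with hs | ⟨_, x, y, hA⟩
    · exact h.sub hs.1
    · exact hA.1.1
  noniso {u v} hs := by
    rcases hs with hs | ⟨_, x, y, hA⟩
    · exact h.noniso hs.1
    · exact ⟨x, y, hA.1⟩
  conf {u v x y} hc := by
    have k := h.conf hc
    have k1 : Alt E S u v a b → Alt E S x y a b := fun hA => hA.partner h.toIsColoring hc
    have k2 : Alt E S x y a b → Alt E S u v a b := fun hA => hA.partner h.toIsColoring hc.symm
    unfold TwoChain.flip
    tauto
  avoid {u v} hf := by
    have k := not_alt_of_restricted h.toIsColoring (a := a) (b := b) hf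
    have := h.avoid hf
    unfold TwoChain.flip
    tauto
  cross {u b' a' v} hf hz h1 h2 := by
    have k1 := fun hA hd hs => Alt.of_cross_left h (a := a) (b := b) (c := a') (d := b')
      (u := u) (v := v) hA hd hf hz hs
    have k2 := fun hA hd hs => Alt.of_cross_right h (a := a) (b := b) (c := u) (d := v)
      (u := a') (v := b') hA hd hf hz hs
    -- If both edges entered S, then ub and ab' were in S before; the restricted edge ub' and the
    -- nonedge ab already violate the old clause.
    have k3 : ¬ S u v → ¬ S a' b' → Alt E S u v a b → Alt E S a' b' a b → False := by
      rintro n1 n2 ⟨x, y, hA⟩ ⟨x', y', hB⟩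
      obtain ⟨-, i2, -, -, -, -, i7, -⟩ := hA
      obtain ⟨-, -, -, -, -, -, -, j8⟩ := hB
      exact h.cross hf i2 (by tauto) (by tauto)
    have k4 := @IsColoring.cross _ _ _ _ _ h.toIsColoring u b' a' v hf hz
    unfold TwoChain.flip at h1 h2
    tauto

/-- A six-cycle opposite to ab seen from av would need ab to be an edge. Thus the row of a and the
column of b keep their colours, and these are the colours by which the test at ab compares an edge
with its cycle. -/
theorem flip_row {a : U} {b v : V} (hz : ¬ E a b) : flip E S a b a v ↔ S a v := by
  have : ¬ Alt E S a v a b := by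
    rintro ⟨x, y, h1, h2, h3, -⟩
    exact hz h3
  unfold flip
  tauto

theorem flip_col {a u : U} {b : V} (hz : ¬ E a b) : flip E S a b u b ↔ S u b := by
  have : ¬ Alt E S u b a b := by
    rintro ⟨x, y, h1, h2, h3, h4, -⟩
    exact hz h4
  unfold flip
  tauto

/-- The colours of ub and av are fixed by the flip. An edge uv that alternated with them has changed
its colour and now agrees with them; any other edge has kept its colour and still does not
alternate. -/
theorem not_alt_flip {a u : U} {b v : V} (hz : ¬ E a b) :
    ¬ Alt E (flip E S a b) u v a b := by
  rintro ⟨x, y, h1, h2, h3, h4, h5, h6, h7, h8⟩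
  rw [flip_col hz] at h7
  rw [flip_row hz] at h8
  by_cases hA : Alt E S u v a b
  · have : flip E S a b u v ↔ ¬ S u v := by unfold flip; tauto
    obtain ⟨x', y', -, -, -, -, -, -, i7, i8⟩ := hA
    tauto
  · have : flip E S a b u v ↔ S u v := by unfold flip; tauto
    exact hA ⟨x, y, h1, h2, h3, h4, h5, h6, by tauto, by tauto⟩

/-- An edge that has just been flipped at ab cannot lie in an alternating six-cycle at another
nonedge a'b'. Otherwise the two cycles, which may be taken with the same edges uv and xy, combine to
a new alternating six-cycle opposite to ab, contradicting `not_alt_flip`. -/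
theorem AltWith.not_alt_of_flip (h : IsTight E F S) {u a x a' : U} {v b y b' : V}
    (hA : AltWith E (TwoChain.flip E S a b) u v a' b' x y) : ¬ Alt E S u v a b := by
  rintro ⟨x₀, y₀, hB⟩
  have hfl := (h.flip a b).toIsColoring
  have hz := hB.2.1
  have hnA := fun u v => not_alt_flip (S := S) (u := u) (v := v) hz
  have he : TwoChain.flip E S a b u v ↔ ¬ S u v := by
    have : Alt E S u v a b := ⟨_, _, hB⟩
    unfold TwoChain.flip; tauto
  obtain ⟨h1, h2, h3, h4, h5, h6, h7, h8⟩ := hA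
  obtain ⟨-, -, i3, i4, i5, i6, i7, i8⟩ := hB.shift h.toIsColoring h1
  rw [← flip_col (S := S) hz] at i7
  rw [← flip_row (S := S) hz] at i8
  generalize TwoChain.flip E S a b = S' at *
  -- In the new colours ub and av agree with uv, while ub' and a'v differ from it. This contrast
  -- forces a'b and ab' to be edges below.
  have d1 : S' u b ↔ S' u v := by rw [i7, he]
  have d2 : S' a v ↔ S' u v := by rw [i8, he]
  clear i7 i8 he hB
  have c0 := hfl.conf h1
  have c1 := hfl.conf (u := x) (v := b) (x := a) (y := v) ⟨i5, i4, h1.2.2.2, hz⟩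
  have c2 := hfl.conf (u := a) (v := y) (x := u) (y := b) ⟨i6, i3, hz, h1.2.2.1⟩
  have c3 := hfl.conf (u := x) (v := b') (x := a') (y := v) ⟨h5, h4, h1.2.2.2, h2⟩
  have c4 := hfl.conf (u := a') (v := y) (x := u) (y := b') ⟨h6, h3, h2, h1.2.2.1⟩
  rw [h7, not_not] at c4
  rw [h8, not_not] at c3
  rw [d2] at c1
  rw [d1] at c2
  have e1 : E a' b := by
    by_contra hn
    have c := hfl.conf (u := u) (v := b) (x := a') (y := y) ⟨i3, h6, h1.2.2.1, hn⟩
    rw [d1, c4] at c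
    exact iff_not_self c
  have e2 : E a b' := by
    by_contra hn
    have c := hfl.conf (u := a) (v := v) (x := x) (y := b') ⟨i4, h5, hn, h1.2.2.2⟩
    rw [d2, c3] at c
    exact iff_not_self c
  have c5 := hfl.conf (u := a') (v := b) (x := a) (y := b') ⟨e1, e2, h2, hz⟩
  -- Either colour of ab' gives an alternating six-cycle opposite to ab: seen from ub' if ab' has
  -- the colour of uv, and from xb' otherwise.
  by_cases hs : S' a b' ↔ S' u v
  · refine hnA u b' ⟨a', y, ⟨h3, h6, h1.2.2.1, h2⟩, hz, i3, e2, e1, i6, ?_, ?_⟩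
    · rw [d1, h7, not_not]
    · rw [hs, h7, not_not]
  · refine hnA x b' ⟨a', v, ⟨h5, h4, h1.2.2.2, h2⟩, hz, i5, e2, e1, i4, ?_, ?_⟩
    · rw [c1, c3]
    · rw [c3]; exact (not_iff_comm.1 (not_iff.1 hs)).symm

/-- Applied to the three rotations of a cycle at a'b', `AltWith.not_alt_of_flip` shows that none of
the edges whose colours matter was flipped, so the cycle existed before. This is why one pass over
the nonedges is enough. -/
theorem not_alt_flip_of_not_alt (h : IsTight E F S) {a a' : U} {b b' : V}
    (hn : ∀ u v, ¬ Alt E S u v a' b') (u : U) (v : V) :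
    ¬ Alt E (flip E S a b) u v a' b' := by
  rintro ⟨x, y, hA⟩
  have hfl := (h.flip a b).toIsColoring
  have n1 := hA.not_alt_of_flip h
  have n2 := (hA.rotate_right hfl).not_alt_of_flip h
  have n3 := (hA.rotate_left hfl).not_alt_of_flip h
  have e1 : flip E S a b u v ↔ S u v := by unfold flip; tauto
  have e2 : flip E S a b u b' ↔ S u b' := by unfold flip; tauto
  have e3 : flip E S a b a' v ↔ S a' v := by unfold flip; tauto
  obtain ⟨h1, h2, h3, h4, h5, h6, h7, h8⟩ := hA
  exact hn u v ⟨x, y, h1, h2, h3, h4, h5, h6, by tauto, by tauto⟩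

/-! ### Chain graphs from a colouring without alternating six-cycles -/

section NoAlt

variable (h : IsTight E F S) (hn : ∀ u v a b, ¬ Alt E S u v a b)
include h hn

/-- If uv were a nonedge, then ub and av would be in conflict, with neither of them in S. If uv were
in S, then it would have a conflict partner and lie in an alternating six-cycle opposite to ab. -/
theorem right_closed {u a : U} {b v : V} (h1 : E u b) (h1' : ¬ S u b) (hz : ¬ E a b)
    (h2 : E a v) (h2' : ¬ S a v) : E u v ∧ ¬ S u v := by
  have huv : E u v := by
    by_contra hn'
    have := h.conf (u := u) (v := b) (x := a) (y := v) ⟨h1, h2, hn', hz⟩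
    tauto
  refine ⟨huv, fun hs => ?_⟩
  obtain ⟨x, y, hc⟩ := h.noniso hs
  have k := h.conf hc
  refine hn u v a b ⟨x, y, hc, hz, h1, h2, ?_, ?_, by tauto, by tauto⟩
  · by_contra hn'
    have := h.conf (u := u) (v := b) (x := x) (y := y) ⟨h1, hc.2.1, hc.2.2.1, hn'⟩
    tauto
  · by_contra hn'
    have := h.conf (u := a) (v := v) (x := x) (y := y) ⟨h2, hc.2.1, hn', hc.2.2.2⟩
    tauto

/-- If u₁v₂ is in S, its conflict partner xy is outside S, and `right_closed` applies twice: over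
the nonedge xv₂ it gives u₂y, and over the nonedge u₁y it gives u₂v₁. -/
theorem chain_right {u₁ u₂ : U} {v₁ v₂ : V} (h1 : E u₁ v₁) (h1' : ¬ S u₁ v₁)
    (h2 : E u₂ v₂) (h2' : ¬ S u₂ v₂) :
    (E u₁ v₂ ∧ ¬ S u₁ v₂) ∨ (E u₂ v₁ ∧ ¬ S u₂ v₁) := by
  by_cases k1 : E u₁ v₂
  · by_cases k2 : S u₁ v₂
    · obtain ⟨x, y, hc⟩ := h.noniso k2
      have k := h.conf hc
      obtain ⟨k3, k4⟩ := right_closed h hn h2 h2' hc.2.2.2 hc.2.1 (by tauto)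
      exact Or.inr (right_closed h hn k3 k4 hc.2.2.1 h1 h1')
    · exact Or.inl ⟨k1, k2⟩
  · exact Or.inr (right_closed h hn h2 h2' k1 h1 h1')

end NoAlt

/-- The edges of `S`, and the edges outside all induced `2K₂` that close up a path of `S`. -/
def closure (E S : U → V → Prop) (u : U) (v : V) : Prop :=
  S u v ∨ (E u v ∧ (¬ ∃ x y, Conf E u v x y) ∧ ∃ a b, ¬ E a b ∧ S u b ∧ S a v)

theorem closure_sub (h : IsTight E F S) {u : U} {v : V} (hc : closure E S u v) : E u v := by
  rcases hc with hc | hc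
  · exact h.sub hc
  · exact hc.1

theorem closure_avoid (h : IsTight E F S) {u : U} {v : V} (hc : closure E S u v) : ¬ F u v := by
  intro hf
  rcases hc with hc | ⟨-, -, a, b, hz, h1, h2⟩
  · exact h.avoid hf hc
  · exact h.cross hf hz h1 h2

section NoAlt

variable (h : IsTight E F S) (hn : ∀ u v a b, ¬ Alt E S u v a b)
include h hn

theorem closure_of_path {u a : U} {b v : V} (h1 : S u b) (hz : ¬ E a b) (h2 : S a v) :
    closure E S u v := by
  by_cases hs : S u v
  · exact Or.inl hs
  have e1 := h.sub h1
  have e2 := h.sub h2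
  have huv : E u v := by
    by_contra hn'
    have := h.conf (u := u) (v := b) (x := a) (y := v) ⟨e1, e2, hn', hz⟩
    tauto
  refine Or.inr ⟨huv, ?_, a, b, hz, h1, h2⟩
  rintro ⟨x, y, hc⟩
  have k := h.conf hc
  refine hn u v a b ⟨x, y, hc, hz, e1, e2, ?_, ?_, by tauto, by tauto⟩
  · by_contra hn'
    have := h.conf (u := u) (v := b) (x := x) (y := y) ⟨e1, hc.2.1, hc.2.2.1, hn'⟩
    tauto
  · by_contra hn'
    have := h.conf (u := a) (v := v) (x := x) (y := y) ⟨e2, hc.2.1, hn', hc.2.2.2⟩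
    tauto

/-- Closing up paths once is enough. Let ub have been added because of ub₁ and a₁b in S over the
nonedge a₁b₁. If ab₁ is a nonedge, the path through ub₁ and av replaces it. Otherwise ab₁ conflicts
with a₁b and so is outside S; as ub has no conflict, ay is a nonedge for the partner xy of ub₁, so
xy conflicts with both ub₁ and ab₁, although these have different colours. -/
theorem closure_step {u a : U} {b v : V} (h1 : closure E S u b) (hz : ¬ E a b) (h2 : S a v) :
    closure E S u v := by
  rcases h1 with h1 | ⟨e1, hi, a₁, b₁, hz₁, s1, s2⟩
  · exact closure_of_path h hn h1 hz h2
  by_cases k1 : E a b₁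
  · exfalso
    obtain ⟨x, y, hc⟩ := h.noniso s1
    have c1 := h.conf hc
    have c2 := h.conf (u := a) (v := b₁) (x := a₁) (y := b) ⟨k1, h.sub s2, hz, hz₁⟩
    have k2 : ¬ E a y := fun k2 => hi ⟨a, y, e1, k2, hc.2.2.1, hz⟩
    have := h.conf (u := a) (v := b₁) (x := x) (y := y) ⟨k1, hc.2.1, k2, hc.2.2.2⟩
    tauto
  · exact closure_of_path h hn s1 k1 h2

/-- The interesting case is that both cross pairs are edges outside S. For partners xy of u₁v₁ and
zw of u₂v₂, the pairs xv₂ and zv₁ are then edges in conflict with each other; the one that lies in S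
closes up a path over xv₁ or zv₂. -/
theorem closure_or_of_left {u₁ u₂ : U} {v₁ v₂ : V} (h1 : S u₁ v₁) (h2 : S u₂ v₂) :
    closure E S u₁ v₂ ∨ closure E S u₂ v₁ := by
  by_cases e1 : E u₁ v₂
  · by_cases e2 : E u₂ v₁
    · by_cases s1 : S u₁ v₂
      · exact Or.inl (Or.inl s1)
      by_cases s2 : S u₂ v₁
      · exact Or.inr (Or.inl s2)
      obtain ⟨x, y, hc⟩ := h.noniso h1
      obtain ⟨z, w, hd⟩ := h.noniso h2
      have c1 := h.conf hc
      have c2 := h.conf hd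
      have k1 : E x v₂ := by
        by_contra hn'
        have := h.conf (u := u₁) (v := v₂) (x := x) (y := y) ⟨e1, hc.2.1, hc.2.2.1, hn'⟩
        tauto
      have k2 : E z v₁ := by
        by_contra hn'
        have := h.conf (u := u₂) (v := v₁) (x := z) (y := w) ⟨e2, hd.2.1, hd.2.2.1, hn'⟩
        tauto
      have c3 := h.conf (u := z) (v := v₁) (x := x) (y := v₂) ⟨k2, k1, hd.2.2.2, hc.2.2.2⟩
      by_cases s3 : S x v₂
      · exact Or.inl (closure_of_path h hn h1 hc.2.2.2 s3)
      · exact Or.inr (closure_of_path h hn h2 hd.2.2.2 (by tauto))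
    · exact Or.inl (closure_of_path h hn h1 e2 h2)
  · exact Or.inr (closure_of_path h hn h2 e1 h1)

/-- An added edge is replaced by the two edges of S that generate it; `closure_step` carries the
conclusion back. -/
theorem chain_closure {u₁ u₂ : U} {v₁ v₂ : V} (h1 : closure E S u₁ v₁)
    (h2 : closure E S u₂ v₂) : closure E S u₁ v₂ ∨ closure E S u₂ v₁ := by
  have key : ∀ {u₁ u₂ : U} {v₁ v₂ : V}, closure E S u₁ v₁ → S u₂ v₂ →
      closure E S u₁ v₂ ∨ closure E S u₂ v₁ := by
    intro u₁ u₂ v₁ v₂ h1 h2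
    rcases h1 with h1 | ⟨-, -, a, b, hz, s1, s2⟩
    · exact closure_or_of_left h hn h1 h2
    · rcases closure_or_of_left h hn s1 h2 with k | k
      · exact Or.inl k
      · exact Or.inr (closure_step h hn k hz s2)
  rcases h2 with h2 | ⟨-, -, a, b, hz, s1, s2⟩
  · exact key h1 h2
  · rcases key h1 s1 with k | k
    · exact Or.inl (closure_step h hn k hz s2)
    · exact Or.inr k

end NoAlt

end Coloring

/-! ### Colourings and restricted covers -/

section Cover

variable {U V : Type*} [DecidableEq U] [DecidableEq V] {E F : Finset (U × V)}

/-- Neither chain graph contains both edges of a conflict, whose cross pairs are nonedges of E. For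
`cross`, uv and ab are edges outside E₂, hence in E₁; the chain property would put ub or av into E₁,
but the first is restricted and the second is a nonedge. -/
theorem IsRestrictedCover.isColoring {E₁ E₂ : Finset (U × V)} (hF : F ⊆ E)
    (h : IsRestrictedCover E F E₁ E₂) :
    IsColoring (fun u v => (u, v) ∈ E) (fun u v => (u, v) ∈ F)
      (fun u v => (u, v) ∈ E ∧ (u, v) ∉ E₂) := by
  obtain ⟨h1, h2, h3, h4⟩ := h
  have hE : ∀ e, e ∈ E ↔ e ∈ E₁ ∨ e ∈ E₂ := fun e => by rw [h3, Finset.mem_union]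
  refine ⟨fun hf => hF hf, fun hs => hs.1, ?_, ?_, ?_⟩
  · rintro u v x y ⟨i1, i2, i3, i4⟩
    have j1 := h1 u x v y
    have j2 := h2 u x v y
    simp only [IsInduced2K2] at j1 j2
    simp only [hE] at *
    tauto
  · intro u v hf hs
    have := fun hh : (u, v) ∈ E₁ => Finset.disjoint_left.1 h4 hh
    have := hE (u, v)
    tauto
  · intro u b a v hf hz hs hs'
    have k := fun hh : (u, b) ∈ E₁ => Finset.disjoint_left.1 h4 hh
    have j1 := h1 u a v b
    simp only [IsInduced2K2] at j1
    simp only [hE] at *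
    tauto

theorem isRestrictedCover_of_coloring {S : U → V → Prop} {E₁ E₂ : Finset (U × V)}
    (h : IsTight (fun u v => (u, v) ∈ E) (fun u v => (u, v) ∈ F) S)
    (hn : ∀ u v a b, ¬ Alt (fun u v => (u, v) ∈ E) S u v a b)
    (h₁ : ∀ u v, (u, v) ∈ E₁ ↔ closure (fun u v => (u, v) ∈ E) S u v)
    (h₂ : ∀ u v, (u, v) ∈ E₂ ↔ (u, v) ∈ E ∧ ¬ S u v) : IsRestrictedCover E F E₁ E₂ := by
  refine ⟨?_, ?_, ?_, ?_⟩
  · rintro u x v y ⟨i1, i2, i3, i4⟩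
    rw [h₁] at *
    have := chain_closure h hn i1 i2
    tauto
  · rintro u x v y ⟨i1, i2, i3, i4⟩
    rw [h₂] at *
    have := chain_right h hn i1.1 i1.2 i2.1 i2.2
    tauto
  · ext ⟨u, v⟩
    rw [Finset.mem_union, h₁, h₂]
    have := fun hc => closure_sub (u := u) (v := v) h hc
    have : S u v → closure (fun u v => (u, v) ∈ E) S u v := Or.inl
    tauto
  · rw [Finset.disjoint_left]
    rintro ⟨u, v⟩ hc
    rw [h₁] at hc
    exact closure_avoid h hc

end Cover

end TwoChain

namespace TwoChain

/-! ### Implication graphs of 2-satisfiability -/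

section Implication

open Relation

/-- The set of vertices collected by going through the roots `R 1, …, R i`: the vertices
reachable from `R k` are added unless `R k` or `ng (R k)` has been collected before. -/
def greedy (arc : ℕ → ℕ → Prop) (R ng : ℕ → ℕ) : ℕ → Set ℕ
  | 0 => ∅
  | i + 1 => {y | y ∈ greedy arc R ng i ∨ (R (i + 1) ∉ greedy arc R ng i ∧
      ng (R (i + 1)) ∉ greedy arc R ng i ∧ ReflTransGen arc (R (i + 1)) y)}

variable {arc : ℕ → ℕ → Prop} {R ng : ℕ → ℕ}

theorem greedy_mono_succ (i : ℕ) : greedy arc R ng i ⊆ greedy arc R ng (i + 1) :=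
  fun _ h => Or.inl h

theorem greedy_mono {i j : ℕ} (h : i ≤ j) : greedy arc R ng i ⊆ greedy arc R ng j := by
  induction h with
  | refl => exact subset_rfl
  | step _ ih => exact ih.trans (greedy_mono_succ _)

theorem greedy_succ_of_skip {i : ℕ}
    (h : R (i + 1) ∈ greedy arc R ng i ∨ ng (R (i + 1)) ∈ greedy arc R ng i) :
    greedy arc R ng (i + 1) = greedy arc R ng i := by
  ext y
  simp only [greedy, Set.mem_ofPred_eq]
  tauto

theorem greedy_closed {i : ℕ} {x y : ℕ} (hx : x ∈ greedy arc R ng i) (h : arc x y) :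
    y ∈ greedy arc R ng i := by
  induction i with
  | zero => exact hx
  | succ i ih =>
    rcases hx with hx | ⟨h1, h2, h3⟩
    · exact Or.inl (ih hx)
    · exact Or.inr ⟨h1, h2, h3.tail h⟩

theorem greedy_reach {i : ℕ} {x y : ℕ} (hx : x ∈ greedy arc R ng i)
    (h : ReflTransGen arc x y) : y ∈ greedy arc R ng i := by
  induction h with
  | refl => exact hx
  | tail _ h ih => exact greedy_closed ih h

theorem greedy_decides {i j : ℕ} (hj : 1 ≤ j) (hi : j ≤ i) :
    R j ∈ greedy arc R ng i ∨ ng (R j) ∈ greedy arc R ng i := by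
  obtain ⟨j, rfl⟩ : ∃ k, j = k + 1 := ⟨j - 1, by omega⟩
  have hm := greedy_mono (arc := arc) (R := R) (ng := ng) hi
  by_cases h1 : R (j + 1) ∈ greedy arc R ng j
  · exact Or.inl (hm (Or.inl h1))
  by_cases h2 : ng (R (j + 1)) ∈ greedy arc R ng j
  · exact Or.inr (hm (Or.inl h2))
  · exact Or.inl (hm (Or.inr ⟨h1, h2, .refl⟩))

theorem exists_arc_crossing {P : ℕ → Prop} {x y : ℕ} (h : ReflTransGen arc x y) (hx : P x)
    (hy : ¬ P y) : ∃ b c, ReflTransGen arc x b ∧ arc b c ∧ P b ∧ ¬ P c := by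
  induction h with
  | refl => exact absurd hx hy
  | @tail b c h1 h2 ih =>
    by_cases hb : P b
    · exact ⟨b, c, h1, h2, hb, hy⟩
    · exact ih hb

/-- `post` numbers the vertices as a depth-first search finishes them. -/
def FinishOrder (arc : ℕ → ℕ → Prop) (post : ℕ → ℕ) : Prop :=
  ∀ u b c, post b ≤ post u → arc b c → post c ≤ post u ∨ ReflTransGen arc c u

/-- Suppose that every vertex in the component of u finishes before v. On a walk from such a vertex
w to v some arc bc leads from finishing times up to that of w to later ones; then c reaches w, so c
is in the component and finishes later than w. This cannot be repeated for ever. -/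
theorem FinishOrder.exists_in_component {post : ℕ → ℕ} {N : ℕ} (h : FinishOrder arc post)
    (hN : ∀ x, post x ≤ N) {u v : ℕ} (huv : ReflTransGen arc u v) :
    ∃ w, ReflTransGen arc u w ∧ ReflTransGen arc w u ∧ post v ≤ post w := by
  by_contra! hc
  have key : ∀ k w, ReflTransGen arc u w → ReflTransGen arc w u → N - post w = k → False := by
    intro k
    induction k using Nat.strong_induction_on with
    | _ k ih =>
      intro w h1 h2 hk
      have h3 := hc w h1 h2
      obtain ⟨b, c, i1, i2, i3, i4⟩ := exists_arc_crossing (P := fun x => post x ≤ post w)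
        (h2.trans huv) le_rfl (by simpa using h3)
      have h4 := (h w b c i3 i2).resolve_left i4
      have := hN c
      exact ih (N - post c) (by omega) c (h1.trans (i1.tail i2)) (h4.trans h2) rfl
  exact key _ u .refl .refl rfl

/-- Reachability in an implication graph is closed under contraposition. -/
theorem reach_contrapose {neg : ℕ → ℕ}
    (hneg : ∀ x y, arc x y → arc (neg y) (neg x)) {x y : ℕ}
    (h : ReflTransGen arc x y) : ReflTransGen arc (neg y) (neg x) := by
  induction h with
  | refl => exact .refl
  | tail _ h ih => exact ReflTransGen.head (hneg _ _ h) ih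

/-- If the implication graph has a consistent assignment then the greedy assignment along the
reversed finishing order is consistent. -/
theorem greedy_consistent {L : Set ℕ} {neg post ord : ℕ → ℕ} {N : ℕ}
    (hL : ∀ x y, arc x y → x ∈ L ∧ y ∈ L)
    (hnegL : ∀ x ∈ L, neg x ∈ L) (hnn : ∀ x ∈ L, neg (neg x) = x)
    (hneg : ∀ x y, arc x y → arc (neg y) (neg x))
    (hpost : ∀ x ∈ L, 1 ≤ post x ∧ ord (post x) = x) (hN : ∀ x, post x ≤ N)
    (hord : ∀ i, 1 ≤ i → i ≤ N → ord i ∈ L ∧ post (ord i) = i)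
    (hfin : FinishOrder arc post)
    {A : Set ℕ} (hA : ∀ x y, arc x y → x ∈ A → y ∈ A) (hA' : ∀ x ∈ L, x ∈ A ↔ neg x ∉ A)
    {i : ℕ} (hi : i ≤ N) {y : ℕ} (hy : y ∈ L) :
    ¬ (y ∈ greedy arc (fun k => neg (ord (N + 1 - k))) neg i ∧
      neg y ∈ greedy arc (fun k => neg (ord (N + 1 - k))) neg i) := by
  have hAr : ∀ x y, ReflTransGen arc x y → x ∈ A → y ∈ A := by
    intro x y h hx
    induction h with
    | refl => exact hx
    | tail _ h ih => exact hA _ _ h ih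
  have hcp : ∀ {x y}, ReflTransGen arc x y → ReflTransGen arc (neg y) (neg x) :=
    fun h => reach_contrapose hneg h
  induction i with
  | zero => exact fun h => h.1
  | succ i ih =>
    specialize ih (by omega)
    have key : ∀ z ∈ L, z ∈ greedy arc (fun k => neg (ord (N + 1 - k))) neg i →
        neg (ord (N + 1 - (i + 1))) ∉ greedy arc (fun k => neg (ord (N + 1 - k))) neg i →
        neg (neg (ord (N + 1 - (i + 1)))) ∉
          greedy arc (fun k => neg (ord (N + 1 - k))) neg i →
        ReflTransGen arc (neg (ord (N + 1 - (i + 1)))) (neg z) → False := by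
      intro z hz h1 h2 h3 h4
      have h5 := hcp h4
      rw [hnn z hz] at h5
      exact h3 (greedy_reach h1 h5)
    rintro ⟨h1 | ⟨h1, h2, h3⟩, h4 | ⟨h4, h5, h6⟩⟩
    · exact ih ⟨h1, h4⟩
    · exact key y hy h1 h4 h5 h6
    · refine key (neg y) (hnegL y hy) h4 h1 h2 ?_
      rwa [hnn y hy]
    -- The new root ¬x reaches both y and ¬y, so by contraposition it reaches x. Some w in the
    -- component of ¬x then finishes no earlier than x. If w = x, then x and ¬x are equivalent,
    -- against the assignment `A`. Otherwise w finishes after x and was treated in an earlier round,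
    -- which already decided x or ¬x.
    · obtain ⟨hxL, hxi⟩ := hord (N + 1 - (i + 1)) (by omega) (by omega)
      set x := ord (N + 1 - (i + 1)) with hx
      rw [hnn x hxL] at h2
      have h7 := hcp h6
      rw [hnn x hxL, hnn y hy] at h7
      have h8 := h3.trans h7
      obtain ⟨w, w1, w2, w3⟩ := hfin.exists_in_component hN h8
      have hwL : w ∈ L := by
        cases w1 with
        | refl => exact hnegL x hxL
        | tail _ h => exact (hL _ _ h).2
      by_cases hw : w = x
      · subst hw
        have a1 := hA' x hxL
        have a2 : x ∈ A → neg x ∈ A := hAr _ _ w2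
        have a3 : neg x ∈ A → x ∈ A := hAr _ _ w1
        tauto
      · have hne : post w ≠ post x := fun he => hw <| by
          rw [← (hpost w hwL).2, he, (hpost x hxL).2]
        have := hN w
        have h9 := greedy_decides (arc := arc) (R := fun k => neg (ord (N + 1 - k))) (ng := neg)
          (i := i) (j := N + 1 - post w) (by omega) (by omega)
        have e1 : N + 1 - (N + 1 - post w) = post w := by omega
        simp only [e1, (hpost w hwL).2, hnn w hwL] at h9
        rcases h9 with h9 | h9
        · have := hcp w1
          rw [hnn x hxL] at this
          exact h2 (greedy_reach h9 this)
        · exact h1 (greedy_reach h9 w2)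

end Implication

end TwoChain

namespace TwoChain

/-! ### Structured commands with counted loops

Commands are compiled to programs. Register `4` holds the constant `1`. Registers `60` and `61`
hold addresses: a product, and the sum of a product and another register. All other registers
below `60` and all array cells grow by at most one in each step. -/

/-- Commands with counted loops. -/
inductive Cmd : Type
  | skip
  | instr (i : Instr)
  | seq (c d : Cmd)
  | ite (b : Test) (c d : Cmd)
  /-- run `c` with register `i` equal to `0, 1, …, n - 1`, where `n` is the content of `n` -/
  | loop (i n : ℕ) (c : Cmd)

instance : Coe Instr Cmd := ⟨Cmd.instr⟩

namespace Cmd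

/-- The program of a command. -/
def compile : Cmd → Program
  | skip => .skip
  | instr i => .instr i
  | seq c d => .seq c.compile d.compile
  | ite b c d => .ite b c.compile d.compile
  | loop i n c =>
    .seq (.instr (.lit i 0)) (.while (.lt i n) (.seq c.compile (.instr (.add i i 4))))

/-- Sequential composition of a list of commands. -/
def block : List Cmd → Cmd
  | [] => skip
  | c :: l => seq c (block l)

open Classical in
/-- The final state of a command. -/
noncomputable def sem : Cmd → State → State
  | skip, s => s
  | instr i, s => i.run s
  | seq c d, s => d.sem (c.sem s)
  | ite b c d, s => if b.Holds s then c.sem s else d.sem s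
  | loop i n c, s =>
    Nat.rec (s.setReg i 0) (fun k st => (c.sem st).setReg i (k + 1)) (s.reg n)

/-- The state after `k` rounds of a loop. -/
noncomputable def loopState (i : ℕ) (c : Cmd) (s : State) (k : ℕ) : State :=
  Nat.rec (s.setReg i 0) (fun k st => (c.sem st).setReg i (k + 1)) k

open Classical in
/-- The running time of a command. -/
noncomputable def time : Cmd → State → ℕ
  | skip, _ => 1
  | instr _, _ => 1
  | seq c d, s => c.time s + d.time (c.sem s)
  | ite b c d, s => 1 + if b.Holds s then c.time s else d.time s
  | loop i n c, s => 2 + ∑ k ∈ Finset.range (s.reg n), (c.time (loopState i c s k) + 2)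

/-- The registers that a command may change. -/
def regWrites : Cmd → List ℕ
  | skip => []
  | instr (.lit r _) => [r]
  | instr (.move r _) => [r]
  | instr (.add r _ _) => [r]
  | instr (.sub r _ _) => [r]
  | instr (.mul r _ _) => [r]
  | instr (.load r _ _) => [r]
  | instr (.store _ _ _) => []
  | seq c d => c.regWrites ++ d.regWrites
  | ite _ c d => c.regWrites ++ d.regWrites
  | loop i _ c => i :: c.regWrites

/-- The arrays that a command may change. -/
def arrWrites : Cmd → List ℕ
  | instr (.store a _ _) => [a]
  | seq c d => c.arrWrites ++ d.arrWrites
  | ite _ c d => c.arrWrites ++ d.arrWrites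
  | loop _ _ c => c.arrWrites
  | _ => []

/-- The registers that bound the loops of a command. -/
def limits : Cmd → List ℕ
  | seq c d => c.limits ++ d.limits
  | ite _ c d => c.limits ++ d.limits
  | loop _ n c => n :: c.limits
  | _ => []

/-- The discipline that keeps numbers small. -/
def ok : Cmd → Bool
  | skip => true
  | instr (.lit r k) => r < 60 && r ≠ 4 && k ≤ 1
  | instr (.move r x) => r < 60 && r ≠ 4 && x < 60
  | instr (.add r x y) => (r < 60 && r ≠ 4 && x < 60 && y = 4) || (r = 61 && x = 60 && y < 60)
  | instr (.sub r x _) => r < 60 && r ≠ 4 && x < 60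
  | instr (.mul r x y) => r = 60 && x < 60 && y < 60
  | instr (.load r _ _) => r < 60 && r ≠ 4
  | instr (.store _ _ y) => y < 60
  | seq c d => c.ok && d.ok
  | ite _ c d => c.ok && d.ok
  | loop i n c => i < 60 && i ≠ 4 && n ≠ i && n ∉ c.regWrites && i ∉ c.regWrites && c.ok

/-- An upper bound for the running time, given bounds for the loop registers. -/
def cost (env : ℕ → ℕ) : Cmd → ℕ
  | skip => 1
  | instr _ => 1
  | seq c d => c.cost env + d.cost env
  | ite _ c d => 1 + (c.cost env + d.cost env)
  | loop _ n c => 2 + env n * (c.cost env + 2)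

end Cmd

open Cmd

/-! ### Reading states -/

@[simp] theorem State.setReg_reg (s : State) (r v r' : ℕ) :
    (s.setReg r v).reg r' = if r' = r then v else s.reg r' := by
  simp [State.setReg, Function.update_apply]

@[simp] theorem State.setReg_arr (s : State) (r v : ℕ) : (s.setReg r v).arr = s.arr := rfl

@[simp] theorem State.setArr_reg (s : State) (a i v : ℕ) : (s.setArr a i v).reg = s.reg := rfl

@[simp] theorem State.setArr_arr (s : State) (a i v a' : ℕ) :
    (s.setArr a i v).arr a' = if a' = a then Function.update (s.arr a) i v else s.arr a' := by
  simp [State.setArr, Function.update_apply]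

section Sem

variable (s : State)

@[simp] theorem sem_skip : sem skip s = s := rfl
@[simp] theorem sem_seq (c d : Cmd) : sem (seq c d) s = sem d (sem c s) := rfl
@[simp] theorem sem_block_nil : sem (block []) s = s := rfl
@[simp] theorem sem_block_cons (c : Cmd) (l : List Cmd) :
    sem (block (c :: l)) s = sem (block l) (sem c s) := rfl
@[simp] theorem sem_lit (r k : ℕ) : sem (instr (.lit r k)) s = s.setReg r k := rfl
@[simp] theorem sem_move (r x : ℕ) : sem (instr (.move r x)) s = s.setReg r (s.reg x) := rfl
@[simp] theorem sem_add (r x y : ℕ) :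
    sem (instr (.add r x y)) s = s.setReg r (s.reg x + s.reg y) := rfl
@[simp] theorem sem_sub (r x y : ℕ) :
    sem (instr (.sub r x y)) s = s.setReg r (s.reg x - s.reg y) := rfl
@[simp] theorem sem_mul (r x y : ℕ) :
    sem (instr (.mul r x y)) s = s.setReg r (s.reg x * s.reg y) := rfl
@[simp] theorem sem_load (r a x : ℕ) :
    sem (instr (.load r a x)) s = s.setReg r (s.arr a (s.reg x)) := rfl
@[simp] theorem sem_store (a x y : ℕ) :
    sem (instr (.store a x y)) s = s.setArr a (s.reg x) (s.reg y) := rfl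

theorem sem_ite_pos {b : Test} (c d : Cmd) (h : b.Holds s) : sem (ite b c d) s = sem c s :=
  if_pos h

theorem sem_ite_neg {b : Test} (c d : Cmd) (h : ¬ b.Holds s) : sem (ite b c d) s = sem d s :=
  if_neg h

@[simp] theorem sem_ite_eq (x y : ℕ) (c d : Cmd) :
    sem (ite (.eq x y) c d) s = if s.reg x = s.reg y then sem c s else sem d s := by
  split <;> rename_i h
  · exact sem_ite_pos s c d h
  · exact sem_ite_neg s c d h

@[simp] theorem sem_ite_ne (x y : ℕ) (c d : Cmd) :
    sem (ite (.ne x y) c d) s = if s.reg x = s.reg y then sem d s else sem c s := by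
  split <;> rename_i h
  · exact sem_ite_neg s c d (not_not.2 h)
  · exact sem_ite_pos s c d h

@[simp] theorem sem_ite_lt (x y : ℕ) (c d : Cmd) :
    sem (ite (.lt x y) c d) s = if s.reg x < s.reg y then sem c s else sem d s := by
  split <;> rename_i h
  · exact sem_ite_pos s c d h
  · exact sem_ite_neg s c d h

@[simp] theorem sem_ite_le (x y : ℕ) (c d : Cmd) :
    sem (ite (.le x y) c d) s = if s.reg x ≤ s.reg y then sem c s else sem d s := by
  split <;> rename_i h
  · exact sem_ite_pos s c d h
  · exact sem_ite_neg s c d h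

theorem sem_loop (i n : ℕ) (c : Cmd) : sem (loop i n c) s = loopState i c s (s.reg n) := rfl

theorem loopState_zero (i : ℕ) (c : Cmd) : loopState i c s 0 = s.setReg i 0 := rfl

theorem loopState_succ (i : ℕ) (c : Cmd) (k : ℕ) :
    loopState i c s (k + 1) = (sem c (loopState i c s k)).setReg i (k + 1) := rfl

theorem loopState_reg (i : ℕ) (c : Cmd) (k : ℕ) : (loopState i c s k).reg i = k := by
  cases k <;> simp [loopState_zero, loopState_succ]

end Sem

/-- A command changes only the registers in its write list. -/
theorem sem_reg_of_notMem (c : Cmd) : ∀ (s : State) {r : ℕ}, r ∉ c.regWrites →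
    (sem c s).reg r = s.reg r := by
  induction c with
  | skip => intros; rfl
  | instr i =>
    intro s r hr
    cases i <;> simp_all [regWrites, sem, Instr.run]
  | seq c d hc hd =>
    intro s r hr
    simp only [regWrites, List.mem_append, not_or] at hr
    rw [sem_seq, hd _ hr.2, hc _ hr.1]
  | ite b c d hc hd =>
    intro s r hr
    simp only [regWrites, List.mem_append, not_or] at hr
    simp only [sem]
    split
    · exact hc _ hr.1
    · exact hd _ hr.2
  | loop i n c hc =>
    intro s r hr
    simp only [regWrites, List.mem_cons, not_or] at hr
    rw [sem_loop]
    induction s.reg n with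
    | zero => simp [loopState_zero, hr.1]
    | succ k ih => simp [loopState_succ, hr.1, hc _ hr.2, ih]

/-- A command changes only the arrays in its write list. -/
theorem sem_arr_of_notMem (c : Cmd) : ∀ (s : State) {a : ℕ}, a ∉ c.arrWrites →
    (sem c s).arr a = s.arr a := by
  induction c with
  | skip => intros; rfl
  | instr i =>
    intro s a ha
    cases i <;> simp_all [arrWrites, sem, Instr.run]
  | seq c d hc hd =>
    intro s r hr
    simp only [arrWrites, List.mem_append, not_or] at hr
    rw [sem_seq, hd _ hr.2, hc _ hr.1]
  | ite b c d hc hd =>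
    intro s r hr
    simp only [arrWrites, List.mem_append, not_or] at hr
    simp only [sem]
    split
    · exact hc _ hr.1
    · exact hd _ hr.2
  | loop i n c hc =>
    intro s r hr
    simp only [arrWrites] at hr
    rw [sem_loop]
    induction s.reg n with
    | zero => simp [loopState_zero]
    | succ k ih => simp [loopState_succ, hc _ hr, ih]

theorem loopState_reg_of_notMem (i : ℕ) (c : Cmd) (s : State) (k : ℕ) {r : ℕ} (hi : r ≠ i)
    (hr : r ∉ c.regWrites) : (loopState i c s k).reg r = s.reg r := by
  induction k with
  | zero => simp [loopState_zero, hi]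
  | succ k ih => simp [loopState_succ, hi, sem_reg_of_notMem c _ hr, ih]

theorem loopState_arr_of_notMem (i : ℕ) (c : Cmd) (s : State) (k : ℕ) {a : ℕ}
    (ha : a ∉ c.arrWrites) : (loopState i c s k).arr a = s.arr a := by
  induction k with
  | zero => simp [loopState_zero]
  | succ k ih => simp [loopState_succ, sem_arr_of_notMem c _ ha, ih]

/-- The invariant rule for loops. -/
theorem sem_loop_inv {i n : ℕ} {c : Cmd} {s : State} (Inv : ℕ → State → Prop)
    (h0 : Inv 0 (s.setReg i 0))
    (hstep : ∀ k st, k < s.reg n → st.reg i = k →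
      (∀ r, r ≠ i → r ∉ c.regWrites → st.reg r = s.reg r) →
      (∀ a, a ∉ c.arrWrites → st.arr a = s.arr a) → Inv k st →
        Inv (k + 1) ((sem c st).setReg i (k + 1))) :
    Inv (s.reg n) (sem (loop i n c) s) := by
  rw [sem_loop]
  have : ∀ k, k ≤ s.reg n → Inv k (loopState i c s k) := by
    intro k
    induction k with
    | zero => intro _; exact h0
    | succ k ih =>
      intro hk
      exact hstep k _ (by omega) (loopState_reg s i c k)
        (fun r h1 h2 => loopState_reg_of_notMem i c s k h1 h2)
        (fun a h => loopState_arr_of_notMem i c s k h) (ih (by omega))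
  exact this _ le_rfl

/-! ### Execution and running time -/

/-- The numbers in a state are small. -/
structure Bounded (s : State) (B : ℕ) : Prop where
  pos : 1 ≤ B
  one : s.reg 4 = 1
  reg : ∀ r < 60, s.reg r ≤ B
  prod : s.reg 60 ≤ B * B
  sum : s.reg 61 ≤ B * B + B
  arr : ∀ a i, s.arr a i ≤ B

theorem Bounded.mono {s : State} {B B' : ℕ} (h : Bounded s B) (hB : B ≤ B') : Bounded s B' where
  pos := h.pos.trans hB
  one := h.one
  reg r hr := (h.reg r hr).trans hB
  prod := h.prod.trans (Nat.mul_le_mul hB hB)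
  sum := h.sum.trans (Nat.add_le_add (Nat.mul_le_mul hB hB) hB)
  arr a i := (h.arr a i).trans hB

theorem Bounded.setReg {s : State} {B r v : ℕ} (h : Bounded s B) (hr : r < 60) (hr' : r ≠ 4)
    (hv : v ≤ B) : Bounded (s.setReg r v) B where
  pos := h.pos
  one := by simp [hr'.symm, h.one]
  reg r' hr' := by
    rw [State.setReg_reg]
    split
    · exact hv
    · exact h.reg r' hr'
  prod := by simp [show 60 ≠ r by omega, h.prod]
  sum := by simp [show 61 ≠ r by omega, h.sum]
  arr := h.arr

/-- Ordinary additions only add register 4, which holds 1. Products and address sums go to registers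
60 and 61, and the discipline never copies these two into another register or into an array, so
squares do not accumulate. -/
theorem Bounded.run {s : State} {B : ℕ} (h : Bounded s B) {i : Instr}
    (hi : (Cmd.instr i).ok = true) :
    i.value s ≤ (B + 1) * (B + 1) + (B + 1) ∧ Bounded (i.run s) (B + 1) := by
  have hB : B ≤ (B + 1) * (B + 1) + (B + 1) := by nlinarith
  have h' := h.mono (Nat.le_succ B)
  have hp := h.pos
  cases i with
  | lit r k =>
    simp only [ok, Bool.and_eq_true, decide_eq_true_eq, ne_eq] at hi
    exact ⟨by simp only [Instr.value]; nlinarith, h'.setReg hi.1.1 hi.1.2 (by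
      simp only [Instr.value]; omega)⟩
  | move r x =>
    simp only [ok, Bool.and_eq_true, decide_eq_true_eq, ne_eq] at hi
    have := h.reg x hi.2
    exact ⟨this.trans hB, h'.setReg hi.1.1 hi.1.2 (by simp only [Instr.value]; omega)⟩
  | add r x y =>
    simp only [ok, Bool.and_eq_true, Bool.or_eq_true, decide_eq_true_eq, ne_eq] at hi
    rcases hi with ⟨⟨⟨h1, h2⟩, h3⟩, rfl⟩ | ⟨⟨rfl, rfl⟩, h3⟩
    · have := h.reg x h3
      have h1' := h.one
      simp only [Instr.run, Instr.value, h1']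
      exact ⟨by nlinarith, h'.setReg h1 h2 (by omega)⟩
    · have := h.reg y h3
      have hpr := h.prod
      have hv : s.reg 60 + s.reg y ≤ (B + 1) * (B + 1) + (B + 1) := by nlinarith
      refine ⟨hv, ?_⟩
      simp only [Instr.run, Instr.value]
      exact ⟨h'.pos, by simp [h.one], fun r hr => by
        simp [show r ≠ 61 by omega, h'.reg r hr], by simp [h'.prod], by simpa using hv, h'.arr⟩
  | sub r x y =>
    simp only [ok, Bool.and_eq_true, decide_eq_true_eq, ne_eq] at hi
    have := h.reg x hi.2
    exact ⟨by simp only [Instr.value]; omega, h'.setReg hi.1.1 hi.1.2 (by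
      simp only [Instr.value]; omega)⟩
  | mul r x y =>
    simp only [ok, Bool.and_eq_true, decide_eq_true_eq] at hi
    obtain ⟨⟨rfl, h2⟩, h3⟩ := hi
    have := Nat.mul_le_mul (h'.reg x h2) (h'.reg y h3)
    simp only [Nat.succ_eq_add_one] at this
    simp only [Instr.run, Instr.value]
    exact ⟨by omega, h'.pos, by simp [h.one], fun r hr => by
        simp [show r ≠ 60 by omega, h'.reg r hr], by simpa using this, by simp [h'.sum], h'.arr⟩
  | load r a x =>
    simp only [ok, Bool.and_eq_true, decide_eq_true_eq, ne_eq] at hi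
    have := h.arr a (s.reg x)
    exact ⟨this.trans hB, h'.setReg hi.1 hi.2 (by simp only [Instr.value]; omega)⟩
  | store a x y =>
    simp only [ok, decide_eq_true_eq] at hi
    have hy := h'.reg y hi
    refine ⟨(h.reg y hi).trans hB, h'.pos, h.one, h'.reg, h'.prod, h'.sum, fun a' j => ?_⟩
    simp only [Instr.run, Instr.value, State.setArr_arr]
    split
    · rw [Function.update_apply]
      split
      · exact hy
      · exact h'.arr _ _
    · exact h'.arr _ _

theorem Exec.of_eq {W : ℕ} {P : Program} {s s' : State} {t t' : ℕ} (h : Exec W P s t s')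
    (ht : t = t') : Exec W P s t' s' := ht ▸ h

/-- Commands that obey the discipline run without overflow. -/
theorem exec_sem {W T : ℕ} (hW : T * T + T < W) (c : Cmd) : ∀ (s : State) (B : ℕ),
    c.ok = true → Bounded s B → B + time c s ≤ T →
      Exec W c.compile s (time c s) (sem c s) ∧ Bounded (sem c s) (B + time c s) := by
  induction c with
  | skip =>
    intro s B _ hs hT
    exact ⟨.skip s, hs.mono (by omega)⟩
  | instr i =>
    intro s B hi hs hT
    obtain ⟨h1, h2⟩ := hs.run hi
    simp only [time] at hT
    have : (B + 1) * (B + 1) ≤ T * T := Nat.mul_le_mul hT hT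
    exact ⟨.instr i s (by omega), h2⟩
  | seq c d hc hd =>
    intro s B hi hs hT
    simp only [ok, Bool.and_eq_true] at hi
    simp only [time] at hT ⊢
    obtain ⟨h1, h2⟩ := hc s B hi.1 hs (by omega)
    obtain ⟨h3, h4⟩ := hd _ _ hi.2 h2 (by omega)
    exact ⟨.seq h1 h3, h4.mono (by omega)⟩
  | ite b c d hc hd =>
    intro s B hi hs hT
    simp only [ok, Bool.and_eq_true] at hi
    by_cases hb : b.Holds s
    · simp only [time, hb, if_true] at hT ⊢
      rw [sem_ite_pos s c d hb]
      obtain ⟨h1, h2⟩ := hc s B hi.1 hs (by omega)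
      exact ⟨.ite_true hb h1, h2.mono (by omega)⟩
    · simp only [time, hb, if_false] at hT ⊢
      rw [sem_ite_neg s c d hb]
      obtain ⟨h1, h2⟩ := hd s B hi.2 hs (by omega)
      exact ⟨.ite_false hb h1, h2.mono (by omega)⟩
  | loop i n c hc =>
    intro s B hi hs hT
    simp only [ok, Bool.and_eq_true, decide_eq_true_eq, ne_eq] at hi
    obtain ⟨⟨⟨⟨⟨h1, h2⟩, h3⟩, h4⟩, h5⟩, h6⟩ := hi
    obtain ⟨σ, hσ⟩ : ∃ σ : ℕ → ℕ,
        σ = fun k => ∑ j ∈ Finset.range k, (c.time (loopState i c s j) + 2) := ⟨_, rfl⟩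
    have hσ0 : σ 0 = 0 := by simp [hσ]
    have hσs : ∀ k, σ (k + 1) = σ k + (c.time (loopState i c s k) + 2) := fun k => by
      simp only [hσ, Finset.sum_range_succ]
    have hmono : Monotone σ := monotone_nat_of_le_succ fun k => by rw [hσs]; omega
    have htime : time (loop i n c) s = 2 + σ (s.reg n) := by simp only [time, hσ]
    rw [htime] at hT ⊢
    clear hσ htime
    rw [sem_loop]
    obtain ⟨N, hN⟩ : ∃ N, N = s.reg n := ⟨_, rfl⟩
    rw [← hN] at hT ⊢
    have hstep : ∀ k, k < N → Bounded (loopState i c s k) (B + 1 + σ k) →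
        Bounded (loopState i c s (k + 1)) (B + 1 + σ (k + 1)) ∧
        Exec W (.seq c.compile (.instr (.add i i 4))) (loopState i c s k)
          (c.time (loopState i c s k) + 1) (loopState i c s (k + 1)) := by
      intro k hk hb
      have e1 := hmono (show k + 1 ≤ N by omega)
      rw [hσs] at e1 ⊢
      obtain ⟨g1, g2⟩ := hc _ _ h6 hb (by omega)
      have hr : (sem c (loopState i c s k)).reg i = k := by
        rw [sem_reg_of_notMem c _ h5, loopState_reg]
      have hle := g2.reg i h1
      rw [hr] at hle
      rw [loopState_succ]
      refine ⟨(g2.mono (by omega)).setReg h1 h2 (by omega), .seq g1 ?_⟩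
      have hv : (Instr.add i i 4).value (sem c (loopState i c s k)) = k + 1 := by
        simp only [Instr.value, hr, g2.one]
      have hlt : k + 1 < W := by
        have := Nat.zero_le (T * T)
        omega
      have := Exec.instr (W := W) (.add i i 4) (sem c (loopState i c s k)) (by rwa [hv])
      simpa only [Instr.run, hv] using this
    have hbd : ∀ k, k ≤ N → Bounded (loopState i c s k) (B + 1 + σ k) := by
      intro k
      induction k with
      | zero => intro _; exact (hs.mono (by omega)).setReg h1 h2 (by omega)
      | succ k ih => intro hk; exact (hstep k (by omega) (ih (by omega))).1
    -- The induction is on the number `j` of rounds left, since `Exec.while_true` splits off the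
    -- first round.
    have hwhile : ∀ j, j ≤ N →
        Exec W (.while (.lt i n) (.seq c.compile (.instr (.add i i 4))))
          (loopState i c s (N - j)) (1 + (σ N - σ (N - j))) (loopState i c s N) := by
      intro j
      induction j with
      | zero =>
        intro _
        refine (Exec.while_false ?_).of_eq (by simp)
        simp only [Test.Holds, Nat.sub_zero, loopState_reg,
          loopState_reg_of_notMem i c s N h3 h4]
        omega
      | succ j ih =>
        intro hj
        obtain ⟨k, hk⟩ : ∃ k, k = N - (j + 1) := ⟨_, rfl⟩
        have hex := (hstep k (by omega) (hbd k (by omega))).2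
        specialize ih (by omega)
        rw [← hk]
        rw [show N - j = k + 1 by omega] at ih
        refine (Exec.while_true ?_ hex ih).of_eq ?_
        · simp only [Test.Holds, loopState_reg, loopState_reg_of_notMem i c s _ h3 h4]
          omega
        · have e1 := hmono (show k + 1 ≤ N by omega)
          rw [hσs] at e1 ⊢
          omega
    have hw := hwhile N le_rfl
    rw [Nat.sub_self, loopState_zero, hσ0] at hw
    refine ⟨(Exec.seq (Exec.instr (.lit i 0) s ?_) hw).of_eq (by omega),
      (hbd N le_rfl).mono (by omega)⟩
    simp only [Instr.value]
    omega

/-- Registers that bound loops are not written inside the command, so their values on entry are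
valid throughout, and the loops multiply out. -/
theorem time_le_cost {env : ℕ → ℕ} (c : Cmd) : ∀ (s : State),
    (∀ n ∈ c.limits, n ∉ c.regWrites) → (∀ n ∈ c.limits, s.reg n ≤ env n) →
      time c s ≤ cost env c := by
  induction c with
  | skip => intros; exact le_rfl
  | instr i => intros; exact le_rfl
  | seq c d hc hd =>
    intro s h1 h2
    simp only [limits, regWrites, List.mem_append, not_or] at h1 h2
    simp only [time, cost]
    refine Nat.add_le_add (hc s (fun n hn => (h1 n (.inl hn)).1) fun n hn => h2 n (.inl hn))
      (hd _ (fun n hn => (h1 n (.inr hn)).2) fun n hn => ?_)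
    rw [sem_reg_of_notMem c s (h1 n (.inr hn)).1]
    exact h2 n (.inr hn)
  | ite b c d hc hd =>
    intro s h1 h2
    simp only [limits, regWrites, List.mem_append, not_or] at h1 h2
    simp only [time, cost]
    have i1 := hc s (fun n hn => (h1 n (.inl hn)).1) fun n hn => h2 n (.inl hn)
    have i2 := hd s (fun n hn => (h1 n (.inr hn)).2) fun n hn => h2 n (.inr hn)
    split <;> omega
  | loop i n c hc =>
    intro s h1 h2
    simp only [limits, regWrites, List.mem_cons, not_or] at h1 h2
    simp only [time, cost]
    have : ∀ k ∈ Finset.range (s.reg n), c.time (loopState i c s k) + 2 ≤ c.cost env + 2 := by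
      intro k _
      refine Nat.add_le_add_right (hc _ (fun n hn => (h1 n (.inr hn)).2) fun n hn => ?_) 2
      rw [loopState_reg_of_notMem i c s k (h1 n (.inr hn)).1 (h1 n (.inr hn)).2]
      exact h2 n (.inr hn)
    have h3 := Finset.sum_le_card_nsmul _ _ _ this
    simp only [Finset.card_range, smul_eq_mul] at h3
    have h4 := Nat.mul_le_mul_right (c.cost env + 2) (h2 n (.inl rfl))
    omega

end TwoChain

namespace TwoChain

/-! ### Depth-first search, one step at a time -/

open Relation

/-- A directed graph on `1, …, N` with arcs `1, …, K`; the arcs with a given source form a linked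
list in decreasing order, with `0` as end marker. -/
structure LinkedGraph where
  (N K : ℕ)
  (src dst nxt head : ℕ → ℕ)
  src_mem : ∀ k, 1 ≤ k → k ≤ K → 1 ≤ src k ∧ src k ≤ N
  dst_mem : ∀ k, 1 ≤ k → k ≤ K → 1 ≤ dst k ∧ dst k ≤ N
  nxt_lt : ∀ k, 1 ≤ k → k ≤ K → nxt k < k
  src_nxt : ∀ k, 1 ≤ k → k ≤ K → nxt k = 0 ∨ src (nxt k) = src k
  nxt_max : ∀ k, 1 ≤ k → k ≤ K → ∀ j, nxt k < j → j < k → src j ≠ src k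
  head_le : ∀ x, head x ≤ K
  src_head : ∀ x, head x = 0 ∨ src (head x) = x
  head_max : ∀ x j, head x < j → j ≤ K → src j ≠ x

namespace LinkedGraph

/-- The arc relation. -/
def arc (G : LinkedGraph) (x y : ℕ) : Prop :=
  ∃ k, 1 ≤ k ∧ k ≤ G.K ∧ G.src k = x ∧ G.dst k = y

end LinkedGraph

/-- The state of a depth-first search: marks, list pointers, stack, finishing order, the height
of the stack, the number of roots tried and the number of finished vertices. -/
@[ext] structure Search where
  (vis ptr stk ord : ℕ → ℕ)
  (sp rt cnt : ℕ)

namespace Search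

/-- Push the new vertex `x`. -/
def visit (head : ℕ → ℕ) (a : Search) (x : ℕ) : Search :=
  { a with
    vis := Function.update a.vis x 1
    sp := a.sp + 1
    stk := Function.update a.stk (a.sp + 1) x
    ptr := Function.update a.ptr x (head x) }

/-- One step of the search. -/
def step (N : ℕ) (dst nxt head R ng : ℕ → ℕ) (a : Search) : Search :=
  if a.sp = 0 then
    if a.rt < N then
      if a.vis (R (a.rt + 1)) = 0 ∧ a.vis (ng (R (a.rt + 1))) = 0 then
        visit head { a with rt := a.rt + 1 } (R (a.rt + 1))
      else { a with rt := a.rt + 1 }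
    else a
  else if a.ptr (a.stk a.sp) = 0 then
    { a with
      cnt := a.cnt + 1
      ord := Function.update a.ord (a.cnt + 1) (a.stk a.sp)
      sp := a.sp - 1 }
  else if a.vis (dst (a.ptr (a.stk a.sp))) = 0 then
    visit head { a with ptr := Function.update a.ptr (a.stk a.sp) (nxt (a.ptr (a.stk a.sp))) }
      (dst (a.ptr (a.stk a.sp)))
  else { a with ptr := Function.update a.ptr (a.stk a.sp) (nxt (a.ptr (a.stk a.sp))) }

/-- The vertex `x` is finished. -/
def Black (a : Search) (x : ℕ) : Prop := ∃ i, 1 ≤ i ∧ i ≤ a.cnt ∧ a.ord i = x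

/-- The vertex `x` is on the stack. -/
def OnStack (a : Search) (x : ℕ) : Prop := ∃ i, 1 ≤ i ∧ i ≤ a.sp ∧ a.stk i = x

/-- The invariant of the search. -/
structure Inv (G : LinkedGraph) (R ng : ℕ → ℕ) (a : Search) : Prop where
  rt_le : a.rt ≤ G.N
  vis_mem : ∀ x, a.vis x ≠ 0 → 1 ≤ x ∧ x ≤ G.N
  vis_iff : ∀ x, a.vis x ≠ 0 ↔ a.OnStack x ∨ a.Black x
  disj : ∀ x, a.OnStack x → ¬ a.Black x
  stk_inj : ∀ i j, 1 ≤ i → i ≤ a.sp → 1 ≤ j → j ≤ a.sp → a.stk i = a.stk j → i = j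
  ord_inj : ∀ i j, 1 ≤ i → i ≤ a.cnt → 1 ≤ j → j ≤ a.cnt → a.ord i = a.ord j → i = j
  ptr_le : ∀ x, a.vis x ≠ 0 → a.ptr x ≤ G.K
  src_ptr : ∀ x, a.vis x ≠ 0 → a.ptr x = 0 ∨ G.src (a.ptr x) = x
  seen : ∀ j, 1 ≤ j → j ≤ G.K → a.vis (G.src j) ≠ 0 → a.ptr (G.src j) < j →
    a.vis (G.dst j) ≠ 0
  ptr_black : ∀ x, a.Black x → a.ptr x = 0
  path : ∀ i, 1 ≤ i → i < a.sp → G.arc (a.stk i) (a.stk (i + 1))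
  order : ∀ i j c, 1 ≤ j → j ≤ i → i ≤ a.cnt → G.arc (a.ord j) c →
    (∃ l, 1 ≤ l ∧ l ≤ i ∧ a.ord l = c) ∨ ReflTransGen G.arc c (a.ord i)
  idle : a.sp = 0 → ∀ x, a.vis x ≠ 0 ↔ x ∈ greedy G.arc R ng a.rt
  busy : a.sp ≠ 0 → 1 ≤ a.rt ∧ R a.rt ∉ greedy G.arc R ng (a.rt - 1) ∧
    ng (R a.rt) ∉ greedy G.arc R ng (a.rt - 1) ∧
    (∀ x ∈ greedy G.arc R ng (a.rt - 1), a.vis x ≠ 0) ∧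
    (∀ x, a.vis x ≠ 0 → x ∈ greedy G.arc R ng a.rt) ∧ a.vis (R a.rt) ≠ 0

section

variable {G : LinkedGraph} {R ng : ℕ → ℕ} {a : Search}

theorem inv_init (h1 : ∀ x, a.vis x = 0) (h2 : a.sp = 0) (h3 : a.rt = 0) (h4 : a.cnt = 0) :
    Inv G R ng a := by
  have hb : ∀ x, ¬ a.Black x := by rintro x ⟨i, hi⟩; omega
  have hs : ∀ x, ¬ a.OnStack x := by rintro x ⟨i, hi⟩; omega
  constructor <;> intros <;> simp_all <;> first | omega | simp [greedy]

/-- Every step pushes at most one vertex; pushing an unvisited vertex keeps the invariant apart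
from the bookkeeping of roots. -/
theorem onStack_visit {x y : ℕ} : (visit G.head a x).OnStack y ↔ a.OnStack y ∨ y = x := by
  simp only [OnStack, visit]
  constructor
  · rintro ⟨i, h1, h2, h3⟩
    by_cases hi : i = a.sp + 1
    · subst hi
      simp at h3
      exact Or.inr h3.symm
    · rw [Function.update_of_ne hi] at h3
      exact Or.inl ⟨i, h1, by omega, h3⟩
  · rintro (⟨i, h1, h2, h3⟩ | rfl)
    · exact ⟨i, h1, by omega, by rw [Function.update_of_ne (by omega)]; exact h3⟩
    · exact ⟨a.sp + 1, by omega, le_rfl, by simp⟩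

theorem vis_visit {x y : ℕ} : (visit G.head a x).vis y ≠ 0 ↔ a.vis y ≠ 0 ∨ y = x := by
  simp only [visit, Function.update_apply]
  split <;> simp_all

/-- The part of the invariant that does not mention roots, with the pointer of `x` free to have
advanced. -/
theorem Inv.visit_of (h : Inv G R ng a) {x : ℕ} (hx : a.vis x = 0) (hxm : 1 ≤ x ∧ x ≤ G.N)
    (hpath : a.sp ≠ 0 → G.arc (a.stk a.sp) x) {r : ℕ} (hr : 1 ≤ r) (hrN : r ≤ G.N)
    (h1 : R r ∉ greedy G.arc R ng (r - 1)) (h2 : ng (R r) ∉ greedy G.arc R ng (r - 1))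
    (h3 : ∀ x ∈ greedy G.arc R ng (r - 1), a.vis x ≠ 0)
    (h4 : ∀ x, a.vis x ≠ 0 → x ∈ greedy G.arc R ng r) (h5 : x ∈ greedy G.arc R ng r)
    (h6 : a.vis (R r) ≠ 0 ∨ R r = x) :
    Inv G R ng (visit G.head { a with rt := r } x) := by
  have hns : ¬ a.OnStack x := fun hs => absurd hx ((h.vis_iff x).2 (Or.inl hs))
  have hnb : ¬ a.Black x := fun hs => absurd hx ((h.vis_iff x).2 (Or.inr hs))
  set b : Search := { a with rt := r } with hb
  have hvis : ∀ y, (visit G.head b x).vis y ≠ 0 ↔ a.vis y ≠ 0 ∨ y = x := fun y => vis_visit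
  have hstk : ∀ y, (visit G.head b x).OnStack y ↔ a.OnStack y ∨ y = x := fun y => onStack_visit
  have hblk : ∀ y, (visit G.head b x).Black y ↔ a.Black y := fun y => Iff.rfl
  have hptr : ∀ y, y ≠ x → (visit G.head b x).ptr y = a.ptr y := fun y hy => by
    simp [visit, hb, Function.update_of_ne hy]
  have hptx : (visit G.head b x).ptr x = G.head x := by simp [visit]
  have hstki : ∀ i, i ≤ a.sp → (visit G.head b x).stk i = a.stk i := fun i hi => by
    simp only [visit, hb]
    rw [Function.update_of_ne (by omega)]
  have hstkt : (visit G.head b x).stk (a.sp + 1) = x := by simp [visit, hb]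
  have hsp : (visit G.head b x).sp = a.sp + 1 := rfl
  refine ⟨hrN, ?_, ?_, ?_, ?_, h.ord_inj, ?_, ?_, ?_, ?_, ?_, h.order, ?_, ?_⟩
  · intro y hy
    rcases (hvis y).1 hy with hy | rfl
    · exact h.vis_mem y hy
    · exact hxm
  · intro y
    rw [hvis, hstk, hblk, h.vis_iff]
    tauto
  · intro y hy
    rw [hblk]
    rcases (hstk y).1 hy with hy | rfl
    · exact h.disj y hy
    · exact hnb
  · intro i j hi hi' hj hj' he
    rw [hsp] at hi' hj'
    by_cases e1 : i = a.sp + 1 <;> by_cases e2 : j = a.sp + 1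
    · omega
    · subst e1
      rw [hstkt, hstki j (by omega)] at he
      exact absurd ⟨j, hj, by omega, he.symm⟩ hns
    · subst e2
      rw [hstkt, hstki i (by omega)] at he
      exact absurd ⟨i, hi, by omega, he⟩ hns
    · rw [hstki i (by omega), hstki j (by omega)] at he
      exact h.stk_inj i j hi (by omega) hj (by omega) he
  · intro y hy
    by_cases e : y = x
    · rw [e, hptx]; exact G.head_le x
    · rw [hptr y e]
      exact h.ptr_le y (((hvis y).1 hy).resolve_right e)
  · intro y hy
    by_cases e : y = x
    · rw [e, hptx]; exact G.src_head x
    · rw [hptr y e]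
      exact h.src_ptr y (((hvis y).1 hy).resolve_right e)
  · intro j hj hj' hy hlt
    rw [hvis] at hy ⊢
    by_cases e : G.src j = x
    · rw [e, hptx] at hlt
      exact absurd e (G.head_max x j hlt hj')
    · rw [hptr _ e] at hlt
      exact Or.inl (h.seen j hj hj' (hy.resolve_right e) hlt)
  · intro y hy
    rw [hblk] at hy
    rw [hptr y (by rintro rfl; exact hnb hy)]
    exact h.ptr_black y hy
  · intro i hi hi'
    rw [hsp] at hi'
    rw [hstki i (by omega)]
    by_cases e : i = a.sp
    · rw [e, hstkt]
      exact hpath (by omega)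
    · rw [hstki (i + 1) (by omega)]
      exact h.path i hi (by omega)
  · intro hs
    rw [hsp] at hs
    omega
  · intro _
    refine ⟨hr, h1, h2, fun y hy => (hvis y).2 (Or.inl (h3 y hy)), fun y hy => ?_,
      (hvis _).2 h6⟩
    rcases (hvis y).1 hy with hy | rfl
    · exact h4 y hy
    · exact h5

theorem Inv.reach_top (h : Inv G R ng a) {i : ℕ} (hi : 1 ≤ i) (hi' : i ≤ a.sp) :
    ReflTransGen G.arc (a.stk i) (a.stk a.sp) := by
  obtain ⟨d, hd⟩ : ∃ d, a.sp = i + d := ⟨a.sp - i, by omega⟩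
  have : ∀ d, i + d ≤ a.sp → ReflTransGen G.arc (a.stk i) (a.stk (i + d)) := by
    intro d
    induction d with
    | zero => intro _; exact .refl
    | succ d ih =>
      intro h1
      exact (ih (by omega)).tail (h.path (i + d) (by omega) (by omega))
  rw [hd]
  exact this d (by omega)

theorem Inv.arc_vis (h : Inv G R ng a) {x y : ℕ} (hx : a.vis x ≠ 0) (hp : a.ptr x = 0)
    (hxy : G.arc x y) : a.vis y ≠ 0 := by
  obtain ⟨k, h1, h2, rfl, rfl⟩ := hxy
  exact h.seen k h1 h2 hx (by omega)

theorem Inv.step (h : Inv G R ng a) (hR : ∀ i, 1 ≤ i → i ≤ G.N → 1 ≤ R i ∧ R i ≤ G.N) :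
    Inv G R ng (step G.N G.dst G.nxt G.head R ng a) := by
  unfold Search.step
  split_ifs with c1 c2 c3 c4 c5
  · -- a new root
    have hi := h.idle c1
    refine h.visit_of c3.1 (hR _ (by omega) c2) (fun hc => absurd c1 hc) (by omega) c2 ?_ ?_ ?_
      ?_ ?_ ?_
    · rw [Nat.add_sub_cancel, ← hi]; simpa using c3.1
    · rw [Nat.add_sub_cancel, ← hi]; simpa using c3.2
    · intro x hx
      rw [Nat.add_sub_cancel] at hx
      exact (hi x).2 hx
    · intro x hx
      exact Or.inl ((hi x).1 hx)
    · refine Or.inr ⟨?_, ?_, .refl⟩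
      · rw [← hi]; simpa using c3.1
      · rw [← hi]; simpa using c3.2
    · exact Or.inr rfl
  · -- a root that is skipped
    have hi := h.idle c1
    have hg : greedy G.arc R ng (a.rt + 1) = greedy G.arc R ng a.rt := by
      apply greedy_succ_of_skip
      rw [← hi, ← hi]
      tauto
    exact ⟨c2, h.vis_mem, h.vis_iff, h.disj, h.stk_inj, h.ord_inj, h.ptr_le, h.src_ptr, h.seen,
      h.ptr_black, h.path, h.order, fun _ x => by rw [hg]; exact hi x, fun hs => absurd c1 hs⟩
  · exact h
  · -- the top of the stack is finished
    have hsp : 1 ≤ a.sp := by omega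
    have htop : a.OnStack (a.stk a.sp) := ⟨a.sp, hsp, le_rfl, rfl⟩
    set x := a.stk a.sp with hx
    have hxv : a.vis x ≠ 0 := (h.vis_iff x).2 (Or.inl htop)
    set b : Search := { a with
      cnt := a.cnt + 1
      ord := Function.update a.ord (a.cnt + 1) x
      sp := a.sp - 1 } with hb
    have hordi : ∀ i, i ≤ a.cnt → b.ord i = a.ord i := fun i hi => by
      simp only [hb]
      rw [Function.update_of_ne (by omega)]
    have hordt : b.ord (a.cnt + 1) = x := by simp [hb]
    have hblk : ∀ y, b.Black y ↔ a.Black y ∨ y = x := by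
      intro y
      constructor
      · rintro ⟨i, i1, i2, i3⟩
        by_cases e : i = a.cnt + 1
        · rw [e, hordt] at i3
          exact Or.inr i3.symm
        · have i2' : i ≤ a.cnt + 1 := i2
          rw [hordi i (by omega)] at i3
          exact Or.inl ⟨i, i1, by omega, i3⟩
      · rintro (⟨i, i1, i2, i3⟩ | rfl)
        · exact ⟨i, i1, Nat.le_succ_of_le i2, by rw [hordi i i2]; exact i3⟩
        · exact ⟨a.cnt + 1, by omega, le_rfl, hordt⟩
    have hstk : ∀ y, b.OnStack y ↔ a.OnStack y ∧ y ≠ x := by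
      intro y
      constructor
      · rintro ⟨i, i1, i2, rfl⟩
        have i2' : i ≤ a.sp - 1 := i2
        refine ⟨⟨i, i1, by omega, rfl⟩, fun e => ?_⟩
        have := h.stk_inj i a.sp i1 (by omega) hsp le_rfl e
        omega
      · rintro ⟨⟨i, i1, i2, rfl⟩, i4⟩
        have : i ≠ a.sp := fun e => i4 (by rw [e])
        exact ⟨i, i1, show i ≤ a.sp - 1 by omega, rfl⟩
    have hcl : ∀ y c, a.Black y ∨ y = x → G.arc y c → a.vis c ≠ 0 := by
      rintro y c (hy | rfl) hc
      · exact h.arc_vis ((h.vis_iff y).2 (Or.inr hy)) (h.ptr_black y hy) hc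
      · exact h.arc_vis hxv c4 hc
    refine ⟨h.rt_le, h.vis_mem, ?_, ?_, ?_, ?_, h.ptr_le, h.src_ptr, h.seen, ?_, ?_, ?_, ?_, ?_⟩
    · intro y
      show a.vis y ≠ 0 ↔ _
      rw [h.vis_iff, hstk, hblk]
      by_cases e : y = x
      · subst e; simp [htop]
      · simp [e]
    · intro y hy hy'
      rw [hstk] at hy
      rcases (hblk y).1 hy' with h1 | h1
      · exact h.disj y hy.1 h1
      · exact hy.2 h1
    · intro i j i1 i2 j1 j2 e
      have i2' : i ≤ a.sp - 1 := i2
      have j2' : j ≤ a.sp - 1 := j2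
      exact h.stk_inj i j i1 (by omega) j1 (by omega) e
    · intro i j i1 i2 j1 j2 e
      have i2' : i ≤ a.cnt + 1 := i2
      have j2' : j ≤ a.cnt + 1 := j2
      have hnb := h.disj x htop
      by_cases e1 : i = a.cnt + 1 <;> by_cases e2 : j = a.cnt + 1
      · omega
      · rw [e1, hordt, hordi j (by omega)] at e
        exact absurd ⟨j, j1, by omega, e.symm⟩ hnb
      · rw [e2, hordt, hordi i (by omega)] at e
        exact absurd ⟨i, i1, by omega, e⟩ hnb
      · rw [hordi i (by omega), hordi j (by omega)] at e
        exact h.ord_inj i j i1 (by omega) j1 (by omega) e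
    · intro y hy
      rcases (hblk y).1 hy with h1 | h1
      · exact h.ptr_black y h1
      · rw [h1]; exact c4
    · intro i i1 i2
      have i2' : i < a.sp - 1 := i2
      exact h.path i i1 (by omega)
    -- All arcs of a finished vertex have been scanned, so c has been visited. If c is still on the
    -- stack then it reaches the top along the stack, which is the vertex being finished now;
    -- otherwise c was finished earlier.
    · intro i j c j1 ji i2 hc
      have i2' : i ≤ a.cnt + 1 := i2
      by_cases e : i = a.cnt + 1
      · have hj : a.Black (b.ord j) ∨ b.ord j = x := (hblk _).1 ⟨j, j1, by omega, rfl⟩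
        rcases (h.vis_iff c).1 (hcl _ _ hj hc) with hs | ⟨l, l1, l2, l3⟩
        · obtain ⟨t, t1, t2, rfl⟩ := hs
          right
          rw [e, hordt]
          exact h.reach_top t1 t2
        · exact Or.inl ⟨l, l1, by omega, by rw [hordi l l2]; exact l3⟩
      · rw [hordi j (by omega)] at hc
        rw [hordi i (by omega)]
        rcases h.order i j c j1 ji (by omega) hc with ⟨l, l1, l2, l3⟩ | h1
        · exact Or.inl ⟨l, l1, l2, by rw [hordi l (by omega)]; exact l3⟩
        · exact Or.inr h1
    -- With the stack empty, all visited vertices are finished. Hence the visited set is closed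
    -- under arcs and contains everything reachable from the current root.
    · intro hs y
      obtain ⟨g1, g2, g3, g4, g5, g6⟩ := h.busy c1
      refine ⟨g5 y, fun hy => ?_⟩
      have hs' : a.sp - 1 = 0 := hs
      have hall : ∀ z, a.vis z ≠ 0 → a.Black z ∨ z = x := by
        intro z hz
        rcases (h.vis_iff z).1 hz with ⟨i, i1, i2, rfl⟩ | hz
        · right
          rw [hx, show i = a.sp by omega]
        · exact Or.inl hz
      have hy' : y ∈ greedy G.arc R ng (a.rt - 1 + 1) := by
        rw [Nat.sub_add_cancel g1]; exact hy
      rcases hy' with hy' | ⟨-, -, hy'⟩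
      · exact g4 y hy'
      · rw [Nat.sub_add_cancel g1] at hy'
        show a.vis y ≠ 0
        induction hy' with
        | refl => exact g6
        | @tail z w k1 k2 ih =>
          have hz : a.vis z ≠ 0 := ih (by
            have : z ∈ greedy G.arc R ng (a.rt - 1 + 1) := Or.inr ⟨by
              rwa [Nat.sub_add_cancel g1], by rwa [Nat.sub_add_cancel g1], by
              rwa [Nat.sub_add_cancel g1]⟩
            rwa [Nat.sub_add_cancel g1] at this)
          exact hcl z w (hall z hz) k2
    · intro hs
      exact h.busy c1
  all_goals
    have hsp : 1 ≤ a.sp := by omega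
    have htop : a.OnStack (a.stk a.sp) := ⟨a.sp, hsp, le_rfl, rfl⟩
    set x := a.stk a.sp with hx
    have hxv : a.vis x ≠ 0 := (h.vis_iff x).2 (Or.inl htop)
    set k := a.ptr x with hk
    have hk1 : 1 ≤ k := by omega
    have hkK : k ≤ G.K := h.ptr_le x hxv
    have hsrc : G.src k = x := (h.src_ptr x hxv).resolve_left c4
    have harc : G.arc x (G.dst k) := ⟨k, hk1, hkK, hsrc, rfl⟩
  · -- an arc to a new vertex
    obtain ⟨g1, g2, g3, g4, g5, g6⟩ := h.busy c1
    have hne : G.dst k ≠ x := fun e => hxv (by rw [← e]; exact c5)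
    -- The push is analysed with the pointer of x not yet advanced; advancing it then concerns only
    -- the arc k, whose target has just become visited.
    have hv := h.visit_of c5 (G.dst_mem k hk1 hkK) (fun _ => harc) g1 h.rt_le g2 g3 g4 g5
      (greedy_closed (g5 x hxv) harc) (Or.inl g6)
    have hxnb : ¬ a.Black x := h.disj x htop
    set y := G.dst k with hy
    set b := Search.visit G.head { a with ptr := Function.update a.ptr x (G.nxt k) } y with hb
    have hp : b.ptr = Function.update (Search.visit G.head { a with rt := a.rt } y).ptr x
        (G.nxt k) := by
      simp only [hb, Search.visit]
      rw [Function.update_comm hne]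
    have hpx : b.ptr x = G.nxt k := by rw [hp]; simp
    have hpz : ∀ z, z ≠ x → b.ptr z = (Search.visit G.head { a with rt := a.rt } y).ptr z :=
      fun z hz => by rw [hp, Function.update_of_ne hz]
    refine ⟨hv.rt_le, hv.vis_mem, hv.vis_iff, hv.disj, hv.stk_inj, hv.ord_inj, ?_, ?_, ?_, ?_,
      hv.path, hv.order, hv.idle, hv.busy⟩
    · intro z hz
      by_cases e : z = x
      · rw [e, hpx]
        have := G.nxt_lt k hk1 hkK
        omega
      · rw [hpz z e]; exact hv.ptr_le z hz
    · intro z hz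
      by_cases e : z = x
      · rw [e, hpx, ← hsrc]
        exact G.src_nxt k hk1 hkK
      · rw [hpz z e]; exact hv.src_ptr z hz
    · intro j j1 j2 j3 j4
      by_cases e : G.src j = x
      · rw [e, hpx] at j4
        by_cases e2 : j = k
        · rw [e2]
          exact (vis_visit (G := G) (a := { a with rt := a.rt })).2 (Or.inr rfl)
        · by_cases e3 : j < k
          · exact absurd (e.trans hsrc.symm) (G.nxt_max k hk1 hkK j j4 e3)
          · refine (vis_visit (G := G) (a := { a with rt := a.rt })).2 (Or.inl ?_)
            exact h.seen j j1 j2 (by rw [e]; exact hxv) (by rw [e]; omega)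
      · rw [hpz _ e] at j4
        exact hv.seen j j1 j2 j3 j4
    · intro z hz
      have hz' : a.Black z := hz
      rw [hpz z (by rintro rfl; exact hxnb hz')]
      exact hv.ptr_black z hz
  · -- an arc to an old vertex
    have hxnb : ¬ a.Black x := h.disj x htop
    refine ⟨h.rt_le, h.vis_mem, h.vis_iff, h.disj, h.stk_inj, h.ord_inj, ?_, ?_, ?_, ?_,
      h.path, h.order, h.idle, h.busy⟩
    · intro z hz
      by_cases e : z = x
      · subst e
        have := G.nxt_lt k hk1 hkK
        simp only [Function.update_self]
        omega
      · simp only [Function.update_of_ne e]; exact h.ptr_le z hz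
    · intro z hz
      by_cases e : z = x
      · rw [e]
        simp only [Function.update_self]
        rw [← hsrc]
        exact G.src_nxt k hk1 hkK
      · simp only [Function.update_of_ne e]; exact h.src_ptr z hz
    · intro j j1 j2 j3 j4
      by_cases e : G.src j = x
      · simp only [e, Function.update_self] at j4
        by_cases e2 : j = k
        · rw [e2]; exact c5
        · by_cases e3 : j < k
          · exact absurd (e.trans hsrc.symm) (G.nxt_max k hk1 hkK j j4 e3)
          · exact h.seen j j1 j2 (by rw [e]; exact hxv) (by rw [e]; omega)
      · simp only [Function.update_of_ne e] at j4
        exact h.seen j j1 j2 j3 j4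
    · intro z hz
      have hz' : a.Black z := hz
      have : z ≠ x := by rintro rfl; exact hxnb hz'
      simp only [Function.update_of_ne this]
      exact h.ptr_black z hz

/-! ### Termination of the search. -/

/-- The arcs that the search has not gone through. -/
def pending (G : LinkedGraph) (a : Search) : Finset ℕ :=
  (Finset.Icc 1 G.K).filter fun j => a.vis (G.src j) = 0 ∨ j ≤ a.ptr (G.src j)

theorem mem_pending {j : ℕ} : j ∈ pending G a ↔
    (1 ≤ j ∧ j ≤ G.K) ∧ (a.vis (G.src j) = 0 ∨ j ≤ a.ptr (G.src j)) := by
  unfold pending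
  rw [Finset.mem_filter, Finset.mem_Icc]

/-- The number of steps that are left. -/
def todo (G : LinkedGraph) (a : Search) : ℕ :=
  (G.N - a.rt) + (G.N - a.cnt) + (pending G a).card

theorem Inv.cnt_le (h : Inv G R ng a) : a.cnt ≤ G.N := by
  have h1 : Set.InjOn a.ord (Finset.Icc 1 a.cnt) := by
    intro i hi j hj e
    simp only [Finset.coe_Icc, Set.mem_Icc] at hi hj
    exact h.ord_inj i j hi.1 hi.2 hj.1 hj.2 e
  have h2 : Set.MapsTo a.ord (Finset.Icc 1 a.cnt) (Finset.Icc 1 G.N : Finset ℕ) := by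
    intro i hi
    simp only [Finset.coe_Icc, Set.mem_Icc] at hi ⊢
    exact h.vis_mem _ ((h.vis_iff _).2 (Or.inr ⟨i, hi.1, hi.2, rfl⟩))
  simpa using Finset.card_le_card_of_injOn a.ord h2 h1

/-- The arcs of an unvisited vertex are pending already. They stay so after the push, because the
new pointer is the head of the list, which has the largest number among the arcs leaving x. -/
theorem pending_visit {x : ℕ} (hx : a.vis x = 0) :
    pending G (visit G.head a x) = pending G a := by
  ext j
  rw [mem_pending, mem_pending]
  simp only [visit]
  refine and_congr_right fun hj => ?_
  by_cases e : G.src j = x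
  · have := G.head_max x j
    simp only [e, Function.update_self, hx, true_or, iff_true, one_ne_zero, false_or]
    by_contra hlt
    exact this (by omega) hj.2 e
  · simp only [Function.update_of_ne e]

/-- Each step uses up a root, finishes a vertex or passes an arc. Pushing a vertex costs nothing
extra, by `pending_visit`. -/
theorem Inv.todo_step (h : Inv G R ng a) (hR : ∀ i, 1 ≤ i → i ≤ G.N → 1 ≤ R i ∧ R i ≤ G.N)
    (hd : ¬ (a.sp = 0 ∧ a.rt = G.N)) :
    todo G (Search.step G.N G.dst G.nxt G.head R ng a) < todo G a := by
  have hinv := h.step hR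
  have hrt := h.rt_le
  revert hinv
  unfold Search.step
  split_ifs with c1 c2 c3 c4 c5
  · intro _
    have := pending_visit (G := G) (a := { a with rt := a.rt + 1 }) c3.1
    simp only [todo, this]
    simp only [visit]
    have e : pending G { a with rt := a.rt + 1 } = pending G a := rfl
    rw [e]
    omega
  · intro _
    have e : pending G { a with rt := a.rt + 1 } = pending G a := rfl
    simp only [todo, e]
    omega
  · omega
  · intro hinv
    have h1 : a.cnt + 1 ≤ G.N := hinv.cnt_le
    have e : pending G { a with
      cnt := a.cnt + 1
      ord := Function.update a.ord (a.cnt + 1) (a.stk a.sp)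
      sp := a.sp - 1 } = pending G a := rfl
    simp only [todo, e]
    omega
  all_goals
    intro _
    have hsp : 1 ≤ a.sp := by omega
    have hxv : a.vis (a.stk a.sp) ≠ 0 := (h.vis_iff _).2 (Or.inl ⟨a.sp, hsp, le_rfl, rfl⟩)
    have hsrc := (h.src_ptr _ hxv).resolve_left c4
    have hkK := h.ptr_le _ hxv
    have hlt : (pending G { a with
        ptr := Function.update a.ptr (a.stk a.sp) (G.nxt (a.ptr (a.stk a.sp))) }).card < (pending G a).card := by
      set x := a.stk a.sp
      set k := a.ptr x with hk
      have hn := G.nxt_lt k (by omega) hkK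
      refine Finset.card_lt_card ⟨fun j hj => ?_, fun hs => ?_⟩
      · rw [mem_pending] at hj ⊢
        refine ⟨hj.1, hj.2.imp_right fun hj' => ?_⟩
        by_cases e : G.src j = x
        · simp only [e, Function.update_self] at hj' ⊢
          omega
        · simpa only [Function.update_of_ne e] using hj'
      · have hmem : k ∈ pending G a := by
          rw [mem_pending]
          exact ⟨⟨by omega, hkK⟩, Or.inr (by rw [hsrc])⟩
        have := mem_pending.1 (hs hmem)
        simp only [hsrc, Function.update_self] at this
        rcases this.2 with h1 | h1
        · exact hxv h1
        · omega
  · have := pending_visit (G := G) (a := { a with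
        ptr := Function.update a.ptr (a.stk a.sp) (G.nxt (a.ptr (a.stk a.sp))) }) c5
    simp only [todo, this]
    simp only [visit]
    omega
  · simp only [todo]
    omega

/-- Enough steps bring the search to its end. -/
theorem Inv.run (hR : ∀ i, 1 ≤ i → i ≤ G.N → 1 ≤ R i ∧ R i ≤ G.N) (b : ℕ) :
    ∀ {a : Search}, Inv G R ng a → todo G a ≤ b →
      Inv G R ng ((Search.step G.N G.dst G.nxt G.head R ng)^[b] a) ∧
      ((Search.step G.N G.dst G.nxt G.head R ng)^[b] a).sp = 0 ∧
      ((Search.step G.N G.dst G.nxt G.head R ng)^[b] a).rt = G.N := by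
  induction b with
  | zero =>
    intro a h hb
    by_cases hd : a.sp = 0 ∧ a.rt = G.N
    · exact ⟨h, hd⟩
    · have := h.todo_step hR hd
      omega
  | succ b ih =>
    intro a h hb
    rw [Function.iterate_succ_apply]
    by_cases hd : a.sp = 0 ∧ a.rt = G.N
    · have hst : Search.step G.N G.dst G.nxt G.head R ng a = a := by
        unfold Search.step
        rw [if_pos hd.1, if_neg (by omega)]
      rw [hst]
      have h0 : ∀ b, (Search.step G.N G.dst G.nxt G.head R ng)^[b] a = a :=
        fun b => Function.iterate_fixed hst b
      rw [h0]
      exact ⟨h, hd⟩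
    · have := h.todo_step hR hd
      exact ih (h.step hR) (by omega)

/-- This yields the number of rounds after which a counted loop can replace the usual loop until the
end of the search. -/
theorem todo_init (h1 : a.rt = 0) (h2 : a.cnt = 0) : todo G a ≤ 2 * G.N + G.K := by
  have : (pending G a).card ≤ G.K := by
    have hs : pending G a ⊆ Finset.Icc 1 G.K := fun j hj => by
      rw [Finset.mem_Icc]
      exact (mem_pending.1 hj).1
    simpa using Finset.card_le_card hs
  simp only [todo, h1, h2]
  omega

end

end Search

end TwoChain

/-! ### Finishing orders and assignments obtained from two searches. -/

namespace TwoChain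

open Relation

theorem greedy_congr {arc : ℕ → ℕ → Prop} {R ng R' ng' : ℕ → ℕ} {N : ℕ}
    (h1 : ∀ i, 1 ≤ i → i ≤ N → R i = R' i) (h2 : ∀ i, 1 ≤ i → i ≤ N → ng (R i) = ng' (R i)) :
    ∀ i ≤ N, greedy arc R ng i = greedy arc R' ng' i := by
  intro i
  induction i with
  | zero => intro _; rfl
  | succ i ih =>
    intro hi
    ext y
    simp only [greedy, ih (by omega), h2 (i + 1) (by omega) hi]
    rw [h1 (i + 1) (by omega) hi]

namespace Search

variable {G : LinkedGraph} {R ng : ℕ → ℕ} {a b : Search}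

/-- A full search finishes all vertices, in a finishing order. -/
theorem Inv.exists_post (h : Inv G R ng a) (hsp : a.sp = 0) (hrt : a.rt = G.N)
    (hR : ∀ i, 1 ≤ i → i ≤ G.N → R i = i) (hng : ∀ i, 1 ≤ i → i ≤ G.N → ng i = 0) :
    ∃ post : ℕ → ℕ, (∀ x, 1 ≤ x → x ≤ G.N → 1 ≤ post x ∧ a.ord (post x) = x) ∧
      (∀ x, post x ≤ G.N) ∧
      (∀ i, 1 ≤ i → i ≤ G.N → (1 ≤ a.ord i ∧ a.ord i ≤ G.N) ∧ post (a.ord i) = i) ∧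
      FinishOrder G.arc post := by
  have hall : ∀ x, 1 ≤ x → x ≤ G.N → ∃ i, 1 ≤ i ∧ i ≤ a.cnt ∧ a.ord i = x := by
    intro x h1 h2
    have hx : a.vis x ≠ 0 := by
      rw [h.idle hsp, hrt]
      rcases greedy_decides (arc := G.arc) (R := R) (ng := ng) h1 h2 with h3 | h3
      · rwa [hR x h1 h2] at h3
      -- In the first search all negations are read as 0, which is not a vertex and is never marked,
      -- so no root is skipped on their account.
      · rw [hR x h1 h2, hng x h1 h2, ← hrt, ← h.idle hsp] at h3
        exact absurd (h.vis_mem 0 h3).1 (by omega)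
    rcases (h.vis_iff x).1 hx with ⟨i, h3, h4, -⟩ | h3
    · omega
    · exact h3
  have hcnt : a.cnt = G.N := by
    refine le_antisymm h.cnt_le ?_
    have hs : Finset.Icc 1 G.N ⊆ (Finset.Icc 1 a.cnt).image a.ord := by
      intro x hx
      rw [Finset.mem_Icc] at hx
      obtain ⟨i, h1, h2, h3⟩ := hall x hx.1 hx.2
      exact Finset.mem_image.2 ⟨i, Finset.mem_Icc.2 ⟨h1, h2⟩, h3⟩
    simpa using (Finset.card_le_card hs).trans Finset.card_image_le
  have hex : ∀ x, ∃ i, i ≤ G.N ∧ ((1 ≤ x ∧ x ≤ G.N) → 1 ≤ i ∧ a.ord i = x) ∧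
      (¬ (1 ≤ x ∧ x ≤ G.N) → i = 0) := by
    intro x
    by_cases hx : 1 ≤ x ∧ x ≤ G.N
    · obtain ⟨i, h1, h2, h3⟩ := hall x hx.1 hx.2
      exact ⟨i, by omega, fun _ => ⟨h1, h3⟩, fun h' => absurd hx h'⟩
    · exact ⟨0, by omega, fun h' => absurd h' hx, fun _ => rfl⟩
  choose post p1 p2 p3 using hex
  have hord : ∀ i, 1 ≤ i → i ≤ G.N → (1 ≤ a.ord i ∧ a.ord i ≤ G.N) ∧ post (a.ord i) = i := by
    intro i h1 h2
    have h3 := h.vis_mem (a.ord i) ((h.vis_iff _).2 (Or.inr ⟨i, h1, by omega, rfl⟩))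
    obtain ⟨h4, h5⟩ := p2 _ h3
    exact ⟨h3, h.ord_inj _ _ h4 (by rw [hcnt]; exact p1 _) h1 (by omega) h5⟩
  refine ⟨post, fun x h1 h2 => p2 x ⟨h1, h2⟩, p1, hord, ?_⟩
  intro u x c hle hc
  obtain ⟨k, k1, k2, k3, k4⟩ := hc
  have hx := G.src_mem k k1 k2
  have hcm := G.dst_mem k k1 k2
  rw [k3] at hx
  rw [k4] at hcm
  obtain ⟨x1, x2⟩ := p2 x hx
  have hu : 1 ≤ u ∧ u ≤ G.N := by
    by_contra hu
    have := p3 u hu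
    omega
  obtain ⟨u1, u2⟩ := p2 u hu
  rcases h.order (post u) (post x) c x1 hle (by rw [hcnt]; exact p1 u)
    ⟨k, k1, k2, k3.trans x2.symm, k4⟩ with ⟨l, l1, l2, l3⟩ | h1
  · left
    rw [← l3, (hord l l1 (l2.trans (p1 u))).2]
    exact l2
  · right
    rwa [u2] at h1

/-- The marks after the second search form a closed and total assignment, which is consistent
whenever there is a consistent one. -/
theorem Inv.assignment {R' ng' neg : ℕ → ℕ} (h : Inv G R ng a) (hsp : a.sp = 0) (hrt : a.rt = G.N)
    (hR : ∀ i, 1 ≤ i → i ≤ G.N → R i = i) (hng : ∀ i, 1 ≤ i → i ≤ G.N → ng i = 0)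
    (h' : Inv G R' ng' b) (hsp' : b.sp = 0) (hrt' : b.rt = G.N)
    (hR' : ∀ i, 1 ≤ i → i ≤ G.N → R' i = neg (a.ord (G.N + 1 - i)))
    (hng' : ∀ i, 1 ≤ i → i ≤ G.N → ng' i = neg i)
    (hneg : ∀ i, 1 ≤ i → i ≤ G.N → (1 ≤ neg i ∧ neg i ≤ G.N) ∧ neg (neg i) = i)
    (harc : ∀ x y, G.arc x y → G.arc (neg y) (neg x)) :
    (∀ x y, G.arc x y → b.vis x ≠ 0 → b.vis y ≠ 0) ∧
    (∀ x, 1 ≤ x → x ≤ G.N → b.vis x ≠ 0 ∨ b.vis (neg x) ≠ 0) ∧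
    ∀ A : Set ℕ, (∀ x y, G.arc x y → x ∈ A → y ∈ A) →
      (∀ x, 1 ≤ x → x ≤ G.N → (x ∈ A ↔ neg x ∉ A)) →
      ∀ x, 1 ≤ x → x ≤ G.N → ¬ (b.vis x ≠ 0 ∧ b.vis (neg x) ≠ 0) := by
  obtain ⟨post, p1, p2, p3, p4⟩ := h.exists_post hsp hrt hR hng
  have hv : ∀ x, b.vis x ≠ 0 ↔ x ∈ greedy G.arc (fun k => neg (a.ord (G.N + 1 - k))) neg G.N := by
    intro x
    rw [h'.idle hsp', hrt', greedy_congr (R' := fun k => neg (a.ord (G.N + 1 - k))) (ng' := neg)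
      hR' (fun i h1 h2 => ?_) G.N le_rfl]
    rw [hR' i h1 h2]
    have := (hneg _ (p3 (G.N + 1 - i) (by omega) (by omega)).1.1
      (p3 (G.N + 1 - i) (by omega) (by omega)).1.2).1
    exact hng' _ this.1 this.2
  refine ⟨fun x y hxy => ?_, fun x h1 h2 => ?_, fun A hA hA' x h1 h2 => ?_⟩
  · rw [hv, hv]
    exact fun hx => greedy_closed hx hxy
  · rw [hv, hv]
    obtain ⟨q1, q2⟩ := p1 x h1 h2
    have q3 := p2 x
    have := greedy_decides (arc := G.arc) (R := fun k => neg (a.ord (G.N + 1 - k))) (ng := neg)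
      (i := G.N) (j := G.N + 1 - post x) (by omega) (by omega)
    simp only [show G.N + 1 - (G.N + 1 - post x) = post x by omega, q2,
      (hneg x h1 h2).2] at this
    exact this.symm
  · rw [hv, hv]
    exact greedy_consistent (L := {x | 1 ≤ x ∧ x ≤ G.N})
      (fun x y ⟨k, k1, k2, k3, k4⟩ => ⟨k3 ▸ G.src_mem k k1 k2, k4 ▸ G.dst_mem k k1 k2⟩)
      (fun x hx => (hneg x hx.1 hx.2).1) (fun x hx => (hneg x hx.1 hx.2).2) harc
      (fun x hx => p1 x hx.1 hx.2) p2 p3 p4 hA (fun x hx => hA' x hx.1 hx.2) le_rfl ⟨h1, h2⟩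

end Search

end TwoChain

namespace TwoChain

open Cmd Instr

/-! ### The program

Registers: `4`, `5` constants one and zero, `10`, …, `14` the numbers of left vertices, right
vertices, edges, restricted edges and nonedges, `16` the number of arcs, `18` the number of
literals. Arrays: `2`, `3` restricted edges, `4` adjacency matrix with the edge numbers, `5`, `6`
edges, `7`, `8` nonedges, `9`, `10` the shorter of these two lists, `11`, …, `14` arcs, `15` a
partner of each edge, `16` negation of literals, `17`, …, `22` search, `23` colours, `24` edges to
be added to the first graph. -/

/-- `r := A[u, v]`. -/
def getA (r u v : ℕ) : Cmd :=
  block [mul 60 u 11, add 61 60 v, load r 4 61]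

/-- Append the arc from `x` to `y`. -/
def addArc (x y : ℕ) : Cmd :=
  block [add 16 16 4, store 11 16 x, store 14 16 y, load 39 12 x, store 13 16 39, store 12 x 16]

/-- The degenerate cases: an empty or complete bipartite graph is itself a chain graph, so the
answer is E₁ = ∅ and E₂ = E. -/
def cmdTrivial : Cmd :=
  block [loop 20 12 (block [load 22 0 20, store 2 20 22, load 22 1 20, store 3 20 22]),
    lit 0 1, lit 1 0]

/-- Edges are numbered from 1, so that the entry 0 of the matrix marks a nonedge. Register 25 runs m
ahead of the edge number, since e + m is the literal opposite to e. -/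
def cmdEdges : Cmd :=
  block [move 25 12,
    loop 20 12 (block [load 22 0 20, load 23 1 20, add 24 20 4, store 5 24 22, store 6 24 23,
      mul 60 22 11, add 61 60 23, store 4 61 24, add 25 25 4, store 16 24 25, store 16 25 24]),
    move 18 25]

def cmdZeros : Cmd :=
  block [lit 14 0,
    loop 20 10 (loop 21 11 (block [getA 22 20 21,
      ite (.eq 22 5) (block [store 7 14 20, store 8 14 21, add 14 14 4]) skip]))]

/-- Going through all pairs of the shorter list costs min(m, m̂)², which is at most m m̂. -/
def cmdShorter : Cmd :=
  ite (.le 12 14)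
    (block [move 15 12,
      loop 20 15 (block [load 22 0 20, store 9 20 22, load 22 1 20, store 10 20 22])])
    (block [move 15 14,
      loop 20 15 (block [load 22 7 20, store 9 20 22, load 22 8 20, store 10 20 22])])

/-- Load the pair with numbers `20` and `21` and look up the matrix. -/
def pairLoad : Cmd :=
  block [load 22 9 20, load 23 10 20, load 24 9 21, load 25 10 21,
    getA 26 22 23, getA 27 24 25, getA 28 22 25, getA 29 24 23,
    ite (.eq 26 5)
      (block [move 30 28, move 31 29, move 32 26, move 33 27])
      (block [move 30 26, move 31 27, move 32 28, move 33 29])]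

/-- Only two of the four implications of a conflict are emitted; their contrapositives arise when
the same conflict is met with its two edges exchanged. -/
def pairEmit : Cmd :=
  ite (.ne 30 5) (ite (.ne 31 5) (ite (.eq 32 5) (ite (.eq 33 5)
    (block [store 15 30 31, load 34 16 30, load 35 16 31, addArc 34 31, addArc 30 35])
    skip) skip) skip) skip

def cmdPairs : Cmd :=
  loop 20 15 (loop 21 15 (seq pairLoad pairEmit))

def restrictedHead : Cmd :=
  block [load 22 2 20, load 23 3 20, getA 26 22 23, load 34 16 26, addArc 34 26]

def restrictedBody : Cmd :=
  seq (block [load 24 7 21, load 25 8 21, getA 28 22 25, getA 29 24 23])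
    (ite (.ne 28 5) (ite (.ne 29 5)
      (block [load 34 16 28, load 35 16 29, addArc 34 29, addArc 35 28]) skip) skip)

def cmdRestricted : Cmd :=
  loop 20 13 (seq restrictedHead (loop 21 14 restrictedBody))

def cmdVisit (x : ℕ) : Cmd :=
  block [store 19 x 4, add 40 40 4, store 21 40 x, load 39 12 x, store 20 x 39]

def cmdStep : Cmd :=
  ite (.eq 40 5)
    (ite (.lt 41 18)
      (block [add 41 41 4, load 22 17 41, load 23 18 22, load 24 19 22, load 25 19 23,
        ite (.eq 24 5) (ite (.eq 25 5) (cmdVisit 22) skip) skip])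
      skip)
    (block [load 22 21 40, load 23 20 22,
      ite (.eq 23 5)
        (block [add 42 42 4, store 22 42 22, sub 40 40 4])
        (block [load 24 13 23, store 20 22 24, load 25 14 23, load 26 19 25,
          ite (.eq 26 5) (cmdVisit 25) skip])])

def cmdSearch : Cmd :=
  block [lit 40 0, lit 41 0, lit 42 0, loop 20 17 cmdStep]

/-- The number of arcs plus 4m is the bound 2N + K of `Search.todo_init` for N = 2m literals and K
arcs. The increments by one obey the discipline on sums. -/
def cmdBudget : Cmd :=
  block [move 17 16, loop 20 12 (block [add 17 17 4, add 17 17 4, add 17 17 4, add 17 17 4]),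
    loop 20 18 (block [add 22 20 4, store 17 22 22])]

/-- Prepares the second search: its roots are the negations of the literals in reversed finishing
order, the table of negations becomes effective, and the marks are cleared. -/
def cmdReverse : Cmd :=
  loop 20 18 (block [add 22 20 4, sub 23 18 20, load 24 22 23, load 25 16 24, store 17 22 25,
    load 26 16 22, store 18 22 26, store 19 22 5])

/-- The literal e says that edge e is outside S, so membership in S is read off the mark of its
negation. Register 43 signals that both literals are marked. Edges without a partner are left out,
which makes the colouring tight. -/
def cmdColour : Cmd :=
  block [lit 43 0,
    loop 20 12 (block [add 22 20 4, load 23 16 22, load 24 19 22, load 25 19 23, load 26 15 22,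
      ite (.ne 25 5)
        (block [ite (.ne 24 5) (lit 43 1) skip,
          ite (.ne 26 5) (store 23 22 4) skip]) skip])]

/-- Load the edge with number `24`, its partner `25`, and the matrix entries of the six-cycle
opposite to the nonedge in registers `22` and `23`. -/
def fixLoad : Cmd :=
  block [load 26 5 24, load 27 6 24, load 28 5 25, load 29 6 25,
    getA 30 26 23, getA 31 22 27, getA 32 28 23, getA 33 22 29]

/-- If ub and av have the same colour, it is copied to uv. This is the flip if uv had the other
colour and changes nothing if not. -/
def fixStore : Cmd :=
  ite (.ne 30 5) (ite (.ne 31 5) (ite (.ne 32 5) (ite (.ne 33 5)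
    (block [load 34 23 30, load 35 23 31, ite (.eq 34 35) (store 23 24 34) skip])
    skip) skip) skip) skip

def fixBody : Cmd :=
  block [add 24 21 4, load 25 15 24, ite (.ne 25 5) (seq fixLoad fixStore) skip]

def cmdFix : Cmd :=
  loop 20 14 (block [load 22 7 20, load 23 8 20, loop 21 12 fixBody])

/-- No test for adjacency is needed: a nonedge has number 0, and the colour stored in cell 0 is 0.
-/
def witBody : Cmd :=
  block [load 22 7 21, load 23 8 21, getA 30 26 23, getA 31 22 27, load 34 23 30, load 35 23 31,
    ite (.eq 34 4) (ite (.eq 35 4) (store 24 24 4) skip) skip]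

def cmdWit : Cmd :=
  loop 20 12 (block [add 24 20 4, load 25 15 24,
    ite (.eq 25 5) (block [load 26 5 24, load 27 6 24, loop 21 14 witBody]) skip])

def outLeft : Cmd :=
  block [store 0 1 26, store 1 1 27, add 1 1 4]

def outRight : Cmd :=
  block [store 2 2 26, store 3 2 27, add 2 2 4]

def outBody : Cmd :=
  block [add 24 20 4, load 26 5 24, load 27 6 24, load 25 23 24, load 28 24 24,
    ite (.eq 25 5) (block [outRight, ite (.ne 28 5) outLeft skip]) outLeft]

def cmdOut : Cmd :=
  block [lit 1 0, lit 2 0, lit 0 1, loop 20 12 outBody]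

def cmdMain : Cmd :=
  block [cmdEdges, cmdZeros, cmdShorter, cmdPairs, cmdRestricted, cmdBudget, cmdSearch,
    cmdReverse, cmdSearch, cmdColour,
    ite (.ne 43 5) (lit 0 0) (block [cmdFix, cmdWit, cmdOut])]

def cmdInit : Cmd :=
  block [move 10 0, move 11 1, move 12 2, move 13 3, mul 60 10 11]

/-- Register 60 holds pq after `cmdInit`, so the second test detects that there are no nonedges. -/
def cmdAll : Cmd :=
  seq cmdInit (ite (.eq 12 5) cmdTrivial (ite (.eq 12 60) cmdTrivial cmdMain))

theorem cmdAll_ok : cmdAll.ok = true := by decide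

end TwoChain

namespace TwoChain

open Cmd Instr

/-! ### Instances with numbered edges -/

/-- A bipartite graph with vertices `0, …, p - 1` and `0, …, q - 1` and numbered edges
`1, …, m`, and a list of restricted edges. The matrix `A` holds the edge numbers. -/
structure Inst where
  (p q m f : ℕ)
  (eu ev fu fv : ℕ → ℕ)
  A : ℕ → ℕ → ℕ
  eu_lt : ∀ e, 1 ≤ e → e ≤ m → eu e < p
  ev_lt : ∀ e, 1 ≤ e → e ≤ m → ev e < q
  A_end : ∀ e, 1 ≤ e → e ≤ m → A (eu e) (ev e) = e
  A_le : ∀ u v, A u v ≤ m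
  eu_A : ∀ u v, A u v ≠ 0 → eu (A u v) = u
  ev_A : ∀ u v, A u v ≠ 0 → ev (A u v) = v
  A_res : ∀ k < f, A (fu k) (fv k) ≠ 0

/-- An instance together with a list of the nonedges. -/
structure Graph extends Inst where
  mh : ℕ
  (zu zv : ℕ → ℕ)
  zu_lt : ∀ k < mh, zu k < p
  zv_lt : ∀ k < mh, zv k < q
  A_zero : ∀ k < mh, A (zu k) (zv k) = 0
  zero_mem : ∀ u v, u < p → v < q → A u v = 0 → ∃ k < mh, zu k = u ∧ zv k = v

/-- Negation of literals. -/
def Inst.neg (D : Inst) (x : ℕ) : ℕ := if x ≤ D.m then x + D.m else x - D.m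

/-- The input is stored. -/
structure Loaded (D : Inst) (s : State) : Prop where
  r4 : s.reg 4 = 1
  r5 : s.reg 5 = 0
  r10 : s.reg 10 = D.p
  r11 : s.reg 11 = D.q
  r12 : s.reg 12 = D.m
  r13 : s.reg 13 = D.f
  a2 : ∀ k < D.f, s.arr 2 k = D.fu k
  a3 : ∀ k < D.f, s.arr 3 k = D.fv k

/-- The edges are numbered and the matrix is filled in. -/
structure Indexed (D : Inst) (s : State) : Prop extends Loaded D s where
  r18 : s.reg 18 = 2 * D.m
  a4 : ∀ u v, u < D.p → v < D.q → s.arr 4 (u * D.q + v) = D.A u v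
  a5 : ∀ e, 1 ≤ e → e ≤ D.m → s.arr 5 e = D.eu e
  a6 : ∀ e, 1 ≤ e → e ≤ D.m → s.arr 6 e = D.ev e
  a16 : ∀ x, 1 ≤ x → x ≤ 2 * D.m → s.arr 16 x = D.neg x

/-- The nonedges are listed, too. -/
structure Base (D : Graph) (s : State) : Prop extends Indexed D.toInst s where
  r14 : s.reg 14 = D.mh
  a7 : ∀ k < D.mh, s.arr 7 k = D.zu k
  a8 : ∀ k < D.mh, s.arr 8 k = D.zv k

theorem Loaded.congr {D : Inst} {s s' : State} (h : Loaded D s)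
    (hr : ∀ r ∈ [4, 5, 10, 11, 12, 13], s'.reg r = s.reg r)
    (ha : ∀ a ∈ [2, 3], s'.arr a = s.arr a) : Loaded D s' := by
  obtain ⟨h1, h2, h3, h4, h5, h6, h7, h8⟩ := h
  constructor
  all_goals first
    | rw [hr _ (by decide)]; assumption
    | rw [ha _ (by decide)]; assumption

theorem Indexed.congr {D : Inst} {s s' : State} (h : Indexed D s)
    (hr : ∀ r ∈ [4, 5, 10, 11, 12, 13, 18], s'.reg r = s.reg r)
    (ha : ∀ a ∈ [2, 3, 4, 5, 6, 16], s'.arr a = s.arr a) : Indexed D s' := by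
  refine ⟨h.toLoaded.congr (fun r h' => hr r (by revert h'; simp; omega))
    (fun r h' => ha r (by revert h'; simp; omega)), ?_, ?_, ?_, ?_, ?_⟩
  · rw [hr _ (by decide)]; exact h.r18
  · rw [ha _ (by decide)]; exact h.a4
  · rw [ha _ (by decide)]; exact h.a5
  · rw [ha _ (by decide)]; exact h.a6
  · rw [ha _ (by decide)]; exact h.a16

theorem Base.congr {D : Graph} {s s' : State} (h : Base D s)
    (hr : ∀ r ∈ [4, 5, 10, 11, 12, 13, 14, 18], s'.reg r = s.reg r)
    (ha : ∀ a ∈ [2, 3, 4, 5, 6, 7, 8, 16], s'.arr a = s.arr a) : Base D s' := by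
  refine ⟨h.toIndexed.congr (fun r h' => hr r (by revert h'; simp; omega))
    (fun r h' => ha r (by revert h'; simp; omega)), ?_, ?_, ?_⟩
  · rw [hr _ (by decide)]; exact h.r14
  · rw [ha _ (by decide)]; exact h.a7
  · rw [ha _ (by decide)]; exact h.a8

theorem Base.sem {D : Graph} {s : State} (h : Base D s) (c : Cmd)
    (hr : ∀ r ∈ [4, 5, 10, 11, 12, 13, 14, 18], r ∉ c.regWrites)
    (ha : ∀ a ∈ [2, 3, 4, 5, 6, 7, 8, 16], a ∉ c.arrWrites) : Base D (sem c s) :=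
  h.congr (fun r h' => sem_reg_of_notMem c s (hr r h'))
    fun a h' => sem_arr_of_notMem c s (ha a h')

theorem Base.setReg {D : Graph} {s : State} (h : Base D s) {r v : ℕ}
    (hr : r ∉ [4, 5, 10, 11, 12, 13, 14, 18]) : Base D (s.setReg r v) :=
  h.congr (fun r' h' => by
    rw [State.setReg_reg, if_neg (by rintro rfl; exact hr h')]) fun a _ => rfl

theorem addr_inj {q u v u' v' : ℕ} (hv : v < q) (hv' : v' < q) (h : u * q + v = u' * q + v') :
    u = u' ∧ v = v' := by
  have h1 : (u * q + v) / q = u := by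
    rw [mul_comm, Nat.mul_add_div (by omega), Nat.div_eq_of_lt hv, add_zero]
  have h2 : (u' * q + v') / q = u' := by
    rw [mul_comm, Nat.mul_add_div (by omega), Nat.div_eq_of_lt hv', add_zero]
  have h3 : u = u' := by rw [← h1, h, h2]
  subst h3
  exact ⟨rfl, by omega⟩

theorem Inst.A_zero_of_end_ne (D : Inst) {e u v : ℕ} (h1 : 1 ≤ e) (h2 : e ≤ D.m) :
    D.A u v = e ↔ u = D.eu e ∧ v = D.ev e := by
  constructor
  · rintro rfl
    exact ⟨(D.eu_A u v (by omega)).symm, (D.ev_A u v (by omega)).symm⟩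
  · rintro ⟨rfl, rfl⟩
    exact D.A_end e h1 h2

/-! ### Preparations -/

theorem cmdEdges_spec {D : Inst} {s : State} (h : Loaded D s)
    (h0 : ∀ k < D.m, s.arr 0 k = D.eu (k + 1)) (h1 : ∀ k < D.m, s.arr 1 k = D.ev (k + 1))
    (h4 : ∀ i, s.arr 4 i = 0) : Indexed D (sem cmdEdges s) := by
  let Inv : ℕ → State → Prop := fun k st =>
    st.reg 25 = D.m + k ∧
    (∀ u v, u < D.p → v < D.q → st.arr 4 (u * D.q + v) = if D.A u v ≤ k then D.A u v else 0) ∧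
    (∀ e, 1 ≤ e → e ≤ k → st.arr 5 e = D.eu e ∧ st.arr 6 e = D.ev e ∧
      st.arr 16 e = e + D.m ∧ st.arr 16 (e + D.m) = e)
  set s0 := s.setReg 25 D.m with hs0
  set c := block [load 22 0 20, load 23 1 20, add 24 20 4, store 5 24 22, store 6 24 23,
      mul 60 22 11, add 61 60 23, store 4 61 24, add 25 25 4, store 16 24 25, store 16 25 24]
    with hc
  have hfin : Inv D.m (sem (loop 20 12 c) s0) := by
    have := sem_loop_inv (i := 20) (n := 12) (c := c) (s := s0) Inv ?_ ?_
    · simpa [hs0, h.r12] using this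
    · refine ⟨by simp [hs0], fun u v _ _ => ?_, fun e e1 e2 => by omega⟩
      simp only [State.setReg_arr, hs0, h4]
      split <;> omega
    · intro k st hk hi hr ha ⟨i1, i2, i3⟩
      have hk : k < D.m := by simpa [hs0, h.r12] using hk
      have r4 : st.reg 4 = 1 := by rw [hr 4 (by decide) (by decide)]; simp [hs0, h.r4]
      have r11 : st.reg 11 = D.q := by rw [hr 11 (by decide) (by decide)]; simp [hs0, h.r11]
      have a0 : st.arr 0 k = D.eu (k + 1) := by
        rw [ha 0 (by decide)]; simp [hs0, h0 k hk]
      have a1 : st.arr 1 k = D.ev (k + 1) := by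
        rw [ha 1 (by decide)]; simp [hs0, h1 k hk]
      have hu := D.eu_lt (k + 1) (by omega) (by omega)
      have hv := D.ev_lt (k + 1) (by omega) (by omega)
      refine ⟨?_, fun u v hu' hv' => ?_, fun e e1 e2 => ?_⟩
      · simp [hc, i1, r4]; omega
      · simp only [hc, sem_block_cons, sem_block_nil, sem_load, sem_add, sem_store, sem_mul]
        simp [hi, r4, r11, a0, a1, Function.update_apply]
        have hA := D.A_zero_of_end_ne (e := k + 1) (u := u) (v := v) (by omega) (by omega)
        split_ifs with g1 g2 g2
        · obtain ⟨g3, g4⟩ := addr_inj hv' hv g1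
          exact (hA.2 ⟨g3, g4⟩).symm
        · obtain ⟨g3, g4⟩ := addr_inj hv' hv g1
          have := hA.2 ⟨g3, g4⟩
          omega
        · rw [i2 u v hu' hv']
          have : D.A u v ≠ k + 1 := fun g3 => g1 (by rw [(hA.1 g3).1, (hA.1 g3).2])
          rw [if_pos (by omega)]
        · rw [i2 u v hu' hv', if_neg (by omega)]
      · simp only [hc, sem_block_cons, sem_block_nil, sem_load, sem_add, sem_store, sem_mul]
        simp [hi, r4, a0, a1, i1, Function.update_apply]
        by_cases g : e = k + 1
        · subst g
          simp
          split_ifs <;> omega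
        · obtain ⟨j1, j2, j3, j4⟩ := i3 e e1 (by omega)
          simp [g, j1, j2, j3, j4]
          split_ifs <;> omega
  obtain ⟨i1, i2, i3⟩ := hfin
  have hL : Loaded D (sem cmdEdges s) := h.congr
    (fun r h' => sem_reg_of_notMem cmdEdges s (by revert r; decide))
    fun a h' => sem_arr_of_notMem cmdEdges s (by revert a; decide)
  have hsem : sem cmdEdges s = (sem (loop 20 12 c) s0).setReg 18 (D.m + D.m) := by
    simp only [cmdEdges, sem_block_cons, sem_block_nil, sem_move, h.r12]
    rw [← hs0, ← hc, i1]
  rw [hsem] at hL ⊢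
  refine ⟨hL, by simp; omega, ?_, ?_, ?_, ?_⟩
  · intro u v hu hv
    simp [i2 u v hu hv, D.A_le u v]
  · intro e e1 e2
    exact (i3 e e1 e2).1
  · intro e e1 e2
    exact (i3 e e1 e2).2.1
  · intro x x1 x2
    simp only [State.setReg_arr]
    by_cases hx : x ≤ D.m
    · simp [Inst.neg, hx, (i3 x x1 hx).2.2.1]
    · have := (i3 (x - D.m) (by omega) (by omega)).2.2.2
      rw [Nat.sub_add_cancel (by omega)] at this
      simp [Inst.neg, hx, this]

theorem sem_getA (r u v : ℕ) (s : State) (hv : v ≠ 60) :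
    sem (getA r u v) s = ((s.setReg 60 (s.reg u * s.reg 11)).setReg 61
      (s.reg u * s.reg 11 + s.reg v)).setReg r (s.arr 4 (s.reg u * s.reg 11 + s.reg v)) := by
  simp [getA, hv]

/-- The nonedges found so far: list `Z`, in the rows before `k` and in row `k` before column
`l`. -/
def ZerosFound (D : Inst) (Z : List (ℕ × ℕ)) (k l : ℕ) (s : State) : Prop :=
  Z.Nodup ∧ (∀ z, z ∈ Z ↔ (z.1 < k ∨ z.1 = k ∧ z.2 < l) ∧ z.1 < D.p ∧ z.2 < D.q ∧
    D.A z.1 z.2 = 0) ∧ s.reg 14 = Z.length ∧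
    ∀ i (hi : i < Z.length), s.arr 7 i = Z[i].1 ∧ s.arr 8 i = Z[i].2

theorem cmdZeros_spec {D : Inst} {s : State} (h : Indexed D s) :
    Indexed D (sem cmdZeros s) ∧ ∃ Z : List (ℕ × ℕ), Z.Nodup ∧
      (∀ z, z ∈ Z ↔ z.1 < D.p ∧ z.2 < D.q ∧ D.A z.1 z.2 = 0) ∧
      (sem cmdZeros s).reg 14 = Z.length ∧
      ∀ i (hi : i < Z.length), (sem cmdZeros s).arr 7 i = Z[i].1 ∧
        (sem cmdZeros s).arr 8 i = Z[i].2 := by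
  refine ⟨h.congr (fun r h' => sem_reg_of_notMem cmdZeros s (by revert r; decide))
    fun a h' => sem_arr_of_notMem cmdZeros s (by revert a; decide), ?_⟩
  set s0 := s.setReg 14 0 with hs0
  have h' : Indexed D s0 := h.congr (fun r h' => by
    rw [hs0, State.setReg_reg, if_neg]; revert r; decide) fun _ _ => rfl
  set c := block [getA 22 20 21,
      ite (.eq 22 5) (block [store 7 14 20, store 8 14 21, add 14 14 4]) skip] with hc
  have hrow : ∀ k st, k < D.p → Indexed D st → st.reg 20 = k →
      (∃ Z, ZerosFound D Z k 0 st) → ∃ Z, ZerosFound D Z (k + 1) 0 (sem (loop 21 11 c) st) := by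
    intro k st hk hst h20 hZ
    have := sem_loop_inv (i := 21) (n := 11) (c := c) (s := st)
      (fun l st => ∃ Z, ZerosFound D Z k l st) ?_ ?_
    · rw [hst.r11] at this
      obtain ⟨Z, z1, z2, z3, z4⟩ := this
      refine ⟨Z, z1, fun z => ?_, z3, z4⟩
      rw [z2]
      refine and_congr_left fun h3 => ?_
      omega
    · obtain ⟨Z, z1, z2, z3, z4⟩ := hZ
      exact ⟨Z, z1, z2, by simpa using z3, z4⟩
    · rintro l t hl h21 hr ha ⟨Z, z1, z2, z3, z4⟩
      rw [hst.r11] at hl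
      have ht : Indexed D t := hst.congr
        (fun r h' => hr r (by revert r; decide) (by revert r; decide))
        fun a h' => ha a (by revert a; decide)
      have t20 : t.reg 20 = k := by rw [hr 20 (by decide) (by decide), h20]
      have r4 := ht.r4
      have r5 := ht.r5
      have r11 := ht.r11
      have a4 := ht.a4 k l hk hl
      by_cases hA : D.A k l = 0
      · refine ⟨Z ++ [(k, l)], ?_, ?_, ?_, ?_⟩
        · rw [List.nodup_append]
          refine ⟨z1, List.nodup_singleton _, fun a ha b hb => ?_⟩
          rw [List.mem_singleton] at hb
          rintro rfl
          rw [z2, hb] at ha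
          simp at ha
        · intro z
          rw [List.mem_append, z2, List.mem_singleton, Prod.ext_iff]
          constructor
          · rintro (h1 | ⟨h1, h2⟩)
            · exact ⟨by omega, h1.2⟩
            · refine ⟨by omega, ?_⟩
              rw [h1, h2]
              exact ⟨hk, hl, hA⟩
          · rintro ⟨h1, h2⟩
            by_cases h3 : z.1 = k ∧ z.2 = l
            · exact Or.inr h3
            · exact Or.inl ⟨by omega, h2⟩
        · simp [hc, sem_getA, t20, h21, r11, a4, hA, r5, r4, z3]
        · intro i hi
          simp only [hc, sem_block_cons, sem_block_nil]
          simp [sem_getA, t20, h21, r11, a4, hA, r5, z3, Function.update_apply]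
          rw [List.length_append, List.length_singleton] at hi
          by_cases hi' : i = Z.length
          · subst hi'; simp
          · simp [hi', List.getElem_append_left (show i < Z.length by omega),
              z4 i (by omega)]
      · refine ⟨Z, z1, fun z => ?_, ?_, ?_⟩
        · rw [z2]
          refine and_congr_left fun h3 => ?_
          have : ¬ (z.1 = k ∧ z.2 = l) := fun h4 => hA (by rw [← h4.1, ← h4.2]; exact h3.2.2)
          omega
        · simp [hc, sem_getA, t20, h21, r11, a4, hA, r5, z3]
        · simp [hc, sem_getA, t20, h21, r11, a4, hA, r5]
          exact z4
  have := sem_loop_inv (i := 20) (n := 10) (c := loop 21 11 c) (s := s0)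
    (fun k st => ∃ Z, ZerosFound D Z k 0 st) ?_ ?_
  · rw [h'.r10] at this
    obtain ⟨Z, z1, z2, z3, z4⟩ := this
    refine ⟨Z, z1, fun z => ?_, z3, z4⟩
    rw [z2]
    exact and_iff_right_of_imp fun h3 => by omega
  · exact ⟨[], List.nodup_nil, by simp, by simp [hs0], by simp⟩
  · intro k st hk h20 hr ha hZ
    rw [h'.r10] at hk
    have ht : Indexed D st := h'.congr
        (fun r h' => hr r (by revert r; decide) (by revert r; decide))
        fun a h' => ha a (by revert a; decide)
    obtain ⟨Z, z1, z2, z3, z4⟩ := hrow k st hk ht h20 hZ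
    exact ⟨Z, z1, z2, by simpa using z3, z4⟩

/-- Arrays `9` and `10` hold a list that contains all edges or all nonedges. -/
structure ShortList (D : Graph) (n : ℕ) (lu lv : ℕ → ℕ) : Prop where
  lu_lt : ∀ k < n, lu k < D.p
  lv_lt : ∀ k < n, lv k < D.q
  full : (∀ u v, D.A u v ≠ 0 → ∃ k < n, lu k = u ∧ lv k = v) ∨
    (∀ u v, u < D.p → v < D.q → D.A u v = 0 → ∃ k < n, lu k = u ∧ lv k = v)

theorem copy_spec {x y z w n i t : ℕ} {s : State} (hxz : x ≠ z) (hxw : x ≠ w) (hyz : y ≠ z)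
    (hyw : y ≠ w) (hzw : z ≠ w) (hti : t ≠ i) :
    ∀ k < s.reg n,
      (sem (loop i n (block [load t x i, store z i t, load t y i, store w i t])) s).arr z k =
        s.arr x k ∧
      (sem (loop i n (block [load t x i, store z i t, load t y i, store w i t])) s).arr w k =
        s.arr y k := by
  set c := block [load t x i, store z i t, load t y i, store w i t] with hc
  refine sem_loop_inv (i := i) (n := n) (c := c) (s := s)
    (fun j st => ∀ k < j, st.arr z k = s.arr x k ∧ st.arr w k = s.arr y k) ?_ ?_
  · intro k hk; omega
  · intro j st hj hi hr ha ih k hk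
    have ax := ha x (by simp [hc, block, arrWrites, hxz, hxw])
    have ay := ha y (by simp [hc, block, arrWrites, hyz, hyw])
    simp [hc, hti.symm, hi, hyz, hzw, hzw.symm, Function.update_apply, ax, ay]
    by_cases e : k = j
    · simp [e]
    · simp [e, ih k (by omega)]

theorem cmdShorter_spec {D : Graph} {s : State} (h : Base D s)
    (h0 : ∀ k < D.m, s.arr 0 k = D.eu (k + 1)) (h1 : ∀ k < D.m, s.arr 1 k = D.ev (k + 1)) :
    Base D (sem cmdShorter s) ∧ (sem cmdShorter s).reg 15 = min D.m D.mh ∧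
      ShortList D (min D.m D.mh) ((sem cmdShorter s).arr 9) ((sem cmdShorter s).arr 10) := by
  refine ⟨h.sem cmdShorter (by decide) (by decide), ?_⟩
  simp only [cmdShorter, sem_ite_le, h.r12, h.r14]
  split_ifs with hm
  · set s0 := s.setReg 15 D.m with hs0
    have hcp := copy_spec (x := 0) (y := 1) (z := 9) (w := 10) (n := 15) (i := 20) (t := 22)
      (s := s0) (by decide) (by decide) (by decide) (by decide) (by decide) (by decide)
    simp only [sem_block_cons, sem_block_nil, sem_move, h.r12]
    rw [← hs0]
    rw [show min D.m D.mh = D.m by omega]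
    set c := loop 20 15 (block [load 22 0 20, store 9 20 22, load 22 1 20, store 10 20 22])
    have e15 : s0.reg 15 = D.m := by simp [hs0]
    rw [e15] at hcp
    have e9 : ∀ k < D.m, (sem c s0).arr 9 k = D.eu (k + 1) := fun k hk => by
      rw [(hcp k hk).1, ← h0 k hk]; rfl
    have e10 : ∀ k < D.m, (sem c s0).arr 10 k = D.ev (k + 1) := fun k hk => by
      rw [(hcp k hk).2, ← h1 k hk]; rfl
    refine ⟨by rw [sem_reg_of_notMem c _ (by decide), e15], ?_, ?_, Or.inl fun u v huv => ?_⟩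
    · intro k hk
      rw [e9 k hk]
      exact D.eu_lt _ (by omega) (by omega)
    · intro k hk
      rw [e10 k hk]
      exact D.ev_lt _ (by omega) (by omega)
    · have := D.A_le u v
      refine ⟨D.A u v - 1, by omega, ?_, ?_⟩
      · rw [e9 _ (by omega), Nat.sub_add_cancel (by omega), D.eu_A u v huv]
      · rw [e10 _ (by omega), Nat.sub_add_cancel (by omega), D.ev_A u v huv]
  · set s0 := s.setReg 15 D.mh with hs0
    have hcp := copy_spec (x := 7) (y := 8) (z := 9) (w := 10) (n := 15) (i := 20) (t := 22)
      (s := s0) (by decide) (by decide) (by decide) (by decide) (by decide) (by decide)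
    simp only [sem_block_cons, sem_block_nil, sem_move, h.r14]
    rw [← hs0]
    rw [show min D.m D.mh = D.mh by omega]
    set c := loop 20 15 (block [load 22 7 20, store 9 20 22, load 22 8 20, store 10 20 22])
    have e15 : s0.reg 15 = D.mh := by simp [hs0]
    rw [e15] at hcp
    have e9 : ∀ k < D.mh, (sem c s0).arr 9 k = D.zu k := fun k hk => by
      rw [(hcp k hk).1, ← h.a7 k hk]; rfl
    have e10 : ∀ k < D.mh, (sem c s0).arr 10 k = D.zv k := fun k hk => by
      rw [(hcp k hk).2, ← h.a8 k hk]; rfl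
    refine ⟨by rw [sem_reg_of_notMem c _ (by decide), e15], ?_, ?_,
      Or.inr fun u v hu hv huv => ?_⟩
    · intro k hk
      rw [e9 k hk]
      exact D.zu_lt _ hk
    · intro k hk
      rw [e10 k hk]
      exact D.zv_lt _ hk
    · obtain ⟨k, hk, k1, k2⟩ := D.zero_mem u v hu hv huv
      exact ⟨k, hk, by rw [e9 k hk, k1], by rw [e10 k hk, k2]⟩

end TwoChain

/-! ### Building the implication graph by loops that only add information. -/

namespace TwoChain

open Cmd Instr

/-- A loop whose body `c` preserves `P`, moves up along `R`, and achieves `Q k` in round `k`. -/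
theorem sem_loop_mono {i n N : ℕ} {c : Cmd} (P : State → Prop) (R : State → State → Prop)
    (Q : ℕ → State → Prop) (hP : ∀ s v, P s → P (s.setReg i v)) (hR : ∀ s v, R s (s.setReg i v))
    (hT : ∀ {s s' s''}, R s s' → R s' s'' → R s s'')
    (hQ : ∀ {k s s'}, R s s' → Q k s → Q k s')
    (hbody : ∀ s, P s → s.reg i < N → P (sem c s) ∧ R s (sem c s) ∧ Q (s.reg i) (sem c s))
    {s : State} (hs : P s) (hn : s.reg n = N) :
    P (sem (loop i n c) s) ∧ R s (sem (loop i n c) s) ∧ ∀ k < N, Q k (sem (loop i n c) s) := by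
  have := sem_loop_inv (i := i) (n := n) (c := c) (s := s)
    (fun k st => P st ∧ R s st ∧ ∀ j < k, Q j st) ⟨hP s 0 hs, hR s 0, fun j hj => by omega⟩ ?_
  · rwa [hn] at this
  · rintro k st hk hi - - ⟨h1, h2, h3⟩
    obtain ⟨g1, g2, g3⟩ := hbody st h1 (by omega)
    rw [hi] at g3
    refine ⟨hP _ _ g1, hT h2 (hT g2 (hR _ _)), fun j hj => hQ (hR _ _) ?_⟩
    by_cases e : j = k
    · rwa [e]
    · exact hQ g2 (h3 j (by omega))

/-! ### The implication graph -/

/-- Adjacency. -/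
def Inst.E (D : Inst) (u v : ℕ) : Prop := D.A u v ≠ 0

/-- The implications between the literals `e` ("the edge `e` is not in `S`") and `neg e`. -/
inductive Impl (D : Inst) : ℕ → ℕ → Prop
  | conf {u v x y : ℕ} : Conf D.E u v x y → Impl D (D.neg (D.A u v)) (D.A x y)
  | conf_neg {u v x y : ℕ} : Conf D.E u v x y → Impl D (D.A u v) (D.neg (D.A x y))
  | avoid {k : ℕ} : k < D.f → Impl D (D.neg (D.A (D.fu k) (D.fv k))) (D.A (D.fu k) (D.fv k))
  | cross {k a v : ℕ} : k < D.f → ¬ D.E a v → D.E (D.fu k) v → D.E a (D.fv k) →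
      Impl D (D.neg (D.A (D.fu k) v)) (D.A a (D.fv k))
  | cross' {k a v : ℕ} : k < D.f → ¬ D.E a v → D.E (D.fu k) v → D.E a (D.fv k) →
      Impl D (D.neg (D.A a (D.fv k))) (D.A (D.fu k) v)

namespace Inst

variable {D : Inst}

theorem A_mem {u v : ℕ} (h : D.E u v) : 1 ≤ D.A u v ∧ D.A u v ≤ D.m :=
  ⟨Nat.pos_of_ne_zero h, D.A_le u v⟩

theorem neg_mem {x : ℕ} (h : 1 ≤ x ∧ x ≤ 2 * D.m) : 1 ≤ D.neg x ∧ D.neg x ≤ 2 * D.m := by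
  unfold neg
  split <;> omega

theorem neg_neg {x : ℕ} (h : 1 ≤ x ∧ x ≤ 2 * D.m) : D.neg (D.neg x) = x := by
  unfold neg
  split_ifs <;> omega

theorem A_lit {u v : ℕ} (h : D.E u v) : 1 ≤ D.A u v ∧ D.A u v ≤ 2 * D.m := by
  have := A_mem h
  omega

end Inst

theorem Impl.mem {D : Inst} {x y : ℕ} (h : Impl D x y) :
    (1 ≤ x ∧ x ≤ 2 * D.m) ∧ (1 ≤ y ∧ y ≤ 2 * D.m) := by
  cases h with
  | conf h => exact ⟨Inst.neg_mem (Inst.A_lit h.1), Inst.A_lit h.2.1⟩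
  | conf_neg h => exact ⟨Inst.A_lit h.1, Inst.neg_mem (Inst.A_lit h.2.1)⟩
  | avoid h => exact ⟨Inst.neg_mem (Inst.A_lit (D.A_res _ h)), Inst.A_lit (D.A_res _ h)⟩
  | cross h1 h2 h3 h4 => exact ⟨Inst.neg_mem (Inst.A_lit h3), Inst.A_lit h4⟩
  | cross' h1 h2 h3 h4 => exact ⟨Inst.neg_mem (Inst.A_lit h4), Inst.A_lit h3⟩

/-- Conflicts are symmetric, `avoid` is its own contrapositive, and `cross'` exists because it is
the contrapositive of `cross`. -/
theorem Impl.contrapose {D : Inst} {x y : ℕ} (h : Impl D x y) : Impl D (D.neg y) (D.neg x) := by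
  cases h with
  | conf h => rw [Inst.neg_neg (Inst.A_lit h.1)]; exact .conf h.symm
  | conf_neg h => rw [Inst.neg_neg (Inst.A_lit h.2.1)]; exact .conf_neg h.symm
  | avoid h => rw [Inst.neg_neg (Inst.A_lit (D.A_res _ h))]; exact .avoid h
  | cross h1 h2 h3 h4 => rw [Inst.neg_neg (Inst.A_lit h3)]; exact .cross' h1 h2 h3 h4
  | cross' h1 h2 h3 h4 => rw [Inst.neg_neg (Inst.A_lit h4)]; exact .cross h1 h2 h3 h4

/-! ### Storing arcs -/

/-- Add an arc. -/
def LinkedGraph.addArc (G : LinkedGraph) (x y : ℕ) (hx : 1 ≤ x ∧ x ≤ G.N)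
    (hy : 1 ≤ y ∧ y ≤ G.N) : LinkedGraph where
  N := G.N
  K := G.K + 1
  src := Function.update G.src (G.K + 1) x
  dst := Function.update G.dst (G.K + 1) y
  nxt := Function.update G.nxt (G.K + 1) (G.head x)
  head := Function.update G.head x (G.K + 1)
  src_mem k h1 h2 := by
    rw [Function.update_apply]
    split
    · exact hx
    · exact G.src_mem k h1 (by omega)
  dst_mem k h1 h2 := by
    rw [Function.update_apply]
    split
    · exact hy
    · exact G.dst_mem k h1 (by omega)
  nxt_lt k h1 h2 := by
    rw [Function.update_apply]
    split
    · have := G.head_le x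
      omega
    · exact G.nxt_lt k h1 (by omega)
  src_nxt k h1 h2 := by
    by_cases hk : k = G.K + 1
    · subst hk
      have := G.head_le x
      simp only [Function.update_self]
      rw [Function.update_of_ne (by omega)]
      exact G.src_head x
    · have := G.nxt_lt k h1 (by omega)
      rw [Function.update_of_ne hk, Function.update_of_ne hk, Function.update_of_ne (by omega)]
      exact G.src_nxt k h1 (by omega)
  nxt_max k h1 h2 j h3 h4 := by
    rw [Function.update_of_ne (show j ≠ G.K + 1 by omega)]
    by_cases hk : k = G.K + 1
    · subst hk
      simp only [Function.update_self] at h3 ⊢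
      exact G.head_max x j h3 (by omega)
    · rw [Function.update_of_ne hk] at h3 ⊢
      exact G.nxt_max k h1 (by omega) j h3 h4
  head_le z := by
    rw [Function.update_apply]
    split
    · exact le_rfl
    · exact (G.head_le z).trans (Nat.le_succ _)
  src_head z := by
    by_cases hz : z = x
    · subst hz
      simp
    · have := G.head_le z
      rw [Function.update_of_ne hz, Function.update_of_ne (by omega)]
      exact G.src_head z
  head_max z j h1 h2 := by
    by_cases hz : z = x
    · subst hz
      simp only [Function.update_self] at h1
      omega
    · rw [Function.update_of_ne hz] at h1
      by_cases hj : j = G.K + 1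
      · subst hj
        simp only [Function.update_self]
        exact Ne.symm hz
      · rw [Function.update_of_ne hj]
        exact G.head_max z j h1 (by omega)

/-- The arc from `x` to `y` is stored. -/
def ArcIn (s : State) (x y : ℕ) : Prop :=
  ∃ k, 1 ≤ k ∧ k ≤ s.reg 16 ∧ s.arr 11 k = x ∧ s.arr 14 k = y

/-- The graph `G` is stored. -/
structure Stored (N : ℕ) (G : LinkedGraph) (s : State) : Prop where
  N_eq : G.N = N
  K_eq : s.reg 16 = G.K
  src_eq : s.arr 11 = G.src
  head_eq : s.arr 12 = G.head
  nxt_eq : s.arr 13 = G.nxt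
  dst_eq : s.arr 14 = G.dst

theorem Stored.arc_iff {N : ℕ} {G : LinkedGraph} {s : State} (h : Stored N G s) {x y : ℕ} :
    G.arc x y ↔ ArcIn s x y := by
  unfold LinkedGraph.arc ArcIn
  rw [h.K_eq, h.src_eq, h.dst_eq]

/-- A graph of valid implications is stored. -/
def ArcState (D : Inst) (s : State) : Prop :=
  (∃ G, Stored (2 * D.m) G s) ∧ ∀ x y, ArcIn s x y → Impl D x y

/-- Cell `e` of array `15` is empty or holds a partner of `e`. -/
def ParState (D : Inst) (s : State) : Prop :=
  ∀ e, s.arr 15 e ≠ 0 → ∃ u v x y, Conf D.E u v x y ∧ e = D.A u v ∧ s.arr 15 e = D.A x y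

/-- More arcs and partners are stored. -/
def Grows (s s' : State) : Prop :=
  (∀ x y, ArcIn s x y → ArcIn s' x y) ∧ ∀ e, s.arr 15 e ≠ 0 → s'.arr 15 e ≠ 0

theorem Grows.trans {s s' s'' : State} (h : Grows s s') (h' : Grows s' s'') : Grows s s'' :=
  ⟨fun x y hx => h'.1 x y (h.1 x y hx), fun e he => h'.2 e (h.2 e he)⟩

theorem Grows.of_eq {s s' : State} (h1 : s'.reg 16 = s.reg 16) (h2 : s'.arr 11 = s.arr 11)
    (h3 : s'.arr 14 = s.arr 14) (h4 : s'.arr 15 = s.arr 15) : Grows s s' := by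
  refine ⟨fun x y hx => ?_, fun e he => by rwa [h4]⟩
  unfold ArcIn at *
  rwa [h1, h2, h3]

theorem ArcState.congr {D : Inst} {s s' : State} (h : ArcState D s)
    (hr : s'.reg 16 = s.reg 16) (ha : ∀ a ∈ [11, 12, 13, 14], s'.arr a = s.arr a) :
    ArcState D s' := by
  obtain ⟨⟨G, h1, h2, h3, h4, h5, h6⟩, h7⟩ := h
  refine ⟨⟨G, h1, ?_, ?_, ?_, ?_, ?_⟩, fun x y hx => h7 x y ?_⟩
  · rw [hr, h2]
  · rw [ha _ (by decide), h3]
  · rw [ha _ (by decide), h4]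
  · rw [ha _ (by decide), h5]
  · rw [ha _ (by decide), h6]
  · unfold ArcIn at *
    rwa [hr, ha 11 (by decide), ha 14 (by decide)] at hx

theorem addArc_spec {D : Inst} {s : State} {x y : ℕ} (h : ArcState D s) (h4 : s.reg 4 = 1)
    (hx : x ≠ 16 ∧ x ≠ 39) (hy : y ≠ 16) (hi : Impl D (s.reg x) (s.reg y)) :
    ArcState D (sem (addArc x y) s) ∧ Grows s (sem (addArc x y) s) ∧
      ArcIn (sem (addArc x y) s) (s.reg x) (s.reg y) := by
  obtain ⟨⟨G, h1, h2, h3, h5, h6, h7⟩, h8⟩ := h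
  obtain ⟨hx1, hy1⟩ := hi.mem
  rw [← h1] at hx1 hy1
  have hS : Stored (2 * D.m) (G.addArc (s.reg x) (s.reg y) hx1 hy1) (sem (addArc x y) s) := by
    constructor
    · exact h1
    · simp [addArc, h4, h2, LinkedGraph.addArc]
    · simp [addArc, h4, h2, h3, LinkedGraph.addArc, hx]
    · simp [addArc, h4, h2, h5, LinkedGraph.addArc, hx]
    · simp [addArc, h4, h2, h6, h5, LinkedGraph.addArc, hx]
    · simp [addArc, h4, h2, h7, LinkedGraph.addArc, hy]
  have harc : ∀ a b, ArcIn (sem (addArc x y) s) a b ↔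
      ArcIn s a b ∨ (a = s.reg x ∧ b = s.reg y) := by
    intro a b
    unfold ArcIn
    rw [hS.K_eq, hS.src_eq, hS.dst_eq, h2, h3, h7]
    simp only [LinkedGraph.addArc]
    constructor
    · rintro ⟨k, k1, k2, k3, k4⟩
      by_cases e : k = G.K + 1
      · subst e
        simp only [Function.update_self] at k3 k4
        exact Or.inr ⟨k3.symm, k4.symm⟩
      · rw [Function.update_of_ne e] at k3 k4
        exact Or.inl ⟨k, k1, by omega, k3, k4⟩
    · rintro (⟨k, k1, k2, k3, k4⟩ | ⟨rfl, rfl⟩)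
      · refine ⟨k, k1, by omega, ?_, ?_⟩
        · rwa [Function.update_of_ne (by omega)]
        · rwa [Function.update_of_ne (by omega)]
      · exact ⟨G.K + 1, by omega, le_rfl, by simp, by simp⟩
  refine ⟨⟨⟨_, hS⟩, fun a b hab => ?_⟩, ⟨fun a b hab => (harc a b).2 (Or.inl hab), ?_⟩,
    (harc _ _).2 (Or.inr ⟨rfl, rfl⟩)⟩
  · rcases (harc a b).1 hab with h9 | ⟨rfl, rfl⟩
    · exact h8 a b h9
    · exact hi
  · rw [sem_arr_of_notMem _ _ (by simp [addArc, block, arrWrites])]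
    exact fun e he => he

/-! ### Finding all conflicts from pairs of the shorter list. -/

/-- The pairs `i`, `j` of the short list that give the induced `2K₂` formed by `uv` and `xy`. -/
def Emits (D : Inst) (lu lv : ℕ → ℕ) (i j u v x y : ℕ) : Prop :=
  (lu i = u ∧ lv i = v ∧ lu j = x ∧ lv j = y ∧ D.E u v) ∨
    (lu i = u ∧ lv i = y ∧ lu j = x ∧ lv j = v ∧ ¬ D.E u y)

/-- The conflict of `uv` and `xy` has been recorded. -/
def Recorded (D : Inst) (u v x y : ℕ) (s : State) : Prop :=
  ArcIn s (D.neg (D.A u v)) (D.A x y) ∧ ArcIn s (D.A u v) (D.neg (D.A x y)) ∧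
    s.arr 15 (D.A u v) ≠ 0

theorem Recorded.mono {D : Inst} {u v x y : ℕ} {s s' : State} (h : Grows s s')
    (hr : Recorded D u v x y s) : Recorded D u v x y s' :=
  ⟨h.1 _ _ hr.1, h.1 _ _ hr.2.1, h.2 _ hr.2.2⟩

/-- The same code serves both lists: two pairs are read as the edges uv and xy if the first one is
an edge, and as the cross pairs uy and xv if it is not. -/
theorem pairLoad_spec {D : Graph} {n : ℕ} {lu lv : ℕ → ℕ} (hL : ShortList D n lu lv) {s : State}
    (h : Base D s) (h9 : s.arr 9 = lu) (h10 : s.arr 10 = lv) (hi : s.reg 20 < n)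
    (hj : s.reg 21 < n) :
    ∃ u v x y, u < D.p ∧ v < D.q ∧ x < D.p ∧ y < D.q ∧
      (sem pairLoad s).reg 30 = D.A u v ∧ (sem pairLoad s).reg 31 = D.A x y ∧
      (sem pairLoad s).reg 32 = D.A u y ∧ (sem pairLoad s).reg 33 = D.A x v ∧
      ∀ u' v' x' y', Conf D.E u' v' x' y' → Emits D.toInst lu lv (s.reg 20) (s.reg 21) u' v' x' y' →
        u' = u ∧ v' = v ∧ x' = x ∧ y' = y := by
  have e1 := h.a4 _ _ (hL.lu_lt _ hi) (hL.lv_lt _ hi)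
  have e2 := h.a4 _ _ (hL.lu_lt _ hj) (hL.lv_lt _ hj)
  have e3 := h.a4 _ _ (hL.lu_lt _ hi) (hL.lv_lt _ hj)
  have e4 := h.a4 _ _ (hL.lu_lt _ hj) (hL.lv_lt _ hi)
  by_cases hA : D.A (lu (s.reg 20)) (lv (s.reg 20)) = 0
  · refine ⟨lu (s.reg 20), lv (s.reg 21), lu (s.reg 21), lv (s.reg 20), hL.lu_lt _ hi,
      hL.lv_lt _ hj, hL.lu_lt _ hj, hL.lv_lt _ hi, ?_, ?_, ?_, ?_, ?_⟩
    any_goals simp [pairLoad, sem_getA, h.r11, h9, h10, h.r5, e1, e2, e3, e4, hA]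
    rintro u v x y hc (⟨rfl, rfl, rfl, rfl, g⟩ | ⟨rfl, rfl, rfl, rfl, g⟩)
    · exact absurd hA g
    · exact ⟨rfl, rfl, rfl, rfl⟩
  · refine ⟨lu (s.reg 20), lv (s.reg 20), lu (s.reg 21), lv (s.reg 21), hL.lu_lt _ hi,
      hL.lv_lt _ hi, hL.lu_lt _ hj, hL.lv_lt _ hj, ?_, ?_, ?_, ?_, ?_⟩
    any_goals simp [pairLoad, sem_getA, h.r11, h9, h10, h.r5, e1, e2, e3, e4, hA]
    rintro u v x y hc (⟨rfl, rfl, rfl, rfl, g⟩ | ⟨rfl, rfl, rfl, rfl, g⟩)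
    · exact ⟨rfl, rfl, rfl, rfl⟩
    · exact absurd hA g

theorem pairEmit_spec {D : Graph} {s : State} (h : Base D s) (ha : ArcState D.toInst s)
    (hp : ParState D.toInst s) {u v x y : ℕ} (h30 : s.reg 30 = D.A u v) (h31 : s.reg 31 = D.A x y)
    (h32 : s.reg 32 = D.A u y) (h33 : s.reg 33 = D.A x v) :
    (ArcState D.toInst (sem pairEmit s) ∧ ParState D.toInst (sem pairEmit s)) ∧
      Grows s (sem pairEmit s) ∧ (Conf D.E u v x y → Recorded D.toInst u v x y (sem pairEmit s)) := by
  have hr : Grows s s := ⟨fun _ _ h => h, fun _ h => h⟩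
  simp only [pairEmit, sem_ite_ne, sem_ite_eq, h30, h31, h32, h33, h.r5, sem_skip]
  split_ifs with c1 c2 c3 c4
  · exact ⟨⟨ha, hp⟩, hr, fun hc => absurd c1 hc.1⟩
  · exact ⟨⟨ha, hp⟩, hr, fun hc => absurd c2 hc.2.1⟩
  · have hc : Conf D.E u v x y := ⟨c1, c2, not_not.2 c3, not_not.2 c4⟩
    obtain ⟨t, ht⟩ : ∃ t, t = sem (block [store 15 30 31, load 34 16 30, load 35 16 31]) s :=
      ⟨_, rfl⟩
    have hsem : sem (block [store 15 30 31, load 34 16 30, load 35 16 31, addArc 34 31,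
        addArc 30 35]) s = sem (addArc 30 35) (sem (addArc 34 31) t) := by
      rw [ht]; rfl
    rw [hsem]
    have m1 := Inst.A_lit hc.1
    have m2 := Inst.A_lit hc.2.1
    have t30 : t.reg 30 = D.A u v := by rw [ht]; simp [h30]
    have t31 : t.reg 31 = D.A x y := by rw [ht]; simp [h31]
    have t34 : t.reg 34 = D.neg (D.A u v) := by
      rw [ht, ← h.a16 _ m1.1 m1.2]; simp [h30]
    have t35 : t.reg 35 = D.neg (D.A x y) := by
      rw [ht, ← h.a16 _ m2.1 m2.2]; simp [h31]
    have t4 : t.reg 4 = 1 := by rw [ht]; simp [h.r4]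
    have t15 : ∀ e, t.arr 15 e = if e = D.A u v then D.A x y else s.arr 15 e := by
      intro e
      rw [ht]
      simp [h30, h31, Function.update_apply]
    have hat : ArcState D.toInst t := ha.congr (by rw [ht]; simp) fun a h' => by
      rw [ht]
      exact sem_arr_of_notMem _ _ (by revert a; decide)
    have hgt : Grows s t := by
      refine ⟨fun a b hab => ?_, fun e he => ?_⟩
      · unfold ArcIn at *
        rw [ht]
        simpa using hab
      · rw [t15]
        split
        · exact c2
        · exact he
    obtain ⟨b1, b2, b3⟩ := addArc_spec (x := 34) (y := 31) hat t4 (by decide) (by decide)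
      (by rw [t34, t31]; exact .conf hc)
    set t' := sem (addArc 34 31) t with ht'
    have k30 : t'.reg 30 = D.A u v := by
      rw [ht', sem_reg_of_notMem _ _ (by decide), t30]
    have k35 : t'.reg 35 = D.neg (D.A x y) := by
      rw [ht', sem_reg_of_notMem _ _ (by decide), t35]
    obtain ⟨d1, d2, d3⟩ := addArc_spec (x := 30) (y := 35) b1
      (by rw [ht', sem_reg_of_notMem _ _ (by decide), t4]) (by decide) (by decide)
      (by rw [k30, k35]; exact .conf_neg hc)
    set t'' := sem (addArc 30 35) t' with ht''
    have e15 : t''.arr 15 = t.arr 15 := by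
      rw [ht'', sem_arr_of_notMem _ _ (by decide), ht', sem_arr_of_notMem _ _ (by decide)]
    rw [t34, t31] at b3
    rw [k30, k35] at d3
    refine ⟨⟨d1, fun e he => ?_⟩, (hgt.trans b2).trans d2, fun _ => ⟨d2.1 _ _ b3, d3, ?_⟩⟩
    · rw [e15, t15] at he ⊢
      split_ifs at he ⊢ with g
      · exact ⟨u, v, x, y, hc, g, rfl⟩
      · exact hp e he
    · rw [e15, t15, if_pos rfl]
      exact c2
  · exact ⟨⟨ha, hp⟩, hr, fun hc => absurd c4 hc.2.2.2⟩
  · exact ⟨⟨ha, hp⟩, hr, fun hc => absurd c3 hc.2.2.1⟩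

/-- The part of the state that the construction of the arcs keeps or extends. -/
structure Building (D : Graph) (s : State) : Prop where
  base : Base D s
  arcs : ArcState D.toInst s
  par : ParState D.toInst s

theorem Building.setReg {D : Graph} {s : State} (h : Building D s) {r v : ℕ}
    (hr : r ∉ [4, 5, 10, 11, 12, 13, 14, 16, 18]) : Building D (s.setReg r v) where
  base := h.base.setReg (by simp at hr ⊢; omega)
  arcs := h.arcs.congr (by simp at hr ⊢; omega) fun _ _ => rfl
  par := h.par

theorem Building.sem {D : Graph} {s : State} (h : Building D s) (c : Cmd)
    (hr : ∀ r ∈ [4, 5, 10, 11, 12, 13, 14, 16, 18], r ∉ c.regWrites)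
    (ha : c.arrWrites = []) : Building D (sem c s) where
  base := h.base.sem c (fun r h' => hr r (by revert h'; simp; omega)) (by simp [ha])
  arcs := h.arcs.congr (sem_reg_of_notMem _ _ (hr _ (by decide)))
    fun a _ => sem_arr_of_notMem _ _ (by simp [ha])
  par := by
    unfold ParState
    rw [sem_arr_of_notMem _ _ (by simp [ha])]
    exact h.par

theorem Grows.setReg {s : State} {r v : ℕ} (hr : r ≠ 16) : Grows s (s.setReg r v) :=
  .of_eq (by simp [hr.symm]) rfl rfl rfl

theorem Grows.sem (s : State) (c : Cmd) (hr : 16 ∉ c.regWrites) (ha : c.arrWrites = []) :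
    Grows s (sem c s) :=
  .of_eq (sem_reg_of_notMem _ _ hr) (sem_arr_of_notMem _ _ (by simp [ha]))
    (sem_arr_of_notMem _ _ (by simp [ha])) (sem_arr_of_notMem _ _ (by simp [ha]))

/-- A conflict has its two edges in the list of edges and its two cross pairs in the list of
nonedges, so it is met whichever of the two lists is complete. -/
theorem cmdPairs_spec {D : Graph} {n : ℕ} {s : State} (h : Building D s)
    (hL : ShortList D n (s.arr 9) (s.arr 10)) (h15 : s.reg 15 = n) :
    Building D (sem cmdPairs s) ∧
      ∀ u v x y, Conf D.E u v x y → Recorded D.toInst u v x y (sem cmdPairs s) := by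
  obtain ⟨lu, hlu⟩ : ∃ lu, lu = s.arr 9 := ⟨_, rfl⟩
  obtain ⟨lv, hlv⟩ : ∃ lv, lv = s.arr 10 := ⟨_, rfl⟩
  rw [← hlu, ← hlv] at hL
  let P : State → Prop := fun st => Building D st ∧ st.arr 9 = lu ∧ st.arr 10 = lv ∧
    st.reg 15 = n
  let Q : ℕ → ℕ → State → Prop := fun i j st => ∀ u v x y, Conf D.E u v x y →
    Emits D.toInst lu lv i j u v x y → Recorded D.toInst u v x y st
  have hQ : ∀ {i j s s'}, Grows s s' → Q i j s → Q i j s' :=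
    fun hg hq u v x y h1 h2 => (hq u v x y h1 h2).mono hg
  have hfin := sem_loop_mono (i := 20) (n := 15) (N := n) (c := loop 21 15 (seq pairLoad pairEmit))
    P Grows (fun i st => ∀ j < n, Q i j st)
    (fun st v hs => ⟨hs.1.setReg (by decide), hs.2⟩) (fun st v => .setReg (by decide))
    Grows.trans (fun hg hq j hj => hQ hg (hq j hj)) ?_ (s := s) ⟨h, hlu.symm, hlv.symm, h15⟩ h15
  · obtain ⟨⟨g1, -⟩, -, g2⟩ := hfin
    refine ⟨g1, fun u v x y hc => ?_⟩
    have m := fun u v (h : D.E u v) =>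
      (⟨by rw [← D.eu_A u v h]; exact D.eu_lt _ (Inst.A_mem h).1 (Inst.A_mem h).2,
        by rw [← D.ev_A u v h]; exact D.ev_lt _ (Inst.A_mem h).1 (Inst.A_mem h).2⟩ :
        u < D.p ∧ v < D.q)
    have m1 := m u v hc.1
    have m2 := m x y hc.2.1
    rcases hL.full with hf | hf
    · obtain ⟨i, i1, i2, i3⟩ := hf u v hc.1
      obtain ⟨j, j1, j2, j3⟩ := hf x y hc.2.1
      exact g2 i i1 j j1 u v x y hc (Or.inl ⟨i2, i3, j2, j3, hc.1⟩)
    · obtain ⟨i, i1, i2, i3⟩ := hf u y m1.1 m2.2 (not_not.1 hc.2.2.1)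
      obtain ⟨j, j1, j2, j3⟩ := hf x v m2.1 m1.2 (not_not.1 hc.2.2.2)
      exact g2 i i1 j j1 u v x y hc (Or.inr ⟨i2, i3, j2, j3, hc.2.2.1⟩)
  · intro st hst hlt
    obtain ⟨k, hk⟩ : ∃ k, k = st.reg 20 := ⟨_, rfl⟩
    have hin := sem_loop_mono (i := 21) (n := 15) (N := n) (c := seq pairLoad pairEmit)
      (fun st => P st ∧ st.reg 20 = k) Grows (Q k)
      (fun st v hs => ⟨⟨hs.1.1.setReg (by decide), hs.1.2⟩, by simp [hs.2]⟩)
      (fun st v => .setReg (by decide)) Grows.trans hQ ?_ (s := st) ⟨hst, hk.symm⟩ hst.2.2.2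
    · rw [← hk]
      exact ⟨hin.1.1, hin.2⟩
    · rintro t ⟨⟨h1, h2, h3, h4⟩, h5⟩ hj
      obtain ⟨u, v, x, y, -, -, -, -, e1, e2, e3, e4, e5⟩ := pairLoad_spec hL h1.base h2 h3
        (by rw [h5, hk]; exact hlt) hj
      have hb := h1.sem pairLoad (by decide) (by decide)
      obtain ⟨⟨f1, f2⟩, f3, f4⟩ := pairEmit_spec hb.base hb.arcs hb.par e1 e2 e3 e4
      refine ⟨⟨⟨⟨hb.base.sem _ (by decide) (by decide), f1, f2⟩, ?_, ?_, ?_⟩, ?_⟩,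
        (Grows.sem _ _ (by decide) (by decide)).trans f3, ?_⟩
      · exact (sem_arr_of_notMem _ _ (by decide)).trans h2
      · exact (sem_arr_of_notMem _ _ (by decide)).trans h3
      · exact (sem_reg_of_notMem _ _ (by decide)).trans h4
      · exact (sem_reg_of_notMem _ _ (by decide)).trans h5
      · intro u' v' x' y' hc he
        rw [← h5] at he
        obtain ⟨rfl, rfl, rfl, rfl⟩ := e5 u' v' x' y' hc he
        exact f4 hc

theorem Building.addArc {D : Graph} {s : State} {x y : ℕ} (h : Building D s)
    (hx : x ≠ 16 ∧ x ≠ 39) (hy : y ≠ 16) (hi : Impl D.toInst (s.reg x) (s.reg y)) :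
    Building D (Cmd.sem (TwoChain.addArc x y) s) ∧
      Grows s (Cmd.sem (TwoChain.addArc x y) s) ∧
      ArcIn (Cmd.sem (TwoChain.addArc x y) s) (s.reg x) (s.reg y) := by
  obtain ⟨h1, h2, h3⟩ := addArc_spec h.arcs h.base.r4 hx hy hi
  refine ⟨⟨h.base.sem _ ?_ ?_, h1, ?_⟩, h2, h3⟩
  · simp [TwoChain.addArc, block, regWrites]
  · simp [TwoChain.addArc, block, arrWrites]
  · unfold ParState
    rw [sem_arr_of_notMem _ _ (by simp [TwoChain.addArc, block, arrWrites])]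
    exact h.par

/-! ### Implications that come from restricted edges. -/

/-- The arcs that come from the restricted edge number `k` and the nonedge number `l`. -/
def CrossStored (D : Graph) (k l : ℕ) (s : State) : Prop :=
  D.E (D.fu k) (D.zv l) → D.E (D.zu l) (D.fv k) →
    ArcIn s (D.neg (D.A (D.fu k) (D.zv l))) (D.A (D.zu l) (D.fv k)) ∧
    ArcIn s (D.neg (D.A (D.zu l) (D.fv k))) (D.A (D.fu k) (D.zv l))

/-- The arc that comes from the restricted edge number `k`. -/
def AvoidStored (D : Graph) (k : ℕ) (s : State) : Prop :=
  ArcIn s (D.neg (D.A (D.fu k) (D.fv k))) (D.A (D.fu k) (D.fv k))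

theorem Inst.lt_of_E (D : Inst) {u v : ℕ} (h : D.E u v) : u < D.p ∧ v < D.q := by
  have h1 := D.eu_lt _ (Inst.A_mem h).1 (Inst.A_mem h).2
  have h2 := D.ev_lt _ (Inst.A_mem h).1 (Inst.A_mem h).2
  rw [D.eu_A u v h] at h1
  rw [D.ev_A u v h] at h2
  exact ⟨h1, h2⟩

theorem restrictedHead_spec {D : Graph} {s : State} (h : Building D s) (hk : s.reg 20 < D.f) :
    Building D (sem restrictedHead s) ∧ Grows s (sem restrictedHead s) ∧
      AvoidStored D (s.reg 20) (sem restrictedHead s) ∧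
      (sem restrictedHead s).reg 22 = D.fu (s.reg 20) ∧
      (sem restrictedHead s).reg 23 = D.fv (s.reg 20) := by
  have hE := D.A_res _ hk
  have hlt := D.lt_of_E hE
  obtain ⟨t, ht⟩ : ∃ t, t = sem (block [load 22 2 20, load 23 3 20, getA 26 22 23,
    load 34 16 26]) s := ⟨_, rfl⟩
  have hsem : sem restrictedHead s = sem (addArc 34 26) t := by rw [ht]; rfl
  have a2 := h.base.a2 _ hk
  have a3 := h.base.a3 _ hk
  have a4 := h.base.a4 _ _ hlt.1 hlt.2
  have hm := Inst.A_lit hE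
  have a16 := h.base.a16 _ hm.1 hm.2
  have t22 : t.reg 22 = D.fu (s.reg 20) := by rw [ht]; simp [sem_getA, a2]
  have t23 : t.reg 23 = D.fv (s.reg 20) := by rw [ht]; simp [sem_getA, a3]
  have t26 : t.reg 26 = D.A (D.fu (s.reg 20)) (D.fv (s.reg 20)) := by
    rw [ht]; simp [sem_getA, a2, a3, a4, h.base.r11]
  have t34 : t.reg 34 = D.neg (D.A (D.fu (s.reg 20)) (D.fv (s.reg 20))) := by
    rw [ht]; simp [sem_getA, a2, a3, a4, h.base.r11, a16]
  have hb : Building D t := by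
    rw [ht]
    exact h.sem _ (by decide) (by decide)
  have hg : Grows s t := by
    rw [ht]
    exact Grows.sem _ _ (by decide) (by decide)
  obtain ⟨g1, g2, g3⟩ := hb.addArc (x := 34) (y := 26) (by decide) (by decide)
    (by rw [t34, t26]; exact .avoid hk)
  rw [hsem]
  refine ⟨g1, hg.trans g2, ?_, ?_, ?_⟩
  · unfold AvoidStored
    rwa [t34, t26] at g3
  · rw [sem_reg_of_notMem _ _ (by decide), t22]
  · rw [sem_reg_of_notMem _ _ (by decide), t23]

theorem restrictedBody_spec {D : Graph} {s : State} (h : Building D s) {k : ℕ} (hk : k < D.f)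
    (hl : s.reg 21 < D.mh) (h22 : s.reg 22 = D.fu k) (h23 : s.reg 23 = D.fv k) :
    Building D (sem restrictedBody s) ∧ Grows s (sem restrictedBody s) ∧
      CrossStored D k (s.reg 21) (sem restrictedBody s) := by
  have hlt := D.lt_of_E (D.A_res _ hk)
  obtain ⟨l, hl'⟩ : ∃ l, l = s.reg 21 := ⟨_, rfl⟩
  rw [← hl'] at hl ⊢
  have a7 := h.base.a7 _ hl
  have a8 := h.base.a8 _ hl
  have e1 := h.base.a4 _ _ hlt.1 (D.zv_lt _ hl)
  have e2 := h.base.a4 _ _ (D.zu_lt _ hl) hlt.2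
  obtain ⟨t, ht⟩ : ∃ t, t = sem (block [load 24 7 21, load 25 8 21, getA 28 22 25,
    getA 29 24 23]) s := ⟨_, rfl⟩
  have t28 : t.reg 28 = D.A (D.fu k) (D.zv l) := by
    rw [ht]; simp [sem_getA, a8, h22, ← hl', h.base.r11, e1]
  have t29 : t.reg 29 = D.A (D.zu l) (D.fv k) := by
    rw [ht]; simp [sem_getA, a7, h23, ← hl', h.base.r11, e2]
  have hb : Building D t := by
    rw [ht]
    exact h.sem _ (by decide) (by decide)
  have hg : Grows s t := by
    rw [ht]
    exact Grows.sem _ _ (by decide) (by decide)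
  simp only [restrictedBody, sem_seq]
  rw [← ht]
  simp only [sem_ite_ne, hb.base.r5, t28, t29, sem_skip]
  split_ifs with c1 c2
  · exact ⟨hb, hg, fun h' => absurd c1 h'⟩
  · exact ⟨hb, hg, fun _ h' => absurd c2 h'⟩
  · have m1 := Inst.A_lit (D := D.toInst) c1
    have m2 := Inst.A_lit (D := D.toInst) c2
    have a1 := hb.base.a16 _ m1.1 m1.2
    have a2 := hb.base.a16 _ m2.1 m2.2
    obtain ⟨t', ht'⟩ : ∃ t', t' = sem (block [load 34 16 28, load 35 16 29]) t := ⟨_, rfl⟩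
    have k28 : t'.reg 28 = D.A (D.fu k) (D.zv l) := by rw [ht']; simp [t28]
    have k29 : t'.reg 29 = D.A (D.zu l) (D.fv k) := by rw [ht']; simp [t29]
    have k34 : t'.reg 34 = D.neg (D.A (D.fu k) (D.zv l)) := by rw [ht']; simp [t28, a1]
    have k35 : t'.reg 35 = D.neg (D.A (D.zu l) (D.fv k)) := by rw [ht']; simp [t29, a2]
    have hb' : Building D t' := by
      rw [ht']
      exact hb.sem _ (by decide) (by decide)
    have hg' : Grows t t' := by
      rw [ht']
      exact Grows.sem _ _ (by decide) (by decide)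
    have hz : ¬ D.E (D.zu l) (D.zv l) := not_not.2 (D.A_zero _ hl)
    obtain ⟨b1, b2, b3⟩ := hb'.addArc (x := 34) (y := 29) (by decide) (by decide)
      (by rw [k34, k29]; exact .cross hk hz c1 c2)
    obtain ⟨t2, ht2⟩ : ∃ t2, t2 = sem (addArc 34 29) t' := ⟨_, rfl⟩
    rw [← ht2] at b1 b2 b3
    have l28 : t2.reg 28 = D.A (D.fu k) (D.zv l) := by
      rw [ht2, sem_reg_of_notMem _ _ (by decide), k28]
    have l35 : t2.reg 35 = D.neg (D.A (D.zu l) (D.fv k)) := by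
      rw [ht2, sem_reg_of_notMem _ _ (by decide), k35]
    obtain ⟨d1, d2, d3⟩ := b1.addArc (x := 35) (y := 28) (by decide) (by decide)
      (by rw [l35, l28]; exact .cross' hk hz c1 c2)
    have hsem : sem (block [load 34 16 28, load 35 16 29, addArc 34 29, addArc 35 28]) t =
        sem (addArc 35 28) t2 := by
      rw [ht2, ht']; rfl
    rw [hsem]
    rw [k34, k29] at b3
    rw [l35, l28] at d3
    exact ⟨d1, ((hg.trans hg').trans b2).trans d2, fun _ _ => ⟨d2.1 _ _ b3, d3⟩⟩

theorem cmdRestricted_spec {D : Graph} {s : State} (h : Building D s) :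
    Building D (sem cmdRestricted s) ∧ Grows s (sem cmdRestricted s) ∧
      ∀ k < D.f, AvoidStored D k (sem cmdRestricted s) ∧
        ∀ l < D.mh, CrossStored D k l (sem cmdRestricted s) := by
  have hA : ∀ {k s s'}, Grows s s' → AvoidStored D k s → AvoidStored D k s' :=
    fun hg hq => hg.1 _ _ hq
  have hC : ∀ {k l s s'}, Grows s s' → CrossStored D k l s → CrossStored D k l s' :=
    fun hg hq h1 h2 => ⟨hg.1 _ _ (hq h1 h2).1, hg.1 _ _ (hq h1 h2).2⟩
  refine sem_loop_mono (i := 20) (n := 13) (N := D.f)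
    (c := seq restrictedHead (loop 21 14 restrictedBody)) (Building D) Grows
    (fun k st => AvoidStored D k st ∧ ∀ l < D.mh, CrossStored D k l st)
    (fun st v hs => hs.setReg (by decide)) (fun st v => .setReg (by decide))
    Grows.trans (fun hg hq => ⟨hA hg hq.1, fun l hl => hC hg (hq.2 l hl)⟩) ?_ h h.base.r13
  intro st hst hlt
  obtain ⟨g1, g2, g3, g4, g5⟩ := restrictedHead_spec hst hlt
  obtain ⟨k, hk⟩ : ∃ k, k = st.reg 20 := ⟨_, rfl⟩
  rw [← hk] at g3 g4 g5 hlt ⊢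
  simp only [sem_seq]
  obtain ⟨t, ht⟩ : ∃ t, t = sem restrictedHead st := ⟨_, rfl⟩
  rw [← ht] at g1 g2 g3 g4 g5 ⊢
  have hin := sem_loop_mono (i := 21) (n := 14) (N := D.mh) (c := restrictedBody)
    (fun st => Building D st ∧ st.reg 22 = D.fu k ∧ st.reg 23 = D.fv k) Grows (CrossStored D k)
    (fun st v hs => ⟨hs.1.setReg (by decide), by simp [hs.2], by simp [hs.2]⟩)
    (fun st v => .setReg (by decide)) Grows.trans hC ?_ (s := t) ⟨g1, g4, g5⟩ g1.base.r14
  · exact ⟨hin.1.1, g2.trans hin.2.1, hA hin.2.1 g3, hin.2.2⟩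
  · rintro u ⟨u1, u2, u3⟩ hl
    obtain ⟨b1, b2, b3⟩ := restrictedBody_spec u1 hlt hl u2 u3
    exact ⟨⟨b1, (sem_reg_of_notMem _ _ (by decide)).trans u2,
      (sem_reg_of_notMem _ _ (by decide)).trans u3⟩, b2, b3⟩

end TwoChain

namespace TwoChain

open Cmd Instr

/-! ### The search on the machine -/

/-- The state of the search that is stored in a state of the machine. -/
def State.search (s : State) : Search where
  vis := s.arr 19
  ptr := s.arr 20
  stk := s.arr 21
  ord := s.arr 22
  sp := s.reg 40
  rt := s.reg 41
  cnt := s.reg 42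

theorem cmdStep_search {s : State} (h4 : s.reg 4 = 1) (h5 : s.reg 5 = 0) :
    (sem cmdStep s).search = Search.step (s.reg 18) (s.arr 14) (s.arr 13) (s.arr 12) (s.arr 17)
      (s.arr 18) s.search := by
  by_cases c1 : s.reg 40 = 0
  · by_cases c2 : s.reg 41 < s.reg 18
    · by_cases c3 : s.arr 19 (s.arr 17 (s.reg 41 + 1)) = 0 ∧
        s.arr 19 (s.arr 18 (s.arr 17 (s.reg 41 + 1))) = 0
      · have : Search.step (s.reg 18) (s.arr 14) (s.arr 13) (s.arr 12) (s.arr 17) (s.arr 18)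
            s.search = Search.visit (s.arr 12) { s.search with rt := s.reg 41 + 1 }
              (s.arr 17 (s.reg 41 + 1)) := by
          simp only [Search.step, State.search, c1, c2, c3, if_true, and_self]
        rw [this]
        simp only [cmdStep, sem_ite_eq, sem_ite_lt, h5, c1, c2, if_true, sem_block_cons,
          sem_block_nil]
        ext <;> simp [h4, h5, c3, cmdVisit, Search.visit, State.search, c1]
      · have : Search.step (s.reg 18) (s.arr 14) (s.arr 13) (s.arr 12) (s.arr 17) (s.arr 18)
            s.search = { s.search with rt := s.reg 41 + 1 } := by
          simp only [Search.step, State.search, c1, c2, c3, if_true, if_false]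
        rw [this]
        simp only [cmdStep, sem_ite_eq, sem_ite_lt, h5, c1, c2, if_true, sem_block_cons,
          sem_block_nil]
        by_cases c4 : s.arr 19 (s.arr 17 (s.reg 41 + 1)) = 0
        · have c5 : s.arr 19 (s.arr 18 (s.arr 17 (s.reg 41 + 1))) ≠ 0 := fun c5 => c3 ⟨c4, c5⟩
          ext <;> simp [h4, h5, c4, c5, State.search, c1]
        · ext <;> simp [h4, h5, c4, State.search, c1]
    · have : Search.step (s.reg 18) (s.arr 14) (s.arr 13) (s.arr 12) (s.arr 17) (s.arr 18)
          s.search = s.search := by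
        simp only [Search.step, State.search, c1, c2, if_true, if_false]
      rw [this]
      simp [cmdStep, h5, c1, c2]
  · by_cases c2 : s.arr 20 (s.arr 21 (s.reg 40)) = 0
    · ext <;> simp [cmdStep, State.search, h4, h5, c1, c2, Search.step]
    · by_cases c3 : s.arr 19 (s.arr 14 (s.arr 20 (s.arr 21 (s.reg 40)))) = 0
      · ext <;> simp [cmdStep, State.search, h4, h5, c1, c2, c3, Search.step, cmdVisit,
          Search.visit]
      · ext <;> simp [cmdStep, State.search, h5, c1, c2, c3, Search.step]

theorem Search.Inv.of_cmdSearch {N : ℕ} {G : LinkedGraph} {s : State} (h4 : s.reg 4 = 1)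
    (h5 : s.reg 5 = 0) (h18 : s.reg 18 = N) (hG : Stored N G s)
    (hR : ∀ i, 1 ≤ i → i ≤ N → 1 ≤ s.arr 17 i ∧ s.arr 17 i ≤ N)
    (h17 : 2 * N + s.reg 16 ≤ s.reg 17) (h19 : ∀ x, s.arr 19 x = 0) :
    Search.Inv G (s.arr 17) (s.arr 18) (sem cmdSearch s).search ∧
      (sem cmdSearch s).search.sp = 0 ∧ (sem cmdSearch s).search.rt = N := by
  obtain ⟨t, ht⟩ : ∃ t, t = sem (block [lit 40 0, lit 41 0, lit 42 0]) s := ⟨_, rfl⟩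
  have hsem : sem cmdSearch s = sem (loop 20 17 cmdStep) t := by rw [ht]; rfl
  have hta : t.arr = s.arr := by rw [ht]; rfl
  have htr : ∀ r, r ≠ 40 → r ≠ 41 → r ≠ 42 → t.reg r = s.reg r := by
    intro r h1 h2 h3
    rw [ht]; simp [h1, h2, h3]
  rw [hsem]
  have hrun := sem_loop_inv (i := 20) (n := 17) (c := cmdStep) (s := t)
    (fun k st => st.search =
      (Search.step G.N G.dst G.nxt G.head (s.arr 17) (s.arr 18))^[k] t.search) ?_ ?_
  · rw [htr 17 (by decide) (by decide) (by decide)] at hrun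
    rw [hrun]
    have h0 : t.search.sp = 0 ∧ t.search.rt = 0 ∧ t.search.cnt = 0 := by
      rw [ht]; simp [State.search]
    have hinit : Search.Inv G (s.arr 17) (s.arr 18) t.search :=
      Search.inv_init (fun x => by simp only [State.search, hta]; exact h19 x) h0.1 h0.2.1 h0.2.2
    have htodo := Search.todo_init (G := G) h0.2.1 h0.2.2
    rw [← hG.N_eq] at hR h17 ⊢
    refine Search.Inv.run hR _ hinit (htodo.trans ?_)
    rw [← hG.K_eq]
    exact h17
  · simp [State.search]
  · intro k st hk hi hr ha ih
    rw [Function.iterate_succ_apply', ← ih]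
    have e : ((sem cmdStep st).setReg 20 (k + 1)).search = (sem cmdStep st).search := by
      simp [State.search]
    rw [e, cmdStep_search (by rw [hr 4 (by decide) (by decide), htr, h4] <;> decide)
      (by rw [hr 5 (by decide) (by decide), htr, h5] <;> decide),
      hr 18 (by decide) (by decide), htr 18 (by decide) (by decide) (by decide), h18,
      ha 14 (by decide), ha 13 (by decide), ha 12 (by decide), ha 17 (by decide),
      ha 18 (by decide), hta, hG.dst_eq, hG.nxt_eq, hG.head_eq, hG.N_eq]

theorem cmdBudget_spec {D : Graph} {s : State} (h : Base D s) :
    (sem cmdBudget s).reg 17 = s.reg 16 + 4 * D.m ∧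
      ∀ x, 1 ≤ x → x ≤ 2 * D.m → (sem cmdBudget s).arr 17 x = x := by
  obtain ⟨c, hc⟩ : ∃ c, c = block [add 17 17 4, add 17 17 4, add 17 17 4, add 17 17 4] := ⟨_, rfl⟩
  obtain ⟨d, hd⟩ : ∃ d, d = block [add 22 20 4, store 17 22 22] := ⟨_, rfl⟩
  obtain ⟨t, ht⟩ : ∃ t, t = s.setReg 17 (s.reg 16) := ⟨_, rfl⟩
  obtain ⟨u, hu⟩ : ∃ u, u = sem (loop 20 12 c) t := ⟨_, rfl⟩
  have hsem : sem cmdBudget s = sem (loop 20 18 d) u := by rw [hu, ht, hc, hd]; rfl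
  have hbt : Base D t := by rw [ht]; exact h.setReg (by decide)
  have h1 : u.reg 17 = s.reg 16 + 4 * D.m := by
    have := sem_loop_inv (i := 20) (n := 12) (c := c) (s := t)
      (fun k st => st.reg 17 = s.reg 16 + 4 * k) (by simp [ht]) ?_
    · rw [hbt.r12] at this
      rwa [hu]
    · intro k st hk hi hr ha ih
      have r4 : st.reg 4 = 1 := by
        rw [hr 4 (by decide) (by rw [hc]; decide), hbt.r4]
      simp [hc, r4, ih]
      omega
  have hbu : Base D u := by
    rw [hu]
    exact hbt.sem _ (by rw [hc]; decide) (by rw [hc]; decide)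
  rw [hsem]
  refine ⟨by rw [sem_reg_of_notMem _ _ (by rw [hd]; decide), h1], ?_⟩
  have := sem_loop_inv (i := 20) (n := 18) (c := d) (s := u)
    (fun k st => ∀ x, 1 ≤ x → x ≤ k → st.arr 17 x = x) (fun x h1 h2 => by omega) ?_
  · rwa [hbu.r18] at this
  · intro k st hk hi hr ha ih x x1 x2
    have r4 : st.reg 4 = 1 := by
      rw [hr 4 (by decide) (by rw [hd]; decide), hbu.r4]
    simp [hd, r4, hi, Function.update_apply]
    split_ifs with hx
    · exact hx.symm
    · exact ih x x1 (by omega)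

theorem cmdReverse_spec {D : Graph} {s : State} (h : Base D s)
    (h22 : ∀ i, 1 ≤ i → i ≤ 2 * D.m → 1 ≤ s.arr 22 i ∧ s.arr 22 i ≤ 2 * D.m)
    (h19 : ∀ x, s.arr 19 x ≠ 0 → 1 ≤ x ∧ x ≤ 2 * D.m) :
    (∀ i, 1 ≤ i → i ≤ 2 * D.m →
      (sem cmdReverse s).arr 17 i = D.neg (s.arr 22 (2 * D.m + 1 - i)) ∧
      (sem cmdReverse s).arr 18 i = D.neg i) ∧ ∀ x, (sem cmdReverse s).arr 19 x = 0 := by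
  obtain ⟨d, hd⟩ : ∃ d, d = block [add 22 20 4, sub 23 18 20, load 24 22 23, load 25 16 24,
    store 17 22 25, load 26 16 22, store 18 22 26, store 19 22 5] := ⟨_, rfl⟩
  have hsem : sem cmdReverse s = sem (loop 20 18 d) s := by rw [hd]; rfl
  rw [hsem]
  have := sem_loop_inv (i := 20) (n := 18) (c := d) (s := s)
    (fun k st => (∀ i, 1 ≤ i → i ≤ k → st.arr 17 i = D.neg (s.arr 22 (2 * D.m + 1 - i)) ∧
      st.arr 18 i = D.neg i) ∧ ∀ x, st.arr 19 x = if 1 ≤ x ∧ x ≤ k then 0 else s.arr 19 x) ?_ ?_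
  · rw [h.r18] at this
    refine ⟨this.1, fun x => ?_⟩
    rw [this.2]
    split_ifs with hx
    · rfl
    · by_contra h0
      exact hx (h19 x h0)
  · refine ⟨fun i h1 h2 => by omega, fun x => ?_⟩
    rw [if_neg (by omega)]
    rfl
  · rintro k st hk hi hr ha ⟨i1, i2⟩
    rw [h.r18] at hk
    have r4 : st.reg 4 = 1 := by rw [hr 4 (by decide) (by rw [hd]; decide), h.r4]
    have r5 : st.reg 5 = 0 := by rw [hr 5 (by decide) (by rw [hd]; decide), h.r5]
    have r18 : st.reg 18 = 2 * D.m := by rw [hr 18 (by decide) (by rw [hd]; decide), h.r18]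
    have a22 : st.arr 22 = s.arr 22 := ha 22 (by rw [hd]; decide)
    have a16 : st.arr 16 = s.arr 16 := ha 16 (by rw [hd]; decide)
    have o := h22 (2 * D.m - k) (by omega) (by omega)
    have e1 := h.a16 _ o.1 o.2
    have e2 := h.a16 (k + 1) (by omega) (by omega)
    constructor
    · intro i h1 h2
      simp [hd, r4, r5, r18, hi, a22, a16, e1, e2, Function.update_apply]
      by_cases e : i = k + 1
      · subst e
        simp
      · simp [e, i1 i h1 (by omega)]
    · intro x
      simp [hd, r4, r5, hi, Function.update_apply, i2]
      split_ifs <;> first | rfl | omega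

end TwoChain

namespace TwoChain

open Cmd Instr

/-! ### From the searches to a colouring -/

/-- The restricted edges. -/
def Inst.F (D : Inst) (u v : ℕ) : Prop := ∃ k < D.f, D.fu k = u ∧ D.fv k = v

/-- The arcs stored in `s` are all implications. -/
def ArcsComplete (D : Inst) (s : State) : Prop := ∀ x y, Impl D x y → ArcIn s x y

/-- The nonedge in a `cross` implication lies between vertices of the graph, because these are ends
of edges; hence it occurs in the list of nonedges. -/
theorem arcsComplete_of {D : Graph} {s : State}
    (h1 : ∀ u v x y, Conf D.E u v x y → Recorded D.toInst u v x y s)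
    (h2 : ∀ k < D.f, AvoidStored D k s ∧ ∀ l < D.mh, CrossStored D k l s) :
    ArcsComplete D.toInst s := by
  intro x y h
  have hz : ∀ {k a v}, k < D.f → ¬ D.E a v → D.E (D.fu k) v → D.E a (D.fv k) →
      ∃ l < D.mh, D.zu l = a ∧ D.zv l = v := fun hk hz h3 h4 =>
    D.zero_mem _ _ (D.lt_of_E h4).1 (D.lt_of_E h3).2 (not_not.1 hz)
  cases h with
  | conf h => exact (h1 _ _ _ _ h).1
  | conf_neg h => exact (h1 _ _ _ _ h).2.1
  | avoid h => exact (h2 _ h).1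
  | cross hk hn h3 h4 =>
    obtain ⟨l, hl, rfl, rfl⟩ := hz hk hn h3 h4
    exact ((h2 _ hk).2 l hl h3 h4).1
  | cross' hk hn h3 h4 =>
    obtain ⟨l, hl, rfl, rfl⟩ := hz hk hn h3 h4
    exact ((h2 _ hk).2 l hl h3 h4).2

/-- The literal `x` holds under the colouring `S`. -/
def Inst.Sat (D : Inst) (S : ℕ → ℕ → Prop) (x : ℕ) : Prop :=
  (x ≤ D.m ∧ ¬ S (D.eu x) (D.ev x)) ∨ (D.m < x ∧ S (D.eu (x - D.m)) (D.ev (x - D.m)))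

theorem Inst.sat_A {D : Inst} {S : ℕ → ℕ → Prop} {u v : ℕ} (h : D.E u v) :
    D.Sat S (D.A u v) ↔ ¬ S u v := by
  have := A_mem h
  simp only [Sat, D.eu_A u v h, D.ev_A u v h]
  constructor
  · rintro (h | h)
    · exact h.2
    · omega
  · exact fun h => Or.inl ⟨this.2, h⟩

theorem Inst.sat_neg {D : Inst} {S : ℕ → ℕ → Prop} {x : ℕ} (h : 1 ≤ x ∧ x ≤ 2 * D.m) :
    D.Sat S x ↔ ¬ D.Sat S (D.neg x) := by
  unfold Sat neg
  by_cases hx : x ≤ D.m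
  · have h1 : ¬ x + D.m ≤ D.m := by omega
    have h2 : D.m < x + D.m := by omega
    have h3 : ¬ D.m < x := by omega
    simp only [hx, if_true, h1, h2, h3, Nat.add_sub_cancel, true_and, false_and, or_false,
      false_or]
  · have h1 : x - D.m ≤ D.m := by omega
    have h2 : ¬ D.m < x - D.m := by omega
    have h3 : D.m < x := by omega
    simp only [hx, if_false, h1, h2, h3, true_and, false_and, or_false,
      false_or, not_not]

theorem Inst.sat_neg_A {D : Inst} {S : ℕ → ℕ → Prop} {u v : ℕ} (h : D.E u v) :
    D.Sat S (D.neg (D.A u v)) ↔ S u v := by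
  have h1 := sat_neg (S := S) (A_lit h)
  rw [← not_iff_not, ← h1, sat_A h]

theorem Impl.sat {D : Inst} {S : ℕ → ℕ → Prop} (h : IsColoring D.E D.F S) {x y : ℕ}
    (hi : Impl D x y) (hx : D.Sat S x) : D.Sat S y := by
  cases hi with
  | conf hc =>
    rw [Inst.sat_neg_A hc.1] at hx
    rw [Inst.sat_A hc.2.1]
    exact (h.conf hc).1 hx
  | conf_neg hc =>
    rw [Inst.sat_A hc.1] at hx
    rw [Inst.sat_neg_A hc.2.1]
    have := h.conf hc
    tauto
  | avoid hk =>
    rw [Inst.sat_neg_A (D.A_res _ hk)] at hx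
    exact absurd hx (h.avoid ⟨_, hk, rfl, rfl⟩)
  | cross hk hz h1 h2 =>
    rw [Inst.sat_neg_A h1] at hx
    rw [Inst.sat_A h2]
    exact h.cross ⟨_, hk, rfl, rfl⟩ hz hx
  | cross' hk hz h1 h2 =>
    rw [Inst.sat_neg_A h2] at hx
    rw [Inst.sat_A h1]
    exact fun h3 => h.cross ⟨_, hk, rfl, rfl⟩ hz h3 hx

/-- A closed, total and consistent set of literals is a colouring. -/
theorem isColoring_of_closed {D : Inst} {vis : ℕ → Prop} (h1 : ∀ x y, Impl D x y → vis x → vis y)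
    (h3 : ∀ e, 1 ≤ e → e ≤ D.m → (vis e ↔ ¬ vis (D.neg e))) :
    IsColoring D.E D.F fun u v => D.E u v ∧ vis (D.neg (D.A u v)) where
  restricted := by
    rintro u v ⟨k, hk, rfl, rfl⟩
    exact D.A_res k hk
  sub h := h.1
  conf {u v x y} hc := by
    have k1 := h1 _ _ (.conf hc)
    have k2 := h1 _ _ (.conf_neg hc)
    have k3 := h3 _ (Inst.A_mem hc.1).1 (Inst.A_mem hc.1).2
    have k4 := h3 _ (Inst.A_mem hc.2.1).1 (Inst.A_mem hc.2.1).2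
    have k5 := hc.1
    have k6 := hc.2.1
    tauto
  avoid := by
    rintro u v ⟨k, hk, rfl, rfl⟩ ⟨-, h⟩
    have k1 := h1 _ _ (.avoid hk)
    have k3 := h3 _ (Inst.A_mem (D.A_res k hk)).1 (Inst.A_mem (D.A_res k hk)).2
    tauto
  cross := by
    rintro u b a v ⟨k, hk, rfl, rfl⟩ hz ⟨e1, s1⟩ ⟨e2, s2⟩
    have k1 := h1 _ _ (.cross hk hz e1 e2)
    have k4 := h3 _ (Inst.A_mem e2).1 (Inst.A_mem e2).2
    tauto

/-- The commands that solve the implication graph. -/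
def cmdSolve : Cmd := block [cmdBudget, cmdSearch, cmdReverse, cmdSearch]

/-- One search command is run twice. At first array 18 is zero, no root is excluded by its negation,
and all literals are finished. The second run, with the negations in place, performs the greedy
assignment along the reversed finishing order. -/
theorem cmdSolve_spec {D : Graph} {s : State} (h : Base D s) (ha : ArcState D.toInst s)
    (hc : ArcsComplete D.toInst s) (h18 : ∀ x, s.arr 18 x = 0) (h19 : ∀ x, s.arr 19 x = 0) :
    (∀ x y, Impl D.toInst x y → (sem cmdSolve s).arr 19 x ≠ 0 → (sem cmdSolve s).arr 19 y ≠ 0) ∧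
    (∀ x, 1 ≤ x → x ≤ 2 * D.m →
      (sem cmdSolve s).arr 19 x ≠ 0 ∨ (sem cmdSolve s).arr 19 (D.neg x) ≠ 0) ∧
    ∀ S, IsColoring D.E D.F S → ∀ x, 1 ≤ x → x ≤ 2 * D.m →
      ¬ ((sem cmdSolve s).arr 19 x ≠ 0 ∧ (sem cmdSolve s).arr 19 (D.neg x) ≠ 0) := by
  obtain ⟨s1, hs1⟩ : ∃ s1, s1 = sem cmdBudget s := ⟨_, rfl⟩
  obtain ⟨s2, hs2⟩ : ∃ s2, s2 = sem cmdSearch s1 := ⟨_, rfl⟩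
  obtain ⟨s3, hs3⟩ : ∃ s3, s3 = sem cmdReverse s2 := ⟨_, rfl⟩
  obtain ⟨s4, hs4⟩ : ∃ s4, s4 = sem cmdSearch s3 := ⟨_, rfl⟩
  have hsem : sem cmdSolve s = s4 := by rw [hs4, hs3, hs2, hs1]; rfl
  rw [hsem]
  obtain ⟨⟨G, hG⟩, hsound⟩ := ha
  have harc : ∀ x y, G.arc x y ↔ Impl D.toInst x y := fun x y =>
    ⟨fun hx => hsound x y (hG.arc_iff.1 hx), fun hx => hG.arc_iff.2 (hc x y hx)⟩
  have hst : ∀ {t t' : State}, Stored (2 * D.m) G t → t'.reg 16 = t.reg 16 →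
      (∀ a ∈ [11, 12, 13, 14], t'.arr a = t.arr a) → Stored (2 * D.m) G t' := by
    intro t t' ht hr ha
    refine ⟨ht.N_eq, by rw [hr, ht.K_eq], ?_, ?_, ?_, ?_⟩
    · rw [ha _ (by decide), ht.src_eq]
    · rw [ha _ (by decide), ht.head_eq]
    · rw [ha _ (by decide), ht.nxt_eq]
    · rw [ha _ (by decide), ht.dst_eq]
  have b1 : Base D s1 := by rw [hs1]; exact h.sem _ (by decide) (by decide)
  have b2 : Base D s2 := by rw [hs2]; exact b1.sem _ (by decide) (by decide)
  have b3 : Base D s3 := by rw [hs3]; exact b2.sem _ (by decide) (by decide)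
  have g1 : Stored (2 * D.m) G s1 := hst hG
    (by rw [hs1]; exact sem_reg_of_notMem _ _ (by decide))
    fun a h' => by rw [hs1]; exact sem_arr_of_notMem _ _ (by revert a; decide)
  have g3 : Stored (2 * D.m) G s3 := hst g1
    (by rw [hs3, hs2, sem_reg_of_notMem _ _ (by decide), sem_reg_of_notMem _ _ (by decide)])
    fun a h' => by
      rw [hs3, hs2, sem_arr_of_notMem _ _ (by revert a; decide),
        sem_arr_of_notMem _ _ (by revert a; decide)]
  obtain ⟨e17, e17'⟩ := cmdBudget_spec h
  rw [← hs1] at e17 e17'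
  have e16 : s1.reg 16 = s.reg 16 := by rw [hs1]; exact sem_reg_of_notMem _ _ (by decide)
  have e18 : ∀ x, s1.arr 18 x = 0 := fun x => by
    rw [hs1, sem_arr_of_notMem _ _ (by decide), h18]
  have e19 : ∀ x, s1.arr 19 x = 0 := fun x => by
    rw [hs1, sem_arr_of_notMem _ _ (by decide), h19]
  obtain ⟨i1, i2, i3⟩ := Search.Inv.of_cmdSearch b1.r4 b1.r5 b1.r18 g1
    (fun i h1 h2 => by rw [e17' i h1 h2]; exact ⟨h1, h2⟩) (by omega) e19
  rw [← hs2] at i1 i2 i3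
  rw [← g1.N_eq] at i3
  have hR1 : ∀ i, 1 ≤ i → i ≤ G.N → s1.arr 17 i = i := by rw [g1.N_eq]; exact e17'
  have hng1 : ∀ i, 1 ≤ i → i ≤ G.N → s1.arr 18 i = 0 := fun i _ _ => e18 i
  obtain ⟨post, p1, p2, p3, p4⟩ := i1.exists_post i2 i3 hR1 hng1
  have hord : ∀ i, 1 ≤ i → i ≤ 2 * D.m → 1 ≤ s2.arr 22 i ∧ s2.arr 22 i ≤ 2 * D.m := by
    intro i h1 h2
    have := (p3 i h1 (by rw [g1.N_eq]; exact h2)).1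
    rwa [g1.N_eq] at this
  have hvm : ∀ x, s2.arr 19 x ≠ 0 → 1 ≤ x ∧ x ≤ 2 * D.m := by
    intro x hx
    have := i1.vis_mem x hx
    rwa [g1.N_eq] at this
  obtain ⟨r1, r2⟩ := cmdReverse_spec b2 hord hvm
  rw [← hs3] at r1 r2
  have f16 : s3.reg 16 = s.reg 16 := by
    rw [hs3, hs2, sem_reg_of_notMem _ _ (by decide), sem_reg_of_notMem _ _ (by decide), e16]
  have f17 : s3.reg 17 = s.reg 16 + 4 * D.m := by
    rw [hs3, hs2, sem_reg_of_notMem _ _ (by decide), sem_reg_of_notMem _ _ (by decide), e17]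
  obtain ⟨j1, j2, j3⟩ := Search.Inv.of_cmdSearch b3.r4 b3.r5 b3.r18 g3
    (fun i h1 h2 => by
      rw [(r1 i h1 h2).1]
      exact Inst.neg_mem (hord _ (by omega) (by omega))) (by omega) r2
  rw [← hs4] at j1 j2 j3
  rw [← g1.N_eq] at j3
  obtain ⟨q1, q2, q3⟩ := i1.assignment (neg := D.neg) i2 i3 hR1 hng1 j1 j2 j3
    (fun i h1 h2 => by
      rw [g1.N_eq] at h2 ⊢
      exact (r1 i h1 h2).1)
    (fun i h1 h2 => by
      rw [g1.N_eq] at h2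
      exact (r1 i h1 h2).2)
    (fun i h1 h2 => by
      rw [g1.N_eq] at h2 ⊢
      exact ⟨Inst.neg_mem ⟨h1, h2⟩, Inst.neg_neg ⟨h1, h2⟩⟩)
    (fun x y hxy => (harc _ _).2 ((harc _ _).1 hxy).contrapose)
  rw [g1.N_eq] at q2 q3
  refine ⟨fun x y hxy => q1 x y ((harc x y).2 hxy), q2, fun S hS => ?_⟩
  exact q3 {x | D.Sat S x} (fun x y hxy hx => ((harc x y).1 hxy).sat hS hx)
    fun x h1 h2 => Inst.sat_neg ⟨h1, h2⟩

theorem cmdColour_spec {D : Graph} {s : State} (h : Base D s) (h23 : ∀ x, s.arr 23 x = 0) :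
    ((sem cmdColour s).reg 43 = 0 ↔ ∀ e, 1 ≤ e → e ≤ D.m →
      ¬ (s.arr 19 e ≠ 0 ∧ s.arr 19 (D.neg e) ≠ 0)) ∧
    ∀ e, (sem cmdColour s).arr 23 e =
      if (1 ≤ e ∧ e ≤ D.m) ∧ s.arr 19 (D.neg e) ≠ 0 ∧ s.arr 15 e ≠ 0 then 1 else 0 := by
  obtain ⟨c, hc⟩ : ∃ c, c = block [add 22 20 4, load 23 16 22, load 24 19 22, load 25 19 23,
      load 26 15 22, ite (.ne 25 5)
        (block [ite (.ne 24 5) (lit 43 1) skip,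
          ite (.ne 26 5) (store 23 22 4) skip]) skip] := ⟨_, rfl⟩
  obtain ⟨t, ht⟩ : ∃ t, t = s.setReg 43 0 := ⟨_, rfl⟩
  have hsem : sem cmdColour s = sem (loop 20 12 c) t := by rw [hc, ht]; rfl
  have hb : Base D t := by rw [ht]; exact h.setReg (by decide)
  have hta : t.arr = s.arr := by rw [ht]; rfl
  rw [hsem]
  have := sem_loop_inv (i := 20) (n := 12) (c := c) (s := t)
    (fun k st => (st.reg 43 = 0 ↔ ∀ e, 1 ≤ e → e ≤ k →
      ¬ (s.arr 19 e ≠ 0 ∧ s.arr 19 (D.neg e) ≠ 0)) ∧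
      ∀ e, st.arr 23 e =
        if (1 ≤ e ∧ e ≤ k) ∧ s.arr 19 (D.neg e) ≠ 0 ∧ s.arr 15 e ≠ 0 then 1 else 0) ?_ ?_
  · rwa [hb.r12] at this
  · refine ⟨iff_of_true (by simp [ht]) fun e h1 h2 => by omega, fun e => ?_⟩
    rw [if_neg (by omega)]
    simp [hta, h23]
  · rintro k st hk hi hr ha ⟨i1, i2⟩
    rw [hb.r12] at hk
    have r4 : st.reg 4 = 1 := by rw [hr 4 (by decide) (by rw [hc]; decide), hb.r4]
    have r5 : st.reg 5 = 0 := by rw [hr 5 (by decide) (by rw [hc]; decide), hb.r5]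
    have a16 : st.arr 16 (k + 1) = D.neg (k + 1) := by
      rw [ha 16 (by rw [hc]; decide), hta, h.a16 _ (by omega) (by omega)]
    have a19 : st.arr 19 = s.arr 19 := by rw [ha 19 (by rw [hc]; decide), hta]
    have a15 : st.arr 15 = s.arr 15 := by rw [ha 15 (by rw [hc]; decide), hta]
    have hex : (∀ e, 1 ≤ e → e ≤ k + 1 → ¬ (s.arr 19 e ≠ 0 ∧ s.arr 19 (D.neg e) ≠ 0)) ↔
        (∀ e, 1 ≤ e → e ≤ k → ¬ (s.arr 19 e ≠ 0 ∧ s.arr 19 (D.neg e) ≠ 0)) ∧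
          ¬ (s.arr 19 (k + 1) ≠ 0 ∧ s.arr 19 (D.neg (k + 1)) ≠ 0) := by
      refine ⟨fun h => ⟨fun e h1 h2 => h e h1 (by omega), h (k + 1) (by omega) le_rfl⟩, ?_⟩
      rintro ⟨h1, h2⟩ e e1 e2
      by_cases e3 : e = k + 1
      · rwa [e3]
      · exact h1 e e1 (by omega)
    have hite : ∀ e, e ≠ k + 1 → ((1 ≤ e ∧ e ≤ k + 1) ↔ (1 ≤ e ∧ e ≤ k)) := by
      intro e he
      omega
    rw [hex, ← i1]
    by_cases c1 : s.arr 19 (D.neg (k + 1)) = 0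
    · constructor
      · simp [hc, r4, r5, hi, a16, a19, a15, c1]
      · intro e
        simp only [hc, sem_block_cons, sem_block_nil, sem_ite_ne]
        simp [r4, r5, hi, a16, a19, c1, i2]
        by_cases e3 : e = k + 1
        · subst e3; simp [c1]
        · simp only [hite e e3]
    · constructor
      · by_cases c2 : s.arr 19 (k + 1) = 0 <;> by_cases c3 : s.arr 15 (k + 1) = 0 <;>
          simp [hc, r4, r5, hi, a16, a19, a15, c1, c2, c3]
      · intro e
        simp only [hc, sem_block_cons, sem_block_nil, sem_ite_ne]
        by_cases e3 : e = k + 1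
        · by_cases c2 : s.arr 19 (k + 1) = 0 <;> by_cases c3 : s.arr 15 (k + 1) = 0 <;>
            simp [r4, r5, hi, a16, a19, a15, c1, c2, c3, i2, e3]
        · simp only [hite e e3]
          by_cases c2 : s.arr 19 (k + 1) = 0 <;> by_cases c3 : s.arr 15 (k + 1) = 0 <;>
            simp [r4, r5, hi, a16, a19, a15, c1, c2, c3, i2, e3]

/-- The colouring stored in array `23`. -/
def State.col (D : Inst) (s : State) (u v : ℕ) : Prop := s.arr 23 (D.A u v) = 1

/-- An edge has a stored partner precisely when it lies in a conflict, so the stored colours are the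
tightened colouring defined by the marks. -/
theorem isTight_col {D : Graph} {s t : State} (hp : ParState D.toInst s)
    (hp' : ∀ u v x y, Conf D.E u v x y → s.arr 15 (D.A u v) ≠ 0)
    (h1 : ∀ x y, Impl D.toInst x y → s.arr 19 x ≠ 0 → s.arr 19 y ≠ 0)
    (h2 : ∀ x, 1 ≤ x → x ≤ 2 * D.m → s.arr 19 x ≠ 0 ∨ s.arr 19 (D.neg x) ≠ 0)
    (h3 : ∀ e, 1 ≤ e → e ≤ D.m → ¬ (s.arr 19 e ≠ 0 ∧ s.arr 19 (D.neg e) ≠ 0))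
    (h4 : ∀ e, t.arr 23 e =
      if (1 ≤ e ∧ e ≤ D.m) ∧ s.arr 19 (D.neg e) ≠ 0 ∧ s.arr 15 e ≠ 0 then 1 else 0) :
    IsTight D.E D.F (t.col D.toInst) := by
  have hcol := (isColoring_of_closed (D := D.toInst) (vis := fun x => s.arr 19 x ≠ 0) h1
    fun e e1 e2 => by
      have k1 := h2 e e1 (by omega)
      have k2 := h3 e e1 e2
      tauto).tighten
  have hpar : ∀ u v, D.E u v → (s.arr 15 (D.A u v) ≠ 0 ↔ ∃ x y, Conf D.E u v x y) := by
    intro u v huv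
    constructor
    · intro he
      obtain ⟨u', v', x, y, hc, e1, -⟩ := hp _ he
      have e2 : u = u' := by rw [← D.eu_A u v huv, e1, D.eu_A u' v' hc.1]
      have e3 : v = v' := by rw [← D.ev_A u v huv, e1, D.ev_A u' v' hc.1]
      subst e2 e3
      exact ⟨x, y, hc⟩
    · rintro ⟨x, y, hc⟩
      exact hp' _ _ _ _ hc
  have heq : t.col D.toInst = fun u v => (D.E u v ∧ s.arr 19 (D.neg (D.A u v)) ≠ 0) ∧
      ∃ x y, Conf D.E u v x y := by
    funext u v
    apply propext
    unfold State.col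
    rw [h4]
    by_cases huv : D.E u v
    · have hm := Inst.A_mem huv
      rw [← hpar u v huv]
      simp [huv, hm]
    · have : D.A u v = 0 := not_not.1 huv
      simp [huv, this]
  rw [heq]
  exact hcol

end TwoChain

namespace TwoChain

open Cmd Instr

/-! ### Repairing the colouring and writing the answer -/

theorem Inst.edge_end {D : Inst} {e : ℕ} (h1 : 1 ≤ e) (h2 : e ≤ D.m) :
    D.E (D.eu e) (D.ev e) := by
  unfold E
  rw [D.A_end e h1 h2]
  omega

/-- Array `23` holds the colours `0` and `1`, and array `15` a partner of each edge that has
one. -/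
structure Coloured (D : Graph) (s : State) : Prop where
  base : Base D s
  par : ParState D.toInst s
  par_ne : ∀ u v x y, Conf D.E u v x y → s.arr 15 (D.A u v) ≠ 0
  le_one : ∀ e, s.arr 23 e ≤ 1
  zero : s.arr 23 0 = 0
  tight : IsTight D.E D.F (s.col D.toInst)

/-- The edge `e`, with number at most `k`, lies in an alternating six-cycle opposite to the nonedge
`ab`, for the colours `C`. -/
def Repairs (D : Graph) (C : ℕ → ℕ) (a b k e : ℕ) : Prop :=
  (1 ≤ e ∧ e ≤ k) ∧ Alt D.E (fun u v => C (D.A u v) = 1) (D.eu e) (D.ev e) a b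

open Classical in
/-- The colour of edge `e` after the repair of the first `k` edges at the nonedge `ab`. -/
noncomputable def repaired (D : Graph) (C : ℕ → ℕ) (a b k e : ℕ) : ℕ :=
  if Repairs D C a b k e then 1 - C e else C e

theorem repaired_of_pos {D : Graph} {C : ℕ → ℕ} {a b k e : ℕ} (h : Repairs D C a b k e) :
    repaired D C a b k e = 1 - C e :=
  if_pos h

theorem repaired_of_neg {D : Graph} {C : ℕ → ℕ} {a b k e : ℕ} (h : ¬ Repairs D C a b k e) :
    repaired D C a b k e = C e :=
  if_neg h

theorem repaired_of_not_alt {D : Graph} {C : ℕ → ℕ} {a b k e : ℕ}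
    (h : ¬ Alt D.E (fun u v => C (D.A u v) = 1) (D.eu e) (D.ev e) a b) :
    repaired D C a b k e = C e :=
  repaired_of_neg fun h' => h h'.2

theorem repaired_le_one {D : Graph} {C : ℕ → ℕ} {a b k e : ℕ} (h : C e ≤ 1) :
    repaired D C a b k e ≤ 1 := by
  unfold repaired
  split <;> omega

theorem repaired_row {D : Graph} {C : ℕ → ℕ} {a b k v : ℕ} (hv : D.E a v) (hz : ¬ D.E a b) :
    repaired D C a b k (D.A a v) = C (D.A a v) := by
  refine repaired_of_not_alt ?_
  rw [D.eu_A _ _ hv, D.ev_A _ _ hv]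
  rintro ⟨x, y, -, -, h3, -⟩
  exact hz h3

theorem repaired_col {D : Graph} {C : ℕ → ℕ} {a b k u : ℕ} (hu : D.E u b) (hz : ¬ D.E a b) :
    repaired D C a b k (D.A u b) = C (D.A u b) := by
  refine repaired_of_not_alt ?_
  rw [D.eu_A _ _ hu, D.ev_A _ _ hu]
  rintro ⟨x, y, -, -, -, h4, -⟩
  exact hz h4

theorem repaired_succ_of_ne {D : Graph} {C : ℕ → ℕ} {a b k e : ℕ} (h : e ≠ k + 1) :
    repaired D C a b (k + 1) e = repaired D C a b k e := by
  have : Repairs D C a b (k + 1) e ↔ Repairs D C a b k e := and_congr_left fun _ => by omega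
  by_cases h' : Repairs D C a b k e
  · rw [repaired_of_pos h', repaired_of_pos (this.2 h')]
  · rw [repaired_of_neg h', repaired_of_neg fun h'' => h' (this.1 h'')]

theorem fixStore_arr {s : State} (h5 : s.reg 5 = 0) (e : ℕ) :
    (sem fixStore s).arr 23 e = if s.reg 30 ≠ 0 ∧ s.reg 31 ≠ 0 ∧ s.reg 32 ≠ 0 ∧ s.reg 33 ≠ 0 ∧
      s.arr 23 (s.reg 30) = s.arr 23 (s.reg 31) ∧ e = s.reg 24 then s.arr 23 (s.reg 30)
      else s.arr 23 e := by
  simp only [fixStore, sem_ite_ne, h5, sem_skip]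
  by_cases c1 : s.reg 30 = 0
  · simp [c1]
  by_cases c2 : s.reg 31 = 0
  · simp [c1, c2]
  by_cases c3 : s.reg 32 = 0
  · simp [c1, c2, c3]
  by_cases c4 : s.reg 33 = 0
  · simp [c1, c2, c3, c4]
  by_cases c5 : s.arr 23 (s.reg 30) = s.arr 23 (s.reg 31)
  · simp [c1, c2, c3, c4, c5, Function.update_apply]
  · simp [c1, c2, c3, c4, c5]

/-- The simultaneous flip may be carried out in place, edge by edge: the colours read for the
comparison lie in row a and column b, which do not change during the pass (`repaired_row`,
`repaired_col`). -/
theorem fixBody_spec {D : Graph} {s : State} {C : ℕ → ℕ} {a b k : ℕ} (h : Base D s)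
    (hp : ParState D.toInst s) (hp' : ∀ u v x y, Conf D.E u v x y → s.arr 15 (D.A u v) ≠ 0)
    (hC : ∀ e, C e ≤ 1) (hS : IsTight D.E D.F fun u v => C (D.A u v) = 1)
    (ha : a < D.p) (hb : b < D.q) (hz : ¬ D.E a b) (h21 : s.reg 21 = k) (hk : k < D.m)
    (h22 : s.reg 22 = a) (h23 : s.reg 23 = b) (hcol : ∀ e, s.arr 23 e = repaired D C a b k e) :
    ∀ e, (sem fixBody s).arr 23 e = repaired D C a b (k + 1) e := by
  obtain ⟨u, hu⟩ : ∃ u, u = D.eu (k + 1) := ⟨_, rfl⟩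
  obtain ⟨v, hv⟩ : ∃ v, v = D.ev (k + 1) := ⟨_, rfl⟩
  have huv : D.E u v := by rw [hu, hv]; exact Inst.edge_end (by omega) (by omega)
  have hA : D.A u v = k + 1 := by rw [hu, hv]; exact D.A_end _ (by omega) (by omega)
  have hlt := D.lt_of_E huv
  have hkk : repaired D C a b k (k + 1) = C (k + 1) :=
    repaired_of_neg fun h' => by have := h'.1; omega
  by_cases c0 : s.arr 15 (k + 1) = 0
  · have hsem : (sem fixBody s).arr 23 = s.arr 23 := by
      simp [fixBody, h21, h.r4, h.r5, c0]
    intro e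
    rw [hsem, hcol]
    by_cases he : e = k + 1
    · subst he
      rw [hkk, repaired_of_not_alt]
      rw [← hu, ← hv]
      rintro ⟨x, y, hc, -⟩
      exact hp' _ _ _ _ hc (by rw [hA]; exact c0)
    · rw [repaired_succ_of_ne he]
  · obtain ⟨u', v', x, y, hc, e1, e2⟩ := hp _ c0
    obtain rfl : u = u' := by rw [hu, e1, D.eu_A _ _ hc.1]
    obtain rfl : v = v' := by rw [hv, e1, D.ev_A _ _ hc.1]
    have hxy := D.lt_of_E hc.2.1
    have hxm := Inst.A_mem hc.2.1
    have a1 := h.a4 u b hlt.1 hb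
    have a2 := h.a4 a v ha hlt.2
    have a3 := h.a4 x b hxy.1 hb
    have a4 := h.a4 a y ha hxy.2
    have a5 := h.a5 (k + 1) (by omega) (by omega)
    have a6 := h.a6 (k + 1) (by omega) (by omega)
    have a5' := h.a5 (D.A x y) hxm.1 hxm.2
    have a6' := h.a6 (D.A x y) hxm.1 hxm.2
    rw [← hu] at a5
    rw [← hv] at a6
    rw [D.eu_A _ _ hc.2.1] at a5'
    rw [D.ev_A _ _ hc.2.1] at a6'
    obtain ⟨t, ht⟩ : ∃ t, t = sem fixLoad (sem (block [add 24 21 4, load 25 15 24]) s) := ⟨_, rfl⟩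
    have hsem : sem fixBody s = sem fixStore t := by
      rw [ht]
      simp [fixBody, h21, h.r4, h.r5, c0]
    have t5 : t.reg 5 = 0 := by
      rw [ht, sem_reg_of_notMem _ _ (by decide), sem_reg_of_notMem _ _ (by decide), h.r5]
    have t24 : t.reg 24 = k + 1 := by
      rw [ht, sem_reg_of_notMem _ _ (by decide)]
      simp [h21, h.r4]
    have t30 : t.reg 30 = D.A u b := by
      rw [ht]; simp [fixLoad, sem_getA, h21, h.r4, a5, h23, h.r11, a1]
    have t31 : t.reg 31 = D.A a v := by
      rw [ht]; simp [fixLoad, sem_getA, h21, h.r4, a6, h22, h.r11, a2]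
    have t32 : t.reg 32 = D.A x b := by
      rw [ht]; simp [fixLoad, sem_getA, h21, h.r4, e2, a5', h23, h.r11, a3]
    have t33 : t.reg 33 = D.A a y := by
      rw [ht]; simp [fixLoad, sem_getA, h21, h.r4, e2, a6', h22, h.r11, a4]
    have t23 : t.arr 23 = s.arr 23 := by
      rw [ht, sem_arr_of_notMem _ _ (by decide), sem_arr_of_notMem _ _ (by decide)]
    have hiff := alt_iff_of_conf hS.toIsColoring (a := a) (b := b) hc
    have hval := fixStore_arr t5
    rw [t30, t31, t32, t33, t24, t23] at hval
    intro e
    rw [hsem, hval]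
    by_cases he : e = k + 1
    · subst he
      have hpos : Alt D.E (fun u v => C (D.A u v) = 1) u v a b →
          repaired D C a b (k + 1) (k + 1) = 1 - C (k + 1) := fun hA' =>
        repaired_of_pos ⟨⟨by omega, le_rfl⟩, by rwa [← hu, ← hv]⟩
      have hneg : ¬ Alt D.E (fun u v => C (D.A u v) = 1) u v a b →
          repaired D C a b (k + 1) (k + 1) = C (k + 1) := fun hA' =>
        repaired_of_not_alt (by rwa [← hu, ← hv])
      by_cases hall : D.E u b ∧ D.E a v ∧ D.E x b ∧ D.E a y
      · obtain ⟨c1, c2, c3, c4⟩ := hall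
        have r1 := repaired_col (C := C) (k := k) (a := a) c1 hz
        have r2 := repaired_row (C := C) (k := k) (b := b) c2 hz
        have l1 := hC (D.A u b)
        have l2 := hC (D.A a v)
        have l3 := hC (k + 1)
        rw [hA] at hiff
        rw [hcol, hcol, hcol, r1, r2, hkk]
        by_cases hAlt : Alt D.E (fun u v => C (D.A u v) = 1) u v a b
        · obtain ⟨-, -, -, -, -, f1, f2⟩ := hiff.1 hAlt
          rw [hpos hAlt, if_pos ⟨c1, c2, c3, c4, by omega, rfl⟩]
          omega
        · rw [hneg hAlt]
          -- If the comparison succeeds although there is no alternating cycle, then uv has the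
          -- common colour already and the store has no effect.
          by_cases f1 : C (D.A u b) = C (D.A a v)
          · rw [if_pos ⟨c1, c2, c3, c4, f1, rfl⟩]
            by_contra f2
            exact hAlt (hiff.2 ⟨hz, c1, c2, c3, c4, by rw [f1], by omega⟩)
          · rw [if_neg fun h' => f1 h'.2.2.2.2.1]
      · rw [if_neg fun h' => hall ⟨h'.1, h'.2.1, h'.2.2.1, h'.2.2.2.1⟩, hcol, hkk, hneg]
        rw [hiff]
        tauto
    · rw [if_neg fun h' => he h'.2.2.2.2.2, hcol, repaired_succ_of_ne he]

theorem fixRow_spec {D : Graph} {s : State} (h : Coloured D s) {a b : ℕ}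
    (ha : a < D.p) (hb : b < D.q) (hz : ¬ D.E a b) (h22 : s.reg 22 = a) (h23 : s.reg 23 = b) :
    ∀ e, (sem (loop 21 12 fixBody) s).arr 23 e = repaired D (s.arr 23) a b D.m e := by
  have := sem_loop_inv (i := 21) (n := 12) (c := fixBody) (s := s)
    (fun k st => ∀ e, st.arr 23 e = repaired D (s.arr 23) a b k e) ?_ ?_
  · rwa [h.base.r12] at this
  · intro e
    exact (repaired_of_neg fun h' => by have := h'.1; omega).symm
  · intro k st hk hi hr har ih
    rw [h.base.r12] at hk
    have hbs : Base D st := h.base.congr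
      (fun r h' => hr r (by revert r; decide) (by revert r; decide))
      fun a h' => har a (by revert a; decide)
    have h15 : st.arr 15 = s.arr 15 := har 15 (by decide)
    exact fixBody_spec hbs (by unfold ParState; rw [h15]; exact h.par)
      (by rw [h15]; exact h.par_ne) h.le_one h.tight ha hb hz hi hk
      (by rw [hr 22 (by decide) (by decide), h22]) (by rw [hr 23 (by decide) (by decide), h23]) ih

theorem Coloured.repair {D : Graph} {s t : State} (h : Coloured D s) {a b : ℕ} (hb : Base D t)
    (h15 : t.arr 15 = s.arr 15) (h23 : ∀ e, t.arr 23 e = repaired D (s.arr 23) a b D.m e) :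
    Coloured D t ∧ t.col D.toInst = flip D.E (s.col D.toInst) a b := by
  have hcol : t.col D.toInst = flip D.E (s.col D.toInst) a b := by
    funext u v
    apply propext
    unfold State.col TwoChain.flip
    rw [h23]
    by_cases huv : D.E u v
    · have hm := Inst.A_mem huv
      have hl := h.le_one (D.A u v)
      have hrep : Repairs D (s.arr 23) a b D.m (D.A u v) ↔
          Alt D.E (fun u v => s.arr 23 (D.A u v) = 1) u v a b := by
        unfold Repairs
        rw [D.eu_A u v huv, D.ev_A u v huv]
        exact and_iff_right hm
      by_cases hA : Alt D.E (fun u v => s.arr 23 (D.A u v) = 1) u v a b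
      · rw [repaired_of_pos (hrep.2 hA)]
        simp only [hA, not_true, and_false, false_or, and_true]
        omega
      · rw [repaired_of_neg fun h' => hA (hrep.1 h')]
        simp [hA]
    · have h0 : D.A u v = 0 := not_not.1 huv
      have hA : ¬ Alt D.E (fun u v => s.arr 23 (D.A u v) = 1) u v a b := by
        rintro ⟨x, y, hc, -⟩
        exact huv hc.1
      have : repaired D (s.arr 23) a b D.m 0 = s.arr 23 0 :=
        repaired_of_neg fun h' => by have := h'.1; omega
      rw [h0, this]
      simp only [hA, h0, and_false, or_false, not_false_eq_true, and_true]
  refine ⟨⟨hb, ?_, ?_, ?_, ?_, ?_⟩, hcol⟩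
  · unfold ParState; rw [h15]; exact h.par
  · rw [h15]; exact h.par_ne
  · intro e
    rw [h23]
    exact repaired_le_one (h.le_one e)
  · rw [h23]
    exact (repaired_of_neg fun h' => by have := h'.1; omega).trans h.zero
  · rw [hcol]
    exact h.tight.flip a b

theorem Coloured.setReg {D : Graph} {s : State} (h : Coloured D s) {r v : ℕ}
    (hr : r ∉ [4, 5, 10, 11, 12, 13, 14, 18]) : Coloured D (s.setReg r v) :=
  ⟨h.base.setReg hr, h.par, h.par_ne, h.le_one, h.zero, h.tight⟩

/-- The invariant says that no alternating six-cycle is opposite to a nonedge treated before. Every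
such cycle is opposite to a listed nonedge, so none is left at the end. -/
theorem cmdFix_spec {D : Graph} {s : State} (h : Coloured D s) :
    Coloured D (sem cmdFix s) ∧
      ∀ u v a b, ¬ Alt D.E ((sem cmdFix s).col D.toInst) u v a b := by
  have := sem_loop_inv (i := 20) (n := 14)
    (c := block [load 22 7 20, load 23 8 20, loop 21 12 fixBody]) (s := s)
    (fun k st => Coloured D st ∧
      ∀ l < k, ∀ u v, ¬ Alt D.E (st.col D.toInst) u v (D.zu l) (D.zv l)) ?_ ?_
  · rw [h.base.r14] at this
    refine ⟨this.1, fun u v a b => ?_⟩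
    rintro ⟨x, y, hA⟩
    obtain ⟨l, hl, rfl, rfl⟩ := D.zero_mem a b (D.lt_of_E hA.2.2.2.1).1 (D.lt_of_E hA.2.2.1).2
      (not_not.1 hA.2.1)
    exact this.2 l hl u v ⟨x, y, hA⟩
  · exact ⟨h.setReg (by decide), fun l hl => by omega⟩
  · rintro k st hk hi - - ⟨i1, i2⟩
    rw [h.base.r14] at hk
    obtain ⟨t, ht⟩ : ∃ t, t = sem (block [load 22 7 20, load 23 8 20]) st := ⟨_, rfl⟩
    have hsem : sem (block [load 22 7 20, load 23 8 20, loop 21 12 fixBody]) st =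
        sem (loop 21 12 fixBody) t := by rw [ht]; rfl
    have hta : t.arr = st.arr := by rw [ht]; rfl
    have hct : Coloured D t := by
      have hb : Base D t := by rw [ht]; exact i1.base.sem _ (by decide) (by decide)
      refine ⟨hb, ?_, ?_, ?_, ?_, ?_⟩
      · unfold ParState; rw [hta]; exact i1.par
      · rw [hta]; exact i1.par_ne
      · rw [hta]; exact i1.le_one
      · rw [hta]; exact i1.zero
      · unfold State.col; rw [hta]; exact i1.tight
    have htc : t.col D.toInst = st.col D.toInst := by unfold State.col; rw [hta]
    have hz : ¬ D.E (D.zu k) (D.zv k) := not_not.2 (D.A_zero k hk)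
    have a7 := i1.base.a7 k hk
    have a8 := i1.base.a8 k hk
    have hrow := fixRow_spec hct (D.zu_lt k hk) (D.zv_lt k hk) hz
      (by rw [ht]; simp [hi, a7]) (by rw [ht]; simp [hi, a8])
    rw [hsem]
    obtain ⟨u, hu⟩ : ∃ u, u = sem (loop 21 12 fixBody) t := ⟨_, rfl⟩
    rw [← hu] at hrow ⊢
    obtain ⟨g1, g2⟩ := hct.repair (by rw [hu]; exact hct.base.sem _ (by decide) (by decide))
      (by rw [hu]; exact sem_arr_of_notMem _ _ (by decide)) hrow
    refine ⟨g1.setReg (by decide), fun l hl => ?_⟩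
    have he : (u.setReg 20 (k + 1)).col D.toInst = u.col D.toInst := rfl
    rw [he, g2]
    by_cases e : l = k
    · subst e
      exact fun u v => not_alt_flip hz
    · refine not_alt_flip_of_not_alt hct.tight ?_
      rw [htc]
      exact i2 l (by omega)

/-! ### The conflict-free edges added to the first graph. -/

/-- The edge `e` lies in no induced `2K₂` and is forced into the first graph. -/
def Witnessed (D : Graph) (s : State) (e : ℕ) : Prop :=
  (1 ≤ e ∧ e ≤ D.m) ∧ s.arr 15 e = 0 ∧
    ∃ l < D.mh, s.col D.toInst (D.eu e) (D.zv l) ∧ s.col D.toInst (D.zu l) (D.ev e)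

theorem witBody_spec {D : Graph} {s : State} (h : Base D s) {e : ℕ} (he : 1 ≤ e) (he' : e ≤ D.m)
    (h24 : s.reg 24 = e) (h26 : s.reg 26 = D.eu e) (h27 : s.reg 27 = D.ev e) {l : ℕ}
    (h21 : s.reg 21 = l) (hl : l < D.mh) :
    ∀ x, (sem witBody s).arr 24 x = open Classical in
      if x = e ∧ s.col D.toInst (D.eu e) (D.zv l) ∧ s.col D.toInst (D.zu l) (D.ev e) then 1
      else s.arr 24 x := by
  have a7 := h.a7 l hl
  have a8 := h.a8 l hl
  have a1 := h.a4 _ _ (D.eu_lt e he he') (D.zv_lt l hl)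
  have a2 := h.a4 _ _ (D.zu_lt l hl) (D.ev_lt e he he')
  intro x
  unfold State.col
  by_cases c1 : s.arr 23 (D.A (D.eu e) (D.zv l)) = 1
  · by_cases c2 : s.arr 23 (D.A (D.zu l) (D.ev e)) = 1
    · simp [witBody, sem_getA, h21, a7, a8, h26, h27, h.r11, a1, a2, h.r4, c1, c2, h24,
        Function.update_apply]
    · simp [witBody, sem_getA, h21, a7, a8, h26, h27, h.r11, a1, a2, h.r4, c1, c2]
  · simp [witBody, sem_getA, h21, a7, a8, h26, h27, h.r11, a1, a2, h.r4, c1]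

theorem cmdWit_spec {D : Graph} {s : State} (h : Base D s) (h24 : ∀ e, s.arr 24 e = 0) :
    ∀ e, (sem cmdWit s).arr 24 e ≠ 0 ↔ Witnessed D s e := by
  let P : State → Prop := fun st => Base D st ∧ st.arr 23 = s.arr 23 ∧ st.arr 15 = s.arr 15 ∧
    ∀ e, st.arr 24 e ≠ 0 → Witnessed D s e
  let R : State → State → Prop := fun st st' => ∀ e, st.arr 24 e ≠ 0 → st'.arr 24 e ≠ 0
  have hfin := sem_loop_mono (i := 20) (n := 12) (N := D.m) (c := block [add 24 20 4,
      load 25 15 24, ite (.eq 25 5) (block [load 26 5 24, load 27 6 24, loop 21 14 witBody]) skip])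
    P R (fun k st => Witnessed D s (k + 1) → st.arr 24 (k + 1) ≠ 0)
    (fun st v hs => ⟨hs.1.setReg (by decide), hs.2⟩) (fun st v e he => he)
    (fun h1 h2 e he => h2 e (h1 e he)) (fun hg hq hw => hg _ (hq hw)) ?_ (s := s)
    ⟨h, rfl, rfl, fun e he => absurd (h24 e) he⟩ h.r12
  · intro e
    refine ⟨hfin.1.2.2.2 e, fun hw => ?_⟩
    have := hfin.2.2 (e - 1) (by have := hw.1; omega)
    rw [Nat.sub_add_cancel hw.1.1] at this
    exact this hw
  · rintro st ⟨b1, b2, b3, b4⟩ hlt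
    obtain ⟨k, hk⟩ : ∃ k, k = st.reg 20 := ⟨_, rfl⟩
    rw [← hk] at hlt ⊢
    have a5 := b1.a5 (k + 1) (by omega) (by omega)
    have a6 := b1.a6 (k + 1) (by omega) (by omega)
    by_cases c0 : st.arr 15 (k + 1) = 0
    · obtain ⟨t, ht⟩ : ∃ t, t = sem (block [add 24 20 4, load 25 15 24, load 26 5 24,
        load 27 6 24]) st := ⟨_, rfl⟩
      have hsem : sem (block [add 24 20 4, load 25 15 24, ite (.eq 25 5)
          (block [load 26 5 24, load 27 6 24, loop 21 14 witBody]) skip]) st =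
          sem (loop 21 14 witBody) t := by
        rw [ht]
        simp [← hk, b1.r4, b1.r5, c0]
      rw [hsem]
      have hta : t.arr = st.arr := by rw [ht]; rfl
      have hbt : Base D t := by rw [ht]; exact b1.sem _ (by decide) (by decide)
      have t24 : t.reg 24 = k + 1 := by rw [ht]; simp [← hk, b1.r4]
      have t26 : t.reg 26 = D.eu (k + 1) := by rw [ht]; simp [← hk, b1.r4, a5]
      have t27 : t.reg 27 = D.ev (k + 1) := by rw [ht]; simp [← hk, b1.r4, a6]
      have hin := sem_loop_mono (i := 21) (n := 14) (N := D.mh) (c := witBody)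
        (fun st => P st ∧ st.reg 24 = k + 1 ∧ st.reg 26 = D.eu (k + 1) ∧
          st.reg 27 = D.ev (k + 1)) R
        (fun l st => s.col D.toInst (D.eu (k + 1)) (D.zv l) →
          s.col D.toInst (D.zu l) (D.ev (k + 1)) → st.arr 24 (k + 1) ≠ 0)
        (fun st v hs => ⟨⟨hs.1.1.setReg (by decide), hs.1.2⟩, by simp [hs.2.1], by simp [hs.2.2.1],
          by simp [hs.2.2.2]⟩) (fun st v e he => he)
        (fun h1 h2 e he => h2 e (h1 e he)) (fun hg hq h1 h2 => hg _ (hq h1 h2)) ?_ (s := t)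
        ⟨⟨hbt, by rw [hta, b2], by rw [hta, b3], by rw [hta]; exact b4⟩, t24, t26, t27⟩ hbt.r14
      · refine ⟨hin.1.1, fun e he => hin.2.1 e (by rw [hta]; exact he), ?_⟩
        rintro ⟨-, -, l, hl, h1, h2⟩
        exact hin.2.2 l hl h1 h2
      · rintro v ⟨⟨v1, v2, v3, v4⟩, v5, v6, v7⟩ hl
        have hw := witBody_spec v1 (e := k + 1) (by omega) (by omega) v5 v6 v7 rfl hl
        have hcol : v.col D.toInst = s.col D.toInst := by unfold State.col; rw [v2]
        rw [hcol] at hw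
        refine ⟨⟨⟨v1.sem _ (by decide) (by decide), ?_, ?_, fun e he => ?_⟩, ?_, ?_, ?_⟩,
          fun e he => ?_, fun h1 h2 => ?_⟩
        · rw [sem_arr_of_notMem _ _ (by decide), v2]
        · rw [sem_arr_of_notMem _ _ (by decide), v3]
        · rw [hw] at he
          split_ifs at he with h1
          · obtain ⟨rfl, h1, h2⟩ := h1
            exact ⟨⟨by omega, by omega⟩, by rw [← b3]; exact c0, _, hl, h1, h2⟩
          · exact v4 e he
        · rw [sem_reg_of_notMem _ _ (by decide), v5]
        · rw [sem_reg_of_notMem _ _ (by decide), v6]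
        · rw [sem_reg_of_notMem _ _ (by decide), v7]
        · rw [hw]
          split_ifs
          · exact one_ne_zero
          · exact he
        · rw [hw, if_pos ⟨rfl, h1, h2⟩]
          exact one_ne_zero
    · have hsem : sem (block [add 24 20 4, load 25 15 24, ite (.eq 25 5)
          (block [load 26 5 24, load 27 6 24, loop 21 14 witBody]) skip]) st =
          sem (block [add 24 20 4, load 25 15 24]) st := by
        simp [← hk, b1.r4, b1.r5, c0]
      rw [hsem]
      exact ⟨⟨b1.sem _ (by decide) (by decide), b2, b3, b4⟩, fun e he => he,
        fun hw => absurd hw.2.1 (by rw [← b3]; exact c0)⟩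

/-! ### Writing the two edge lists. -/

/-- Register `r` and arrays `a`, `b` hold the edges with the numbers in `J`. -/
def HoldsEdges (D : Inst) (J : List ℕ) (r a b : ℕ) (s : State) : Prop :=
  s.reg r = J.length ∧ ∀ i (h : i < J.length), s.arr a i = D.eu J[i] ∧ s.arr b i = D.ev J[i]

theorem HoldsEdges.push {D : Inst} {J : List ℕ} {r a b e : ℕ} {s : State}
    (h : HoldsEdges D J r a b s) (hab : a ≠ b) (h4 : s.reg 4 = 1) (h26 : s.reg 26 = D.eu e)
    (h27 : s.reg 27 = D.ev e) : HoldsEdges D (J ++ [e]) r a b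
      (sem (block [store a r 26, store b r 27, add r r 4]) s) := by
  obtain ⟨h1, h2⟩ := h
  refine ⟨by simp [h4, h1], fun i hi => ?_⟩
  simp only [List.length_append, List.length_singleton] at hi
  simp [hab, hab.symm, h26, h27, h1, Function.update_apply]
  by_cases e1 : i = J.length
  · subst e1
    simp
  · have hi' : i < J.length := by omega
    simp [e1, List.getElem_append_left hi', h2 i hi']

theorem HoldsEdges.congr {D : Inst} {J : List ℕ} {r a b : ℕ} {s s' : State}
    (h : HoldsEdges D J r a b s) (hr : s'.reg r = s.reg r) (ha : s'.arr a = s.arr a)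
    (hb : s'.arr b = s.arr b) : HoldsEdges D J r a b s' := by
  unfold HoldsEdges
  rw [hr, ha, hb]
  exact h

/-- The list `J` consists of the numbers between `1` and `k` that satisfy `Q`. -/
def Lists (J : List ℕ) (k : ℕ) (Q : ℕ → Prop) : Prop :=
  J.Nodup ∧ ∀ e, e ∈ J ↔ (1 ≤ e ∧ e ≤ k) ∧ Q e

theorem Lists.push {J : List ℕ} {k : ℕ} {Q : ℕ → Prop} (h : Lists J k Q) (hQ : Q (k + 1)) :
    Lists (J ++ [k + 1]) (k + 1) Q := by
  refine ⟨?_, fun e => ?_⟩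
  · rw [List.nodup_append]
    refine ⟨h.1, List.nodup_singleton _, fun a ha b hb => ?_⟩
    rw [List.mem_singleton] at hb
    have := ((h.2 a).1 ha).1
    omega
  · rw [List.mem_append, h.2, List.mem_singleton]
    by_cases e1 : e = k + 1
    · subst e1; simp [hQ]
    · have : (1 ≤ e ∧ e ≤ k) ↔ (1 ≤ e ∧ e ≤ k + 1) := by omega
      rw [this]
      simp [e1]

theorem Lists.skip {J : List ℕ} {k : ℕ} {Q : ℕ → Prop} (h : Lists J k Q) (hQ : ¬ Q (k + 1)) :
    Lists J (k + 1) Q := by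
  refine ⟨h.1, fun e => ?_⟩
  rw [h.2]
  refine and_congr_left fun h' => ?_
  have : e ≠ k + 1 := by rintro rfl; exact hQ h'
  omega

theorem cmdOut_spec {D : Graph} {s : State} (h : Base D s) :
    (sem cmdOut s).reg 0 = 1 ∧ ∃ J₁ J₂ : List ℕ,
      Lists J₁ D.m (fun e => s.arr 23 e ≠ 0 ∨ s.arr 24 e ≠ 0) ∧
      Lists J₂ D.m (fun e => s.arr 23 e = 0) ∧
      HoldsEdges D.toInst J₁ 1 0 1 (sem cmdOut s) ∧ HoldsEdges D.toInst J₂ 2 2 3 (sem cmdOut s) := by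
  obtain ⟨t, ht⟩ : ∃ t, t = sem (block [lit 1 0, lit 2 0, lit 0 1]) s := ⟨_, rfl⟩
  have hsem : sem cmdOut s = sem (loop 20 12 outBody) t := by rw [ht]; rfl
  have hta : t.arr = s.arr := by rw [ht]; rfl
  have r4 : t.reg 4 = 1 := by rw [ht, sem_reg_of_notMem _ _ (by decide), h.r4]
  have r5 : t.reg 5 = 0 := by rw [ht, sem_reg_of_notMem _ _ (by decide), h.r5]
  have r12 : t.reg 12 = D.m := by rw [ht, sem_reg_of_notMem _ _ (by decide), h.r12]
  rw [hsem]
  refine ⟨by rw [sem_reg_of_notMem _ _ (by decide), ht]; simp, ?_⟩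
  have := sem_loop_inv (i := 20) (n := 12) (c := outBody) (s := t)
    (fun k st => ∃ J₁ J₂ : List ℕ,
      Lists J₁ k (fun e => s.arr 23 e ≠ 0 ∨ s.arr 24 e ≠ 0) ∧
      Lists J₂ k (fun e => s.arr 23 e = 0) ∧
      HoldsEdges D.toInst J₁ 1 0 1 st ∧ HoldsEdges D.toInst J₂ 2 2 3 st) ?_ ?_
  · rwa [r12] at this
  · refine ⟨[], [], ⟨List.nodup_nil, fun e => ?_⟩, ⟨List.nodup_nil, fun e => ?_⟩,
      ⟨by rw [ht]; simp, fun i hi => absurd hi (Nat.not_lt_zero _)⟩,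
      ⟨by rw [ht]; simp, fun i hi => absurd hi (Nat.not_lt_zero _)⟩⟩ <;>
    exact iff_of_false List.not_mem_nil fun h' => by omega
  · rintro k st hk hi hr ha ⟨J₁, J₂, j1, j2, j3, j4⟩
    rw [r12] at hk
    obtain ⟨w, hw⟩ : ∃ w, w = sem (block [add 24 20 4, load 26 5 24, load 27 6 24, load 25 23 24,
      load 28 24 24]) st := ⟨_, rfl⟩
    have s4 : st.reg 4 = 1 := by rw [hr 4 (by decide) (by decide), r4]
    have s5 : st.reg 5 = 0 := by rw [hr 5 (by decide) (by decide), r5]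
    have a5 : st.arr 5 (k + 1) = D.eu (k + 1) := by
      rw [ha 5 (by decide), hta, h.a5 _ (by omega) (by omega)]
    have a6 : st.arr 6 (k + 1) = D.ev (k + 1) := by
      rw [ha 6 (by decide), hta, h.a6 _ (by omega) (by omega)]
    have a23 : st.arr 23 = s.arr 23 := by rw [ha 23 (by decide), hta]
    have a24 : st.arr 24 = s.arr 24 := by rw [ha 24 (by decide), hta]
    have w4 : w.reg 4 = 1 := by rw [hw, sem_reg_of_notMem _ _ (by decide), s4]
    have w5 : w.reg 5 = 0 := by rw [hw, sem_reg_of_notMem _ _ (by decide), s5]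
    have w26 : w.reg 26 = D.eu (k + 1) := by rw [hw]; simp [hi, s4, a5]
    have w27 : w.reg 27 = D.ev (k + 1) := by rw [hw]; simp [hi, s4, a6]
    have w25 : w.reg 25 = s.arr 23 (k + 1) := by rw [hw]; simp [hi, s4, a23]
    have w28 : w.reg 28 = s.arr 24 (k + 1) := by rw [hw]; simp [hi, s4, a24]
    have hwa : w.arr = st.arr := by rw [hw]; rfl
    have wj1 : HoldsEdges D.toInst J₁ 1 0 1 w := j3.congr
      (by rw [hw, sem_reg_of_notMem _ _ (by decide)]) (by rw [hwa]) (by rw [hwa])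
    have wj2 : HoldsEdges D.toInst J₂ 2 2 3 w := j4.congr
      (by rw [hw, sem_reg_of_notMem _ _ (by decide)]) (by rw [hwa]) (by rw [hwa])
    have hs : sem outBody st = if s.arr 23 (k + 1) = 0 then
        if s.arr 24 (k + 1) = 0 then sem outRight w else sem outLeft (sem outRight w)
        else sem outLeft w := by
      have : sem outBody st = sem (ite (.eq 25 5) (block [outRight, ite (.ne 28 5) outLeft skip])
        outLeft) w := by rw [hw]; rfl
      rw [this]
      simp only [sem_ite_eq, sem_ite_ne, w25, w5, sem_block_cons, sem_block_nil]
      rw [sem_reg_of_notMem outRight w (r := 28) (by decide),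
        sem_reg_of_notMem outRight w (r := 5) (by decide), w28, w5]
      rfl
    have fr : ∀ {J r a b u}, HoldsEdges D.toInst J r a b u → r ≠ 20 →
        HoldsEdges D.toInst J r a b (u.setReg 20 (k + 1)) :=
      fun hu hr => hu.congr (by simp [hr]) rfl rfl
    by_cases c1 : s.arr 23 (k + 1) = 0
    · have p2 := wj2.push (e := k + 1) (by decide) w4 w26 w27
      have q1 : HoldsEdges D.toInst J₁ 1 0 1 (sem outRight w) := wj1.congr
        (sem_reg_of_notMem _ _ (by decide)) (sem_arr_of_notMem _ _ (by decide))
        (sem_arr_of_notMem _ _ (by decide))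
      by_cases c2 : s.arr 24 (k + 1) = 0
      · rw [hs, if_pos c1, if_pos c2]
        exact ⟨J₁, J₂ ++ [k + 1], j1.skip (by tauto), j2.push c1, fr q1 (by decide),
          fr p2 (by decide)⟩
      · rw [hs, if_pos c1, if_neg c2]
        have p1 := q1.push (e := k + 1) (by decide)
          (by rw [sem_reg_of_notMem _ _ (by decide), w4])
          (by rw [sem_reg_of_notMem _ _ (by decide), w26])
          (by rw [sem_reg_of_notMem _ _ (by decide), w27])
        refine ⟨J₁ ++ [k + 1], J₂ ++ [k + 1], j1.push (Or.inr c2), j2.push c1, fr p1 (by decide),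
          fr (p2.congr ?_ ?_ ?_) (by decide)⟩
        · exact sem_reg_of_notMem outLeft _ (by decide)
        · exact sem_arr_of_notMem outLeft _ (by decide)
        · exact sem_arr_of_notMem outLeft _ (by decide)
    · rw [hs, if_neg c1]
      have p1 := wj1.push (e := k + 1) (by decide) w4 w26 w27
      refine ⟨J₁ ++ [k + 1], J₂, j1.push (Or.inl c1), j2.skip c1, fr p1 (by decide),
        fr (wj2.congr ?_ ?_ ?_) (by decide)⟩
      · exact sem_reg_of_notMem outLeft _ (by decide)
      · exact sem_arr_of_notMem outLeft _ (by decide)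
      · exact sem_arr_of_notMem outLeft _ (by decide)

end TwoChain

namespace TwoChain

open Cmd Instr

/-! ### Correctness of the main part -/

/-- Add the list of nonedges to an instance. -/
def Inst.withZeros (D : Inst) (Z : List (ℕ × ℕ))
    (hZ : ∀ z, z ∈ Z ↔ z.1 < D.p ∧ z.2 < D.q ∧ D.A z.1 z.2 = 0) : Graph where
  toInst := D
  mh := Z.length
  zu k := (Z.getD k (0, 0)).1
  zv k := (Z.getD k (0, 0)).2
  zu_lt k hk := by
    rw [List.getD_eq_getElem _ _ hk]
    exact ((hZ _).1 (List.getElem_mem hk)).1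
  zv_lt k hk := by
    rw [List.getD_eq_getElem _ _ hk]
    exact ((hZ _).1 (List.getElem_mem hk)).2.1
  A_zero k hk := by
    rw [List.getD_eq_getElem _ _ hk]
    exact ((hZ _).1 (List.getElem_mem hk)).2.2
  zero_mem u v hu hv h := by
    obtain ⟨k, hk, he⟩ := List.getElem_of_mem ((hZ (u, v)).2 ⟨hu, hv, h⟩)
    refine ⟨k, hk, ?_⟩
    rw [List.getD_eq_getElem _ _ hk, he]
    exact ⟨rfl, rfl⟩

/-- The number of nonedges. -/
def Inst.zeros (D : Inst) : ℕ :=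
  ((Finset.range D.p ×ˢ Finset.range D.q).filter fun z => D.A z.1 z.2 = 0).card

theorem exists_graph {D : Inst} {s : State} (h : Indexed D s) :
    ∃ G : Graph, G.toInst = D ∧ Base G (sem cmdZeros s) ∧ G.mh = D.zeros := by
  obtain ⟨h1, Z, z1, z2, z3, z4⟩ := cmdZeros_spec h
  refine ⟨D.withZeros Z z2, rfl, ⟨h1, z3, ?_, ?_⟩, ?_⟩
  · intro k hk
    rw [(z4 k hk).1]
    show _ = (Z.getD k (0, 0)).1
    rw [List.getD_eq_getElem _ _ hk]
  · intro k hk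
    rw [(z4 k hk).2]
    show _ = (Z.getD k (0, 0)).2
    rw [List.getD_eq_getElem _ _ hk]
  · show Z.length = _
    rw [← List.toFinset_card_of_nodup z1, Inst.zeros]
    congr 1
    ext z
    simp only [List.mem_toFinset, z2, Finset.mem_filter, Finset.mem_product, Finset.mem_range]
    tauto

/-- The state before the main part. -/
structure Ready (D : Inst) (s : State) : Prop extends Loaded D s where
  a0 : ∀ k < D.m, s.arr 0 k = D.eu (k + 1)
  a1 : ∀ k < D.m, s.arr 1 k = D.ev (k + 1)
  arr_zero : ∀ a, 4 ≤ a → ∀ i, s.arr a i = 0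
  r16 : s.reg 16 = 0

theorem building_init {D : Graph} {s : State} (h : Base D s) (h16 : s.reg 16 = 0)
    (h12 : ∀ i, s.arr 12 i = 0) (h15 : ∀ i, s.arr 15 i = 0) : Building D s := by
  refine ⟨h, ⟨⟨⟨2 * D.m, 0, s.arr 11, s.arr 14, s.arr 13, s.arr 12, ?_, ?_, ?_, ?_, ?_, ?_, ?_, ?_⟩,
    ⟨rfl, h16, rfl, rfl, rfl, rfl⟩⟩, ?_⟩, fun e he => absurd (h15 e) he⟩
  · intro k _ _; omega
  · intro k _ _; omega
  · intro k _ _; omega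
  · intro k _ _; omega
  · intro k _ _; omega
  · intro x; rw [h12]
  · intro x; exact Or.inl (h12 x)
  · intro x j _ _; omega
  · rintro x y ⟨k, k1, k2, -⟩
    omega

/-- The commands that build the arcs. -/
def cmdBuild : Cmd := block [cmdEdges, cmdZeros, cmdShorter, cmdPairs, cmdRestricted]

theorem cmdBuild_spec {D : Inst} {s : State} (h : Ready D s) :
    ∃ G : Graph, G.toInst = D ∧ G.mh = D.zeros ∧ Building G (sem cmdBuild s) ∧
      ArcsComplete D (sem cmdBuild s) ∧
      (∀ u v x y, Conf D.E u v x y → (sem cmdBuild s).arr 15 (D.A u v) ≠ 0) ∧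
      ∀ a, 18 ≤ a → ∀ i, (sem cmdBuild s).arr a i = 0 := by
  obtain ⟨s1, hs1⟩ : ∃ s1, s1 = sem cmdEdges s := ⟨_, rfl⟩
  obtain ⟨s2, hs2⟩ : ∃ s2, s2 = sem cmdZeros s1 := ⟨_, rfl⟩
  obtain ⟨s3, hs3⟩ : ∃ s3, s3 = sem cmdShorter s2 := ⟨_, rfl⟩
  obtain ⟨s4, hs4⟩ : ∃ s4, s4 = sem cmdPairs s3 := ⟨_, rfl⟩
  obtain ⟨s5, hs5⟩ : ∃ s5, s5 = sem cmdRestricted s4 := ⟨_, rfl⟩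
  have hsem : sem cmdBuild s = s5 := by rw [hs5, hs4, hs3, hs2, hs1]; rfl
  rw [hsem]
  have i1 := cmdEdges_spec h.toLoaded h.a0 h.a1 (h.arr_zero 4 le_rfl)
  rw [← hs1] at i1
  obtain ⟨G, rfl, b2, hmh⟩ := exists_graph i1
  rw [← hs2] at b2
  have f2 : ∀ a ∉ cmdEdges.arrWrites ++ cmdZeros.arrWrites, s2.arr a = s.arr a := by
    intro a ha
    rw [List.mem_append, not_or] at ha
    rw [hs2, hs1, sem_arr_of_notMem _ _ ha.2, sem_arr_of_notMem _ _ ha.1]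
  obtain ⟨b3, r3, l3⟩ := cmdShorter_spec b2
    (by rw [f2 0 (by decide)]; exact h.a0) (by rw [f2 1 (by decide)]; exact h.a1)
  rw [← hs3] at b3 r3 l3
  have f3 : ∀ a ∉ cmdEdges.arrWrites ++ cmdZeros.arrWrites ++ cmdShorter.arrWrites,
      s3.arr a = s.arr a := by
    intro a ha
    rw [List.mem_append, not_or] at ha
    rw [hs3, sem_arr_of_notMem _ _ ha.2, f2 a ha.1]
  have g3 : Building G s3 := building_init b3
    (by rw [hs3, hs2, hs1, sem_reg_of_notMem _ _ (by decide), sem_reg_of_notMem _ _ (by decide),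
      sem_reg_of_notMem _ _ (by decide), h.r16])
    (by rw [f3 12 (by decide)]; exact h.arr_zero 12 (by decide))
    (by rw [f3 15 (by decide)]; exact h.arr_zero 15 (by decide))
  obtain ⟨g4, c4⟩ := cmdPairs_spec g3 l3 r3
  rw [← hs4] at g4 c4
  obtain ⟨g5, w5, c5⟩ := cmdRestricted_spec g4
  rw [← hs5] at g5 w5 c5
  have c5' : ∀ u v x y, Conf G.E u v x y → Recorded G.toInst u v x y s5 :=
    fun u v x y hc => (c4 u v x y hc).mono w5
  refine ⟨G, rfl, hmh, g5, arcsComplete_of c5' c5, fun u v x y hc => (c5' u v x y hc).2.2, ?_⟩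
  intro a ha i
  have hw : ∀ x ∈ cmdEdges.arrWrites ++ cmdZeros.arrWrites ++ cmdShorter.arrWrites ++
      cmdPairs.arrWrites ++ cmdRestricted.arrWrites, x < 18 := by decide
  have hn : a ∉ cmdEdges.arrWrites ++ cmdZeros.arrWrites ++ cmdShorter.arrWrites ++
      cmdPairs.arrWrites ++ cmdRestricted.arrWrites := fun h' => by
    have := hw a h'
    omega
  rw [List.mem_append, List.mem_append, not_or, not_or] at hn
  rw [hs5, hs4, sem_arr_of_notMem _ _ hn.2, sem_arr_of_notMem _ _ hn.1.2, f3 a hn.1.1]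
  exact h.arr_zero a (by omega) i

/-- The answer in terms of colourings. -/
def Answered (D : Inst) (t : State) : Prop :=
  (t.reg 0 = 0 ∧ ¬ ∃ S, IsColoring D.E D.F S) ∨
    (t.reg 0 = 1 ∧ ∃ S, IsTight D.E D.F S ∧ (∀ u v a b, ¬ Alt D.E S u v a b) ∧
      ∃ J₁ J₂ : List ℕ, Lists J₁ D.m (fun e => closure D.E S (D.eu e) (D.ev e)) ∧
        Lists J₂ D.m (fun e => ¬ S (D.eu e) (D.ev e)) ∧
        HoldsEdges D J₁ 1 0 1 t ∧ HoldsEdges D J₂ 2 2 3 t)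

theorem Lists.congr {J : List ℕ} {k : ℕ} {Q Q' : ℕ → Prop} (h : Lists J k Q)
    (hQ : ∀ e, 1 ≤ e → e ≤ k → (Q e ↔ Q' e)) : Lists J k Q' := by
  refine ⟨h.1, fun e => ?_⟩
  rw [h.2]
  exact and_congr_right fun he => hQ e he.1 he.2

/-- The commands that repair the colouring and write the graphs. -/
def cmdFinish : Cmd := block [cmdFix, cmdWit, cmdOut]

theorem cmdFinish_spec {D : Graph} {s : State} (h : Coloured D s) (h24 : ∀ e, s.arr 24 e = 0) :
    Answered D.toInst (sem cmdFinish s) := by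
  obtain ⟨s1, hs1⟩ : ∃ s1, s1 = sem cmdFix s := ⟨_, rfl⟩
  obtain ⟨s2, hs2⟩ : ∃ s2, s2 = sem cmdWit s1 := ⟨_, rfl⟩
  have hsem : sem cmdFinish s = sem cmdOut s2 := by rw [hs2, hs1]; rfl
  obtain ⟨c1, n1⟩ := cmdFix_spec h
  rw [← hs1] at c1 n1
  have w2 := cmdWit_spec c1.base
    (by rw [hs1, sem_arr_of_notMem _ _ (by decide)]; exact h24)
  rw [← hs2] at w2
  have b2 : Base D s2 := by rw [hs2]; exact c1.base.sem _ (by decide) (by decide)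
  have e23 : s2.arr 23 = s1.arr 23 := by rw [hs2, sem_arr_of_notMem _ _ (by decide)]
  obtain ⟨o1, J₁, J₂, o2, o3, o4, o5⟩ := cmdOut_spec b2
  rw [hsem]
  have hcol : ∀ e, 1 ≤ e → e ≤ D.m →
      (s1.col D.toInst (D.eu e) (D.ev e) ↔ s1.arr 23 e ≠ 0) := by
    intro e e1 e2
    unfold State.col
    rw [D.A_end e e1 e2]
    have := c1.le_one e
    omega
  refine Or.inr ⟨o1, s1.col D.toInst, c1.tight, n1, J₁, J₂, o2.congr ?_, o3.congr ?_, o4, o5⟩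
  · intro e e1 e2
    rw [e23, w2, ← hcol e e1 e2]
    unfold closure Witnessed
    have hE := Inst.edge_end e1 e2
    have h15 : s1.arr 15 e = 0 ↔ ¬ ∃ x y, Conf D.E (D.eu e) (D.ev e) x y := by
      constructor
      · rintro h0 ⟨x, y, hc⟩
        exact c1.par_ne _ _ _ _ hc (by rw [D.A_end e e1 e2]; exact h0)
      · intro hn
        by_contra h0
        obtain ⟨u, v, x, y, hc, rfl, -⟩ := c1.par e h0
        rw [D.eu_A _ _ hc.1, D.ev_A _ _ hc.1] at hn
        exact hn ⟨x, y, hc⟩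
    have hz : (∃ l < D.mh, s1.col D.toInst (D.eu e) (D.zv l) ∧
        s1.col D.toInst (D.zu l) (D.ev e)) ↔ ∃ a b, ¬ D.E a b ∧
          s1.col D.toInst (D.eu e) b ∧ s1.col D.toInst a (D.ev e) := by
      constructor
      · rintro ⟨l, hl, k1, k2⟩
        exact ⟨_, _, not_not.2 (D.A_zero l hl), k1, k2⟩
      · rintro ⟨a, b, hab, k1, k2⟩
        obtain ⟨l, hl, rfl, rfl⟩ := D.zero_mem a b (D.lt_of_E (c1.tight.sub k2)).1
          (D.lt_of_E (c1.tight.sub k1)).2 (not_not.1 hab)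
        exact ⟨l, hl, k1, k2⟩
    rw [h15, hz]
    exact or_congr_right ⟨fun ⟨_, k1, k2⟩ => ⟨hE, k1, k2⟩, fun ⟨_, k1, k2⟩ => ⟨⟨e1, e2⟩, k1, k2⟩⟩
  · intro e e1 e2
    rw [e23, hcol e e1 e2, not_not]

theorem cmdMain_spec {D : Inst} {s : State} (h : Ready D s) : Answered D (sem cmdMain s) := by
  obtain ⟨G, rfl, -, hB, hC, hP, h0⟩ := cmdBuild_spec h
  obtain ⟨s1, hs1⟩ : ∃ s1, s1 = sem cmdBuild s := ⟨_, rfl⟩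
  obtain ⟨s2, hs2⟩ : ∃ s2, s2 = sem cmdSolve s1 := ⟨_, rfl⟩
  obtain ⟨s3, hs3⟩ : ∃ s3, s3 = sem cmdColour s2 := ⟨_, rfl⟩
  have hsem : sem cmdMain s = sem (ite (.ne 43 5) (lit 0 0) cmdFinish) s3 := by
    rw [hs3, hs2, hs1]; rfl
  rw [← hs1] at hB hC hP h0
  obtain ⟨q1, q2, q3⟩ := cmdSolve_spec hB.base hB.arcs hC (h0 18 (by decide)) (h0 19 (by decide))
  rw [← hs2] at q1 q2 q3
  have b2 : Base G s2 := by rw [hs2]; exact hB.base.sem _ (by decide) (by decide)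
  have b3 : Base G s3 := by rw [hs3]; exact b2.sem _ (by decide) (by decide)
  have e15 : s2.arr 15 = s1.arr 15 := by rw [hs2, sem_arr_of_notMem _ _ (by decide)]
  have p2 : ParState G.toInst s2 := by unfold ParState; rw [e15]; exact hB.par
  have hP2 : ∀ u v x y, Conf G.E u v x y → s2.arr 15 (G.A u v) ≠ 0 := by rw [e15]; exact hP
  obtain ⟨k1, k2⟩ := cmdColour_spec b2
    (by rw [hs2, sem_arr_of_notMem _ _ (by decide)]; exact h0 23 (by decide))
  rw [← hs3] at k1 k2
  rw [hsem, sem_ite_ne, b3.r5]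
  split_ifs with c1
  · refine cmdFinish_spec ⟨b3, ?_, ?_, ?_, ?_, ?_⟩ ?_
    · unfold ParState
      rw [hs3, sem_arr_of_notMem _ _ (by decide)]
      exact p2
    · rw [hs3, sem_arr_of_notMem _ _ (by decide)]
      exact hP2
    · intro e
      rw [k2]
      split <;> omega
    · rw [k2, if_neg (by omega)]
    · exact isTight_col p2 hP2 q1 q2 (k1.1 c1) k2
    · rw [hs3, hs2, sem_arr_of_notMem _ _ (by decide), sem_arr_of_notMem _ _ (by decide)]
      exact h0 24 (by decide)
  · refine Or.inl ⟨by simp, ?_⟩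
    rintro ⟨S, hS⟩
    exact c1 (k1.2 fun e e1 e2 => q3 S hS e e1 (by omega))

end TwoChain

namespace TwoChain

open Cmd Instr

/-! ### Instances on finite types -/

section Lift

variable {p q : ℕ}

/-- A relation on finite types as a relation between numbers. -/
def Lift (R : Fin p → Fin q → Prop) (u v : ℕ) : Prop :=
  ∃ (hu : u < p) (hv : v < q), R ⟨u, hu⟩ ⟨v, hv⟩

@[simp] theorem lift_val {R : Fin p → Fin q → Prop} (u : Fin p) (v : Fin q) :
    Lift R u v ↔ R u v :=
  ⟨fun ⟨_, _, h⟩ => h, fun h => ⟨u.2, v.2, h⟩⟩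

theorem IsColoring.lift {E F S : Fin p → Fin q → Prop} (h : IsColoring E F S) :
    IsColoring (Lift E) (Lift F) (Lift S) where
  restricted := fun ⟨hu, hv, h'⟩ => ⟨hu, hv, h.restricted h'⟩
  sub := fun ⟨hu, hv, h'⟩ => ⟨hu, hv, h.sub h'⟩
  conf := by
    rintro u v x y ⟨⟨hu, hv, h1⟩, ⟨hx, hy, h2⟩, h3, h4⟩
    have h3' : ¬ E ⟨u, hu⟩ ⟨y, hy⟩ := fun h' => h3 ⟨hu, hy, h'⟩
    have h4' : ¬ E ⟨x, hx⟩ ⟨v, hv⟩ := fun h' => h4 ⟨hx, hv, h'⟩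
    have h5 := h.conf ⟨h1, h2, h3', h4'⟩
    have e1 := lift_val (R := S) ⟨u, hu⟩ ⟨v, hv⟩
    have e2 := lift_val (R := S) ⟨x, hx⟩ ⟨y, hy⟩
    exact e1.trans (h5.trans (not_congr e2.symm))
  avoid := fun ⟨_, _, h'⟩ ⟨_, _, h''⟩ => h.avoid h' h''
  cross := by
    rintro u b a v ⟨hu, hb, h1⟩ h2 ⟨_, hv, h3⟩ ⟨ha, _, h4⟩
    exact h.cross h1 (fun h' => h2 ⟨ha, hv, h'⟩) h3 h4

theorem conf_lift {E : Fin p → Fin q → Prop} {u x : Fin p} {v y : Fin q} :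
    Conf (Lift E) u v x y ↔ Conf E u v x y := by
  simp only [Conf, lift_val]

theorem exists_conf_lift {E : Fin p → Fin q → Prop} {u : Fin p} {v : Fin q} :
    (∃ x y, Conf (Lift E) u v x y) ↔ ∃ x y, Conf E u v x y := by
  constructor
  · rintro ⟨x, y, h⟩
    obtain ⟨hx, hy, -⟩ := h.2.1
    exact ⟨⟨x, hx⟩, ⟨y, hy⟩, conf_lift.1 h⟩
  · rintro ⟨x, y, h⟩
    exact ⟨x, y, conf_lift.2 h⟩

theorem IsTight.of_lift {E F : Fin p → Fin q → Prop} {S : ℕ → ℕ → Prop}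
    (h : IsTight (Lift E) (Lift F) S) : IsTight E F fun u v => S u v where
  restricted {u v} hf := (lift_val u v).1 (h.restricted ((lift_val u v).2 hf))
  sub {u v} hs := (lift_val u v).1 (h.sub hs)
  conf hc := h.conf (conf_lift.2 hc)
  avoid {u v} hf := h.avoid ((lift_val u v).2 hf)
  cross {u b a v} hf hz := h.cross ((lift_val u b).2 hf) (fun h' => hz ((lift_val a v).1 h'))
  noniso hs := exists_conf_lift.1 (h.noniso hs)

theorem Alt.lift {E : Fin p → Fin q → Prop} {S : ℕ → ℕ → Prop} {u a : Fin p} {v b : Fin q}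
    (h : Alt E (fun u v => S u v) u v a b) : Alt (Lift E) S u v a b := by
  obtain ⟨x, y, h1, h2⟩ := h
  refine ⟨x, y, conf_lift.2 h1, ?_⟩
  simpa only [lift_val] using h2

/-- Pairs of numbers out of range count as nonedges of the lifted graph, but a nonedge ab that
closes up a path has both a and b as ends of edges in S, hence in range. -/
theorem closure_lift {E F : Fin p → Fin q → Prop} {S : ℕ → ℕ → Prop}
    (h : IsTight (Lift E) (Lift F) S) (u : Fin p) (v : Fin q) :
    closure (Lift E) S u v ↔ closure E (fun u v => S u v) u v := by
  unfold closure
  rw [exists_conf_lift, lift_val]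
  refine or_congr_right (and_congr_right fun _ => and_congr_right fun _ => ?_)
  constructor
  · rintro ⟨a, b, h1, h2, h3⟩
    obtain ⟨-, hb, -⟩ := h.sub h2
    obtain ⟨ha, -, -⟩ := h.sub h3
    exact ⟨⟨a, ha⟩, ⟨b, hb⟩, fun h' => h1 ⟨ha, hb, h'⟩, h2, h3⟩
  · rintro ⟨a, b, h1, h2, h3⟩
    exact ⟨a, b, by rwa [lift_val], h2, h3⟩

end Lift

/-! ### Edge lists as numbered instances, and the answer in terms of finite sets. -/

section Input

variable {p q : ℕ} {E F : Finset (Fin p × Fin q)} {lE lF : List (Fin p × Fin q)}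

theorem Enumerates.length_eq {l : List (Fin p × Fin q)} {E : Finset (Fin p × Fin q)}
    (h : Enumerates l E) : l.length = E.card := by
  rw [← List.toFinset_card_of_nodup h.1]
  congr 1
  ext e
  rw [List.mem_toFinset, h.2]

/-- The left end vertices. -/
def lefts (l : List (Fin p × Fin q)) (i : ℕ) : ℕ := (l.map fun e => (e.1 : ℕ)).getD i 0

/-- The right end vertices. -/
def rights (l : List (Fin p × Fin q)) (i : ℕ) : ℕ := (l.map fun e => (e.2 : ℕ)).getD i 0

theorem lefts_eq {l : List (Fin p × Fin q)} {i : ℕ} (h : i < l.length) :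
    lefts l i = (l[i].1 : ℕ) := by
  unfold lefts
  rw [List.getD_eq_getElem _ _ (by simpa using h), List.getElem_map]

theorem rights_eq {l : List (Fin p × Fin q)} {i : ℕ} (h : i < l.length) :
    rights l i = (l[i].2 : ℕ) := by
  unfold rights
  rw [List.getD_eq_getElem _ _ (by simpa using h), List.getElem_map]

/-- The number of an edge. -/
def edgeNumber (l : List (Fin p × Fin q)) (u v : ℕ) : ℕ :=
  if h : u < p ∧ v < q then
    if (⟨u, h.1⟩, ⟨v, h.2⟩) ∈ l then l.idxOf (⟨u, h.1⟩, ⟨v, h.2⟩) + 1 else 0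
  else 0

theorem edgeNumber_ne_zero {l : List (Fin p × Fin q)} {u v : ℕ} :
    edgeNumber l u v ≠ 0 ↔ Lift (fun u v => (u, v) ∈ l) u v := by
  unfold edgeNumber Lift
  by_cases h : u < p ∧ v < q
  · by_cases h' : (⟨u, h.1⟩, ⟨v, h.2⟩) ∈ l
    · simp [h, h']
    · simp [h, h']
  · rw [dif_neg h]
    refine iff_of_false (fun h' => h' rfl) ?_
    rintro ⟨h1, h2, -⟩
    exact h ⟨h1, h2⟩

theorem edgeNumber_spec {l : List (Fin p × Fin q)} {u v : ℕ} (h : edgeNumber l u v ≠ 0) :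
    ∃ i, ∃ hi : i < l.length, edgeNumber l u v = i + 1 ∧ (l[i].1 : ℕ) = u ∧ (l[i].2 : ℕ) = v := by
  obtain ⟨hu, hv, hm⟩ := edgeNumber_ne_zero.1 h
  refine ⟨l.idxOf (⟨u, hu⟩, ⟨v, hv⟩), List.idxOf_lt_length_iff.2 hm, ?_, ?_, ?_⟩
  · unfold edgeNumber
    rw [dif_pos ⟨hu, hv⟩, if_pos hm]
  · rw [List.getElem_idxOf]
  · rw [List.getElem_idxOf]

theorem edgeNumber_getElem {l : List (Fin p × Fin q)} (hl : l.Nodup) {i : ℕ} (hi : i < l.length) :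
    edgeNumber l (l[i].1 : ℕ) (l[i].2 : ℕ) = i + 1 := by
  unfold edgeNumber
  rw [dif_pos ⟨l[i].1.2, l[i].2.2⟩]
  have e : ((⟨l[i].1, l[i].1.2⟩, ⟨l[i].2, l[i].2.2⟩) : Fin p × Fin q) = l[i] := rfl
  rw [e, if_pos (List.getElem_mem hi), List.Nodup.idxOf_getElem hl]

/-- The instance given by lists of edges. -/
def listInst (lE lF : List (Fin p × Fin q)) (hl : lE.Nodup) (hF : ∀ e ∈ lF, e ∈ lE) : Inst where
  p := p
  q := q
  m := lE.length
  f := lF.length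
  eu e := lefts lE (e - 1)
  ev e := rights lE (e - 1)
  fu := lefts lF
  fv := rights lF
  A := edgeNumber lE
  eu_lt e h1 h2 := by
    rw [lefts_eq (show e - 1 < lE.length by omega)]
    exact Fin.is_lt _
  ev_lt e h1 h2 := by
    rw [rights_eq (show e - 1 < lE.length by omega)]
    exact Fin.is_lt _
  A_end e h1 h2 := by
    have hi : e - 1 < lE.length := by omega
    rw [lefts_eq hi, rights_eq hi, edgeNumber_getElem hl hi]
    omega
  A_le u v := by
    by_cases h : edgeNumber lE u v = 0
    · omega
    · obtain ⟨i, hi, h1, -⟩ := edgeNumber_spec h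
      omega
  eu_A u v h := by
    obtain ⟨i, hi, h1, h2, h3⟩ := edgeNumber_spec h
    rw [h1, Nat.add_sub_cancel, lefts_eq hi, h2]
  ev_A u v h := by
    obtain ⟨i, hi, h1, h2, h3⟩ := edgeNumber_spec h
    rw [h1, Nat.add_sub_cancel, rights_eq hi, h3]
  A_res k hk := by
    rw [lefts_eq hk, rights_eq hk, edgeNumber_ne_zero, lift_val]
    exact hF _ (List.getElem_mem hk)

variable {hl : lE.Nodup} {hF : ∀ e ∈ lF, e ∈ lE}

theorem listInst_E (hE : Enumerates lE E) :
    (listInst lE lF hl hF).E = Lift fun u v => (u, v) ∈ E := by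
  funext u v
  apply propext
  simp only [← hE.2]
  exact edgeNumber_ne_zero

theorem listInst_F (hF' : Enumerates lF F) :
    (listInst lE lF hl hF).F = Lift fun u v => (u, v) ∈ F := by
  funext u v
  apply propext
  constructor
  · rintro ⟨k, hk, rfl, rfl⟩
    have hk' : k < lF.length := hk
    show Lift _ (lefts lF k) (rights lF k)
    rw [lefts_eq hk', rights_eq hk', lift_val, ← hF'.2]
    exact List.getElem_mem hk'
  · rintro ⟨hu, hv, h⟩
    rw [← hF'.2] at h
    obtain ⟨k, hk, he⟩ := List.getElem_of_mem h
    refine ⟨k, hk, ?_, ?_⟩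
    · show lefts lF k = u
      rw [lefts_eq hk, he]
    · show rights lF k = v
      rw [rights_eq hk, he]

theorem listInst_zeros (hE : Enumerates lE E) : (listInst lE lF hl hF).zeros = Eᶜ.card := by
  symm
  unfold Inst.zeros
  refine Finset.card_bij (fun e _ => ((e.1 : ℕ), (e.2 : ℕ))) ?_ ?_ ?_
  · intro e he
    rw [Finset.mem_filter, Finset.mem_product, Finset.mem_range, Finset.mem_range]
    refine ⟨⟨e.1.2, e.2.2⟩, ?_⟩
    rw [Finset.mem_compl] at he
    by_contra h
    have h' : (listInst lE lF hl hF).E e.1 e.2 := h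
    rw [listInst_E hE, lift_val] at h'
    exact he h'
  · intro e _ e' _ h
    simp only [Prod.mk.injEq] at h
    exact Prod.ext (Fin.ext h.1) (Fin.ext h.2)
  · rintro ⟨u, v⟩ hz
    rw [Finset.mem_filter, Finset.mem_product, Finset.mem_range, Finset.mem_range] at hz
    obtain ⟨⟨hu, hv⟩, hz⟩ := hz
    refine ⟨(⟨u, hu⟩, ⟨v, hv⟩), ?_, rfl⟩
    rw [Finset.mem_compl]
    intro h
    have : (listInst lE lF hl hF).E u v := by
      rw [listInst_E hE]
      exact ⟨hu, hv, h⟩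
    exact this hz

theorem storesEdges_of_holds (hE : Enumerates lE E) {J : List ℕ} {Q : ℕ → Prop}
    {r a b : ℕ} {t : State} {E' : Finset (Fin p × Fin q)} (hJ : Lists J lE.length Q)
    (hE' : ∀ i (hi : i < lE.length), lE[i] ∈ E' ↔ Q (i + 1)) (hsub : E' ⊆ E)
    (h : HoldsEdges (listInst lE lF hl hF) J r a b t) : StoresEdges t r a b E' := by
  have hlt : ∀ e ∈ J, 1 ≤ e ∧ e - 1 < lE.length := fun e he => by
    have := ((hJ.2 e).1 he).1
    omega
  refine ⟨J.pmap (fun e he => lE[e - 1]'he.2) hlt, ⟨?_, fun e => ?_⟩, ?_, fun i hi => ?_⟩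
  · refine List.Nodup.pmap (fun e he e' he' heq => ?_) hJ.1
    have := (List.Nodup.getElem_inj_iff hE.1).1 heq
    omega
  · rw [List.mem_pmap]
    constructor
    · rintro ⟨x, hx, rfl⟩
      have hx' := (hJ.2 x).1 hx
      rw [hE', Nat.sub_add_cancel hx'.1.1]
      exact hx'.2
    · intro he
      obtain ⟨i, hi, rfl⟩ := List.getElem_of_mem ((hE.2 e).2 (hsub he))
      exact ⟨i + 1, (hJ.2 _).2 ⟨by omega, (hE' i hi).1 he⟩, rfl⟩
  · rw [List.length_pmap]
    exact h.1
  · rw [List.length_pmap] at hi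
    rw [List.getElem_pmap]
    obtain ⟨h1, h2⟩ := h.2 i hi
    have hi' := (hlt _ (List.getElem_mem hi)).2
    rw [h1, h2]
    exact ⟨lefts_eq hi', rights_eq hi'⟩

theorem isAnswer_of_answered (hE : Enumerates lE E) (hF' : Enumerates lF F) (hFE : F ⊆ E)
    {t : State} (h : Answered (listInst lE lF hl hF) t) : IsAnswer E F t := by
  unfold Answered at h
  rw [listInst_E hE, listInst_F hF'] at h
  rcases h with ⟨h1, h2⟩ | ⟨h1, S, hS, hA, J₁, J₂, j1, j2, j3, j4⟩
  · refine Or.inr ⟨h1, ?_⟩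
    rintro ⟨E₁, E₂, hc⟩
    exact h2 ⟨_, (hc.isColoring hFE).lift⟩
  · classical
    have hT := hS.of_lift
    let E₁ := Finset.univ.filter fun e : Fin p × Fin q =>
      closure (fun u v => (u, v) ∈ E) (fun u v => S u v) e.1 e.2
    let E₂ := E.filter fun e : Fin p × Fin q => ¬ S e.1 e.2
    have m1 : ∀ u v, (u, v) ∈ E₁ ↔ closure (fun u v => (u, v) ∈ E) (fun u v => S u v) u v :=
      fun u v => by simp [E₁]
    have m2 : ∀ u v, (u, v) ∈ E₂ ↔ (u, v) ∈ E ∧ ¬ S u v := fun u v => by simp [E₂]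
    refine Or.inl ⟨h1, E₁, E₂, isRestrictedCover_of_coloring hT
      (fun u v a b h => hA u v a b h.lift) m1 m2, ?_, ?_⟩
    · refine storesEdges_of_holds hE j1 (fun i hi => ?_) (fun e he => ?_) j3
      · rw [← Prod.mk.eta (p := lE[i]), m1, ← closure_lift hS]
        show _ ↔ closure _ S (lefts lE (i + 1 - 1)) (rights lE (i + 1 - 1))
        rw [Nat.add_sub_cancel, lefts_eq hi, rights_eq hi]
      · exact closure_sub hT ((m1 e.1 e.2).1 he)
    · refine storesEdges_of_holds hE j2 (fun i hi => ?_) (Finset.filter_subset _ _) j4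
      rw [← Prod.mk.eta (p := lE[i]), m2]
      show _ ↔ ¬ S (lefts lE (i + 1 - 1)) (rights lE (i + 1 - 1))
      rw [Nat.add_sub_cancel, lefts_eq hi, rights_eq hi]
      exact and_iff_right ((hE.2 _).1 (List.getElem_mem hi))

theorem cmdTrivial_spec (hE : Enumerates lE E) (h : E.card = 0 ∨ Eᶜ.card = 0) {s : State}
    (h12 : s.reg 12 = lE.length) (h2 : s.reg 2 = lE.length)
    (h0 : s.arr 0 = lefts lE) (h1 : s.arr 1 = rights lE) : IsAnswer E F (sem cmdTrivial s) := by
  have hcp := copy_spec (x := 0) (y := 1) (z := 2) (w := 3) (n := 12) (i := 20) (t := 22)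
    (s := s) (by decide) (by decide) (by decide) (by decide) (by decide) (by decide)
  rw [h12, h0, h1] at hcp
  have hr := sem_reg_of_notMem
    (loop 20 12 (block [load 22 0 20, store 2 20 22, load 22 1 20, store 3 20 22])) s (r := 2)
    (by decide)
  simp only [cmdTrivial, sem_block_cons, sem_block_nil]
  obtain ⟨t, ht⟩ : ∃ t, t = sem (loop 20 12 (block [load 22 0 20, store 2 20 22, load 22 1 20,
    store 3 20 22])) s := ⟨_, rfl⟩
  rw [← ht] at hcp hr ⊢
  refine Or.inl ⟨by simp, ∅, E, ⟨?_, ?_, by simp, by simp⟩, ⟨[], ⟨by simp, by simp⟩, by simp,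
    by simp⟩, ⟨lE, hE, ?_, fun i hi => ?_⟩⟩
  · rintro u₁ u₂ v₁ v₂ ⟨h1, -⟩
    simp at h1
  · rintro u₁ u₂ v₁ v₂ ⟨h1, -, h3, -⟩
    rcases h with h | h
    · rw [Finset.card_eq_zero.1 h] at h1
      simp at h1
    · rw [Finset.card_eq_zero, Finset.compl_eq_empty_iff] at h
      rw [h] at h3
      simp at h3
  · simp [hr, h2]
  · simp [(hcp i hi).1, (hcp i hi).2, lefts_eq hi, rights_eq hi]

end Input

end TwoChain

namespace TwoChain

open Cmd Instr

/-! ### Running time -/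

section Cost

variable (env : ℕ → ℕ)

theorem cost_cmdEdges : cost env cmdEdges = 5 + env 12 * 14 := by
  simp only [cmdEdges, block, cost]; ring

theorem cost_cmdZeros : cost env cmdZeros = 4 + env 10 * 4 + env 10 * env 11 * 13 := by
  simp only [cmdZeros, getA, block, cost]; ring

theorem cost_cmdPairs : cost env cmdPairs = 2 + env 15 * 4 + env 15 * env 15 * 60 := by
  simp only [cmdPairs, pairLoad, pairEmit, addArc, getA, block, cost]; ring

theorem cost_cmdRestricted :
    cost env cmdRestricted = 2 + env 13 * 19 + env 13 * env 14 * 34 := by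
  simp only [cmdRestricted, restrictedHead, restrictedBody, addArc, getA, block, cost]; ring

theorem cost_cmdBudget : cost env cmdBudget = 6 + env 12 * 7 + env 18 * 5 := by
  simp only [cmdBudget, block, cost]; ring

theorem cost_cmdSearch : cost env cmdSearch = 6 + env 17 * 42 := by
  simp only [cmdSearch, cmdStep, cmdVisit, block, cost]; ring

theorem cost_cmdReverse : cost env cmdReverse = 2 + env 18 * 11 := by
  simp only [cmdReverse, block, cost]

theorem cost_cmdColour : cost env cmdColour = 4 + env 12 * 17 := by
  simp only [cmdColour, block, cost]; ring

theorem cost_cmdFix : cost env cmdFix = 2 + env 14 * 7 + env 12 * env 14 * 42 := by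
  simp only [cmdFix, fixBody, fixLoad, fixStore, getA, block, cost]; ring

theorem cost_cmdWit : cost env cmdWit = 2 + env 12 * 12 + env 12 * env 14 * 20 := by
  simp only [cmdWit, witBody, getA, block, cost]; ring

theorem cost_cmdOut : cost env cmdOut = 6 + env 12 * 24 := by
  simp only [cmdOut, outBody, outLeft, outRight, block, cost]; ring

theorem cost_cmdTrivial : cost env cmdTrivial = 5 + env 12 * 7 := by
  simp only [cmdTrivial, block, cost]; ring

end Cost

theorem time_le (c : Cmd) (s : State) (h : ∀ n ∈ c.limits, n ∉ c.regWrites) :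
    time c s ≤ cost s.reg c :=
  time_le_cost c s h fun _ _ => le_rfl

/-- The command sets its own loop bound, register 15, so the general estimate `time_le` does not
apply. -/
theorem time_cmdShorter {D : Graph} {s : State} (h : Base D s) :
    time cmdShorter s ≤ 5 + 7 * min D.m D.mh := by
  have hcopy : ∀ (t : State) (a b : ℕ), time (block [loop 20 15 (block [load 22 a 20,
      store 9 20 22, load 22 b 20, store 10 20 22])]) t = 3 + 7 * t.reg 15 := by
    intro t a b
    simp only [block, time, Finset.sum_const, Finset.card_range, smul_eq_mul]
    omega
  have hmove : ∀ (t : State) (x : ℕ) (l : List Cmd), time (block (move 15 x :: l)) t =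
      1 + time (block l) (t.setReg 15 (t.reg x)) := fun t x l => rfl
  unfold cmdShorter
  simp only [time, Test.Holds, h.r12, h.r14]
  split_ifs with hm
  · rw [hmove, hcopy]
    simp only [State.setReg_reg, if_true, h.r12]
    omega
  · rw [hmove, hcopy]
    simp only [State.setReg_reg, if_true, h.r14]
    omega

theorem time_block_cons (c : Cmd) (l : List Cmd) (s : State) :
    time (block (c :: l)) s = time c s + time (block l) (sem c s) := rfl

theorem time_block_nil (s : State) : time (block []) s = 1 := rfl

/-- The commands before the searches. -/
def cmdPrefix : Cmd :=
  block [cmdEdges, cmdZeros, cmdShorter, cmdPairs, cmdRestricted, cmdBudget]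

/-- With m and m̂ positive, every term is at most a constant times m m̂: the matrix scan because pq
= m + m̂, the pairs because min(m, m̂)² ≤ m m̂, and the restricted edges because f ≤ m. -/
theorem cmdPrefix_time {D : Inst} {s : State} (h : Ready D s) (hm : 1 ≤ D.m) (hz : 1 ≤ D.zeros)
    (hf : D.f ≤ D.m) (hpq : D.p * D.q = D.m + D.zeros) :
    time cmdPrefix s ≤ 220 * (D.m * D.zeros) ∧
      ∃ G : Graph, G.toInst = D ∧ G.mh = D.zeros ∧ Base G (sem cmdPrefix s) := by
  obtain ⟨s1, hs1⟩ : ∃ s1, s1 = sem cmdEdges s := ⟨_, rfl⟩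
  obtain ⟨s2, hs2⟩ : ∃ s2, s2 = sem cmdZeros s1 := ⟨_, rfl⟩
  obtain ⟨s3, hs3⟩ : ∃ s3, s3 = sem cmdShorter s2 := ⟨_, rfl⟩
  obtain ⟨s4, hs4⟩ : ∃ s4, s4 = sem cmdPairs s3 := ⟨_, rfl⟩
  obtain ⟨s5, hs5⟩ : ∃ s5, s5 = sem cmdRestricted s4 := ⟨_, rfl⟩
  have hsem : sem cmdPrefix s = sem cmdBudget s5 := by rw [hs5, hs4, hs3, hs2, hs1]; rfl
  have htime : time cmdPrefix s = time cmdEdges s + (time cmdZeros s1 + (time cmdShorter s2 +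
      (time cmdPairs s3 + (time cmdRestricted s4 + (time cmdBudget s5 + 1))))) := by
    rw [hs5, hs4, hs3, hs2, hs1]; rfl
  have i1 := cmdEdges_spec h.toLoaded h.a0 h.a1 (h.arr_zero 4 le_rfl)
  rw [← hs1] at i1
  obtain ⟨G, rfl, b2, hmh⟩ := exists_graph i1
  rw [← hs2] at b2
  have f2 : ∀ a ∉ cmdEdges.arrWrites ++ cmdZeros.arrWrites, s2.arr a = s.arr a := by
    intro a ha
    rw [List.mem_append, not_or] at ha
    rw [hs2, hs1, sem_arr_of_notMem _ _ ha.2, sem_arr_of_notMem _ _ ha.1]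
  obtain ⟨b3, r3, l3⟩ := cmdShorter_spec b2
    (by rw [f2 0 (by decide)]; exact h.a0) (by rw [f2 1 (by decide)]; exact h.a1)
  rw [← hs3] at b3 r3 l3
  have b4 : Base G s4 := by rw [hs4]; exact b3.sem _ (by decide) (by decide)
  have b5 : Base G s5 := by rw [hs5]; exact b4.sem _ (by decide) (by decide)
  have b6 : Base G (sem cmdBudget s5) := b5.sem _ (by decide) (by decide)
  refine ⟨?_, G, rfl, hmh, by rw [hsem]; exact b6⟩
  rw [htime]
  have t1 := time_le cmdEdges s (by decide)
  have t2 := time_le cmdZeros s1 (by decide)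
  have t3 := time_cmdShorter b2
  have t4 := time_le cmdPairs s3 (by decide)
  have t5 := time_le cmdRestricted s4 (by decide)
  have t6 := time_le cmdBudget s5 (by decide)
  rw [cost_cmdEdges, h.r12] at t1
  rw [cost_cmdZeros, i1.r10, i1.r11, hpq] at t2
  rw [cost_cmdPairs, r3] at t4
  rw [cost_cmdRestricted, b4.r13, b4.r14] at t5
  rw [cost_cmdBudget, b5.r12, b5.r18] at t6
  rw [← hmh] at hz hpq t2 ⊢
  have e1 : G.m ≤ G.m * G.mh := Nat.le_mul_of_pos_right _ hz
  have e2 : G.mh ≤ G.m * G.mh := Nat.le_mul_of_pos_left _ hm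
  have e3 : min G.m G.mh * min G.m G.mh ≤ G.m * G.mh :=
    Nat.mul_le_mul (min_le_left _ _) (min_le_right _ _)
  have e4 : G.f * G.mh ≤ G.m * G.mh := Nat.mul_le_mul_right _ hf
  have e5 : G.p ≤ G.p * G.q := by
    refine Nat.le_mul_of_pos_right _ (Nat.pos_of_ne_zero fun h0 => ?_)
    rw [h0] at hpq
    omega
  have e6 : min G.m G.mh ≤ G.m := min_le_left _ _
  omega

theorem cmdMain_time {D : Inst} {s : State} (h : Ready D s) (hm : 1 ≤ D.m) (hz : 1 ≤ D.zeros)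
    (hf : D.f ≤ D.m) (hpq : D.p * D.q = D.m + D.zeros)
    (hB : Bounded s (7 * (D.m * D.zeros))) : time cmdMain s ≤ 20000 * (D.m * D.zeros) := by
  obtain ⟨t0, G, rfl, hmh, b0⟩ := cmdPrefix_time h hm hz hf hpq
  -- The length of the searches, in register 17, is not computed from the number of arcs. Registers
  -- grow by at most one per step, so it is at most the initial bound plus the time spent so far,
  -- that is 227 m m̂; two searches at 42 per round account for most of the 20000.
  have hbd := (exec_sem (T := 7 * (G.m * G.zeros) + time cmdPrefix s) (Nat.lt_succ_self _)
    cmdPrefix s _ (by decide) hB le_rfl).2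
  obtain ⟨s0, hs0⟩ : ∃ s0, s0 = sem cmdPrefix s := ⟨_, rfl⟩
  rw [← hs0] at b0 hbd
  have r17 := hbd.reg 17 (by decide)
  obtain ⟨s1, hs1⟩ : ∃ s1, s1 = sem cmdSearch s0 := ⟨_, rfl⟩
  obtain ⟨s2, hs2⟩ : ∃ s2, s2 = sem cmdReverse s1 := ⟨_, rfl⟩
  obtain ⟨s3, hs3⟩ : ∃ s3, s3 = sem cmdSearch s2 := ⟨_, rfl⟩
  obtain ⟨s4, hs4⟩ : ∃ s4, s4 = sem cmdColour s3 := ⟨_, rfl⟩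
  obtain ⟨s5, hs5⟩ : ∃ s5, s5 = sem cmdFix s4 := ⟨_, rfl⟩
  obtain ⟨s6, hs6⟩ : ∃ s6, s6 = sem cmdWit s5 := ⟨_, rfl⟩
  have hend : time (ite (.ne 43 5) (lit 0 0) (block [cmdFix, cmdWit, cmdOut])) s4 ≤
      3 + time cmdFix s4 + time cmdWit s5 + time cmdOut s6 := by
    rw [hs6, hs5]
    simp only [time, block]
    split <;> omega
  have htime : time cmdMain s + 1 = time cmdPrefix s + (time cmdSearch s0 + (time cmdReverse s1 +
      (time cmdSearch s2 + (time cmdColour s3 +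
        (time (ite (.ne 43 5) (lit 0 0) (block [cmdFix, cmdWit, cmdOut])) s4 + 1))))) := by
    rw [hs4, hs3, hs2, hs1, hs0]
    simp only [cmdMain, cmdPrefix, time_block_cons, time_block_nil, sem_block_cons,
      sem_block_nil]
    omega
  have b1 : Base G s1 := by rw [hs1]; exact b0.sem _ (by decide) (by decide)
  have b2 : Base G s2 := by rw [hs2]; exact b1.sem _ (by decide) (by decide)
  have b3 : Base G s3 := by rw [hs3]; exact b2.sem _ (by decide) (by decide)
  have b4 : Base G s4 := by rw [hs4]; exact b3.sem _ (by decide) (by decide)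
  have b5 : Base G s5 := by rw [hs5]; exact b4.sem _ (by decide) (by decide)
  have b6 : Base G s6 := by rw [hs6]; exact b5.sem _ (by decide) (by decide)
  have r17' : s2.reg 17 = s0.reg 17 := by
    rw [hs2, hs1, sem_reg_of_notMem _ _ (by decide), sem_reg_of_notMem _ _ (by decide)]
  have t1 := time_le cmdSearch s0 (by decide)
  have t2 := time_le cmdReverse s1 (by decide)
  have t3 := time_le cmdSearch s2 (by decide)
  have t4 := time_le cmdColour s3 (by decide)
  have t5 := time_le cmdFix s4 (by decide)
  have t6 := time_le cmdWit s5 (by decide)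
  have t7 := time_le cmdOut s6 (by decide)
  rw [cost_cmdSearch] at t1 t3
  rw [cost_cmdReverse, b1.r18] at t2
  rw [cost_cmdColour, b3.r12] at t4
  rw [cost_cmdFix, b4.r12, b4.r14] at t5
  rw [cost_cmdWit, b5.r12, b5.r14] at t6
  rw [cost_cmdOut, b6.r12] at t7
  rw [r17'] at t3
  rw [← hmh] at hz r17 t0 ⊢
  have e1 : G.m ≤ G.m * G.mh := Nat.le_mul_of_pos_right _ hz
  have e2 : G.mh ≤ G.m * G.mh := Nat.le_mul_of_pos_left _ hm
  omega

theorem card_add_card_compl {p q : ℕ} (E : Finset (Fin p × Fin q)) :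
    p * q = E.card + Eᶜ.card := by
  rw [Finset.card_add_card_compl]
  simp

/-- The whole program. -/
def program : Program := .seq (.instr (.lit 4 1)) cmdAll.compile

/-! ### Execution on words of logarithmic length. -/

section Final

variable {p q : ℕ} {E F : Finset (Fin p × Fin q)} {lE lF : List (Fin p × Fin q)}

/-- The state after the constant one has been set. -/
def startState (lE lF : List (Fin p × Fin q)) : State := (inputState p q lE lF).setReg 4 1

theorem startState_bounded (hF : lF.length ≤ lE.length) :
    Bounded (startState lE lF) (p + q + lE.length + 2) := by
  have hl : ∀ (l : List (Fin p × Fin q)) i, (l.map fun e => (e.1 : ℕ)).getD i 0 ≤ p := by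
    intro l i
    by_cases hi : i < l.length
    · rw [List.getD_eq_getElem _ _ (by simpa using hi), List.getElem_map]
      exact (Fin.is_lt _).le
    · rw [List.getD_eq_default _ _ (by simpa using hi)]
      exact Nat.zero_le _
  have hr : ∀ (l : List (Fin p × Fin q)) i, (l.map fun e => (e.2 : ℕ)).getD i 0 ≤ q := by
    intro l i
    by_cases hi : i < l.length
    · rw [List.getD_eq_getElem _ _ (by simpa using hi), List.getElem_map]
      exact (Fin.is_lt _).le
    · rw [List.getD_eq_default _ _ (by simpa using hi)]
      exact Nat.zero_le _
  have hreg : ∀ r, (startState lE lF).reg r ≤ p + q + lE.length + 2 := by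
    intro r
    simp only [startState, State.setReg_reg, inputState]
    split
    · omega
    · split <;> omega
  refine ⟨by omega, rfl, fun r _ => hreg r, (hreg 60).trans (Nat.le_mul_self _),
    (hreg 61).trans (Nat.le_add_left _ _), fun a i => ?_⟩
  simp only [startState, State.setReg_arr, inputState]
  split
  · exact (hl lE i).trans (by omega)
  · exact (hr lE i).trans (by omega)
  · exact (hl lF i).trans (by omega)
  · exact (hr lF i).trans (by omega)
  · exact Nat.zero_le _

theorem cmdInit_ready (hl : lE.Nodup) (hF : ∀ e ∈ lF, e ∈ lE) :
    Ready (listInst lE lF hl hF) (sem cmdInit (startState lE lF)) := by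
  have harr : (sem cmdInit (startState lE lF)).arr = (inputState p q lE lF).arr := rfl
  constructor
  · constructor
    · simp [cmdInit, startState]
    · simp [cmdInit, startState, inputState]
    · simp [cmdInit, startState, inputState, listInst]
    · simp [cmdInit, startState, inputState, listInst]
    · simp [cmdInit, startState, inputState, listInst]
    · simp [cmdInit, startState, inputState, listInst]
    · intro k _; rw [harr]; rfl
    · intro k _; rw [harr]; rfl
  · intro k _; rw [harr]; rfl
  · intro k _; rw [harr]; rfl
  · intro a ha i
    rw [harr]
    simp only [inputState]
    split <;> omega
  · simp [cmdInit, startState, inputState]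

theorem cmdInit_bounded {M : ℕ} (hB : Bounded (startState lE lF) M) (hM : p + q ≤ M) :
    Bounded (sem cmdInit (startState lE lF)) M := by
  have hB' : Bounded (((((startState lE lF).setReg 10 p).setReg 11 q).setReg 12
      lE.length).setReg 13 lF.length) M := by
    refine (((hB.setReg ?_ ?_ ?_).setReg ?_ ?_ ?_).setReg ?_ ?_ ?_).setReg ?_ ?_ ?_ <;>
      first | omega | skip
    · exact hB.reg 2 (by omega)
    · exact hB.reg 3 (by omega)
  have he : sem cmdInit (startState lE lF) = (((((startState lE lF).setReg 10 p).setReg 11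
      q).setReg 12 lE.length).setReg 13 lF.length).setReg 60 (p * q) := rfl
  rw [he]
  refine ⟨hB'.pos, hB'.one, fun r hr => ?_, ?_, hB'.sum, hB'.arr⟩
  · rw [State.setReg_reg, if_neg (by omega)]
    exact hB'.reg r hr
  · rw [State.setReg_reg, if_pos rfl]
    exact Nat.mul_le_mul (by omega) (by omega)

/-- Commands that take few steps run on the machine. -/
theorem exec_program {M : ℕ} (hM : 2 ≤ M) (hB : Bounded (startState lE lF) M)
    (ht : time cmdAll (startState lE lF) ≤ 2 ^ 15 * M ^ 3) :
    Exec (M ^ 42) program (inputState p q lE lF) (1 + time cmdAll (startState lE lF))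
      (sem cmdAll (startState lE lF)) := by
  -- As M ≥ 2, constants are absorbed into powers of M. With T = M¹⁹ bounding all ordinary numbers,
  -- the addresses are at most T² + T ≤ M³⁹, and the exponent 42 leaves some slack.
  have h1 : 2 ^ 15 * M ^ 3 ≤ M ^ 18 := by
    calc 2 ^ 15 * M ^ 3 ≤ M ^ 15 * M ^ 3 := Nat.mul_le_mul_right _ (Nat.pow_le_pow_left hM 15)
      _ = M ^ 18 := by ring
  have h2 : M ≤ M ^ 18 := Nat.le_self_pow (by norm_num) M
  have h3 : M + time cmdAll (startState lE lF) ≤ M ^ 19 := by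
    have : 2 * M ^ 18 ≤ M * M ^ 18 := Nat.mul_le_mul_right _ hM
    have h4 : M ^ 19 = M * M ^ 18 := by ring
    omega
  have h5 : M ^ 19 * M ^ 19 + M ^ 19 < M ^ 42 := by
    have e1 : M ^ 19 * M ^ 19 = M ^ 38 := by ring
    have e2 : M ^ 19 ≤ M ^ 38 := Nat.pow_le_pow_right (by omega) (by norm_num)
    have e3 : 2 * M ^ 38 ≤ M * M ^ 38 := Nat.mul_le_mul_right _ hM
    have e4 : M * M ^ 38 = M ^ 39 := by ring
    have e5 : M ^ 39 < M ^ 42 := Nat.pow_lt_pow_right (by omega) (by norm_num)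
    omega
  have hW : 1 < M ^ 42 := Nat.one_lt_pow (by norm_num) (by omega)
  exact .seq (.instr (.lit 4 1) _ hW) (exec_sem h5 cmdAll _ _ cmdAll_ok hB h3).1

end Final

end TwoChain

open TwoChain in
theorem theorem3 :
    ∃ (P : TwoChain.Program) (c C : ℕ),
      ∀ (p q : ℕ) (E F : Finset (Fin p × Fin q)), F ⊆ E →
        ∀ lE lF : List (Fin p × Fin q),
          TwoChain.Enumerates lE E → TwoChain.Enumerates lF F →
            ∃ (t : ℕ) (s : TwoChain.State),
              TwoChain.Exec ((p + q + E.card + 2) ^ c) P (TwoChain.inputState p q lE lF) t s ∧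
              TwoChain.IsAnswer E F s ∧
              (0 < E.card → 0 < Eᶜ.card →
                t ≤ C * TwoChain.timeBound E.card Eᶜ.card F.card) ∧
              (E.card = 0 ∨ Eᶜ.card = 0 → t ≤ C * (p + q + E.card + 1)) := by
  -- The constant covers 20008 m m̂ plus one step in the main case, and 14 + 7m in the degenerate
  -- cases.
  refine ⟨program, 42, 30000, fun p q E F hFE lE lF hE hF => ?_⟩
  have hl := hE.1
  have hsub : ∀ e ∈ lF, e ∈ lE := fun e he => (hE.2 e).2 (hFE ((hF.2 e).1 he))
  have hEm := hE.length_eq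
  have hFm := hF.length_eq
  have hfm : F.card ≤ E.card := Finset.card_le_card hFE
  have hpq := card_add_card_compl E
  have hR := cmdInit_ready hl hsub
  have hB := startState_bounded (lE := lE) (lF := lF) (by omega)
  rw [hEm] at hB
  obtain ⟨s1, hs1⟩ : ∃ s1, s1 = Cmd.sem cmdInit (startState lE lF) := ⟨_, rfl⟩
  rw [← hs1] at hR
  have r12 : s1.reg 12 = E.card := hR.r12.trans hEm
  have r60 : s1.reg 60 = p * q := by
    rw [hs1]; simp [cmdInit, startState, inputState]
  have r5 : s1.reg 5 = 0 := hR.r5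
  have hsem : Cmd.sem cmdAll (startState lE lF) = if E.card = 0 then Cmd.sem cmdTrivial s1 else
      if E.card = p * q then Cmd.sem cmdTrivial s1 else Cmd.sem cmdMain s1 := by
    rw [cmdAll, sem_seq, ← hs1, sem_ite_eq, sem_ite_eq, r12, r60, r5]
  have htime : Cmd.time cmdAll (startState lE lF) = 6 + (1 + if E.card = 0 then
      Cmd.time cmdTrivial s1 else 1 + if E.card = p * q then Cmd.time cmdTrivial s1 else
        Cmd.time cmdMain s1) := by
    rw [hs1] at r12 r60 r5
    simp only [cmdAll, Cmd.time, Test.Holds, r12, r60, r5]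
    rw [← hs1]
    rfl
  have hM : 2 ≤ p + q + E.card + 2 := by omega
  obtain ⟨M, hMe⟩ : ∃ M, M = p + q + E.card + 2 := ⟨_, rfl⟩
  by_cases hdeg : E.card = 0 ∨ Eᶜ.card = 0
  · have hsem' : Cmd.sem cmdAll (startState lE lF) = Cmd.sem cmdTrivial s1 := by
      rw [hsem]
      split_ifs <;> first | rfl | omega
    have htriv := time_le cmdTrivial s1 (by decide)
    rw [cost_cmdTrivial, r12] at htriv
    have htime' : Cmd.time cmdAll (startState lE lF) ≤ 13 + 7 * E.card := by
      rw [htime]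
      split_ifs <;> omega
    refine ⟨_, _, exec_program hM hB ?_, ?_, fun h1 h2 => by omega, fun _ => by omega⟩
    · rw [← hMe] at hM ⊢
      have : M ≤ M ^ 3 := Nat.le_self_pow (by norm_num) M
      omega
    · rw [hsem']
      exact cmdTrivial_spec hE hdeg (r12.trans hEm.symm)
        (by rw [hs1]; simp [cmdInit, startState, inputState]) (by rw [hs1]; rfl) (by rw [hs1]; rfl)
  · have hm : 1 ≤ E.card := by omega
    have hz : 1 ≤ Eᶜ.card := by omega
    have hsem' : Cmd.sem cmdAll (startState lE lF) = Cmd.sem cmdMain s1 := by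
      rw [hsem, if_neg (by omega), if_neg (by omega)]
    have hzeros := listInst_zeros (hl := hl) (hF := hsub) hE
    have hDm : (listInst lE lF hl hsub).m = E.card := hEm
    have e1 : E.card ≤ E.card * Eᶜ.card := Nat.le_mul_of_pos_right _ hz
    have e2 : Eᶜ.card ≤ E.card * Eᶜ.card := Nat.le_mul_of_pos_left _ hm
    have e3 : p ≤ p * q := by
      refine Nat.le_mul_of_pos_right _ (Nat.pos_of_ne_zero fun h0 => ?_)
      have := Nat.mul_eq_zero.2 (Or.inr h0 : p = 0 ∨ q = 0)
      omega
    have e4 : q ≤ p * q := by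
      refine Nat.le_mul_of_pos_left _ (Nat.pos_of_ne_zero fun h0 => ?_)
      have := Nat.mul_eq_zero.2 (Or.inl h0 : p = 0 ∨ q = 0)
      omega
    have hmain : Cmd.time cmdMain s1 ≤ 20000 * (E.card * Eᶜ.card) := by
      have := cmdMain_time hR (by rw [hDm]; exact hm) (by rw [hzeros]; exact hz)
        (show lF.length ≤ lE.length by omega)
        (by rw [hzeros, hDm]; exact hpq) ?_
      · rwa [hzeros, hDm] at this
      · rw [hzeros, hDm, hs1]
        -- Here p + q + m + 2 ≤ 7 m m̂, since p and q are at most pq = m + m̂ ≤ 2 m m̂.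
        exact (cmdInit_bounded hB (by omega)).mono (by omega)
    have htime' : Cmd.time cmdAll (startState lE lF) ≤ 20008 * (E.card * Eᶜ.card) := by
      rw [htime, if_neg (by omega), if_neg (by omega)]
      omega
    refine ⟨_, _, exec_program hM hB ?_, ?_, fun _ _ => ?_, fun h => absurd h hdeg⟩
    · have h1 : E.card * Eᶜ.card ≤ M * (M * M) :=
        Nat.mul_le_mul (by omega) ((show Eᶜ.card ≤ p * q by omega).trans
          (Nat.mul_le_mul (by omega) (by omega)))
      rw [← hMe]
      have h2 : M ^ 3 = M * (M * M) := by ring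
      omega
    · rw [hsem']
      exact isAnswer_of_answered hE hF hFE (cmdMain_spec hR)
    -- The summand m m̂ alone suffices; the minimum is merely nonnegative.
    · unfold timeBound
      rw [Nat.mul_add]
      omega
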